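/- Let $k$ be a commutative unital ring, $G$ a group with identity $1$, and let all algebras be associative, not necessarily unital $k$-algebras. Products of submodules denote $k$-spans of products of elements. For a $G$-graded algebra $A=\bigoplus_{t\in G}A_t$ put $D_t^A:=A_tA_{t^{-1}}$; $A$ is \emph{partially-strongly-graded} if $A_t=A_tA_{t^{-1}}A_t$ for all $t\in G$. A \emph{Morita context} $(A,B,X,Y,\tau_A,\tau_B)$ consists of algebras $A,B$, bimodules ${}_AX_B$, ${}_BY_A$ and bimodule maps $\tau_A:X\otimes_BY\to A$, $\tau_B:Y\otimes_AX\to B$ with $\tau_A(x\otimes y)x'=x\,\tau_B(y\otimes x')$ and $\tau_B(y\otimes x)y'=y\,\tau_A(x\otimes y')$; its context algebra is the algebra of matrices $\begin{pmatrix}a&x\\y&b\end{pmatrix}$. It is a \emph{Morita equivalence} if $AX=X=XB$, $BY=Y=YA$ and $\tau_A,\tau_B$ are surjective. Partially-strongly-$G$-graded algebras $A$ and $B$ are \emph{strongly-graded-equivalent} if there are a Morita context $(A,B,X,Y,\tau_A,\tau_B)$ with $\tau_A,\tau_B$ surjective and $G$-gradings $X=\bigoplus_tX_t$, $Y=\bigoplus_tY_t$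 making $X$, $Y$ graded bimodules, such that $\tau_A(X_r\otimes Y_s)\subseteq A_{rs}$ and $\tau_B(Y_r\otimes X_s)\subseteq B_{rs}$ for all $r,s\in G$, and for all $t\in G$: $D_t^AX_t=X_t=X_tD_{t^{-1}}^B$, $D_t^BY_t=Y_t=Y_tD_{t^{-1}}^A$, $\tau_A(X_t\otimes Y_{t^{-1}})=D_t^A$ and $\tau_B(Y_t\otimes X_{t^{-1}})=D_t^B$. A \emph{product partial action} $\alpha$ of $G$ on an algebra $A$ consists of two-sided ideals $D_t$ of $A$ and algebra isomorphisms $\alpha_t:D_{t^{-1}}\to D_t$ ($t\in G$) such that $\alpha_1=\mathrm{id}_A$, $D_t^2=D_t$, $D_sD_t=D_tD_s$, $\alpha_s(D_{s^{-1}}D_t)=D_sD_{st}$, and $\alpha_s(\alpha_t(x))=\alpha_{st}(x)$ for all $x\in D_{t^{-1}}D_{(st)^{-1}}$. Product partial actions $\alpha$ on $A$ and $\alpha'$ on $A'$, with domains $D_t$ and $D_t'$, are \emph{Morita equivalent} if there are a Morita equivalence $(A,A',X,Y,\tau_A,\tau_{A'})$ and a product partial action $\theta$ of $G$ on its context algebra,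 with domains $\bar D_t$, such that $\tau_{A'}(YD_t\otimes X)=D_t'$ for all $t\in G$, and $\theta$ restricts to $\alpha$ and to $\alpha'$ on the diagonal corners, i.e. $\bar D_t\cap A=D_t$, $\theta_t|_{D_{t^{-1}}}=\alpha_t$, $\bar D_t\cap A'=D'_t$, $\theta_t|_{D'_{t^{-1}}}=\alpha'_t$ for all $t\in G$. Let $B$ be a partially-strongly-$G$-graded algebra. Inside the algebra of $G\times G$-matrices over $B$ with finitely many non-zero entries, with $b\,e_{r,s}$ the matrix with entry $b$ at $(r,s)$ and $0$ elsewhere, let $B\#G=\bigoplus_{r,s}B_{r^{-1}s}e_{r,s}$, on which $G$ acts by $\beta_t(b\,e_{r,s})=b\,e_{tr,ts}$, and let $I^B=\bigoplus_{r,s}B_{r^{-1}}B_se_{r,s}$, an ideal of $B\#G$. The \emph{canonical partial action} $\gamma^B$ of $G$ on $I^B$ is the product partial action with domains $I^B_t=I^B\beta_t(I^B)$ and $\gamma^B_t=\beta_t|_{I^B_{t^{-1}}}$. \textbf{Statement.} Let $A$ and $B$ be partially-strongly-$G$-graded algebras. Then $A$ and $B$ are strongly-graded-equivalent if and only if their canonical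 partial actions $\gamma^A$ and $\gamma^B$ are Morita equivalent. -/

import Mathlib

universe uk uG uA uB uX uY

namespace GradedMorita

section SubmoduleProducts

variable {k : Type uk} [CommRing k] {A : Type uA} [NonUnitalRing A] [Module k A]
  [IsScalarTower k A A] [SMulCommClass k A A]

/-- The product `S T` of two `k`-submodules of a (not necessarily unital) `k`-algebra: the
`k`-submodule of all finite sums of products `s * t` with `s ∈ S`, `t ∈ T`. -/
def sprod (S T : Submodule k A) : Submodule k A :=
  Submodule.map₂ (LinearMap.mul k A) S T

infixl:70 " ⊡ " => sprod

theorem mul_mem_sprod {S T : Submodule k A} {a b : A} (ha : a ∈ S) (hb : b ∈ T) :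
    a * b ∈ S ⊡ T :=
  Submodule.apply_mem_map₂ (LinearMap.mul k A) ha hb

theorem sprod_le {S T U : Submodule k A} :
    S ⊡ T ≤ U ↔ ∀ a ∈ S, ∀ b ∈ T, a * b ∈ U :=
  Submodule.map₂_le (f := LinearMap.mul k A)

theorem sprod_mono {S S' T T' : Submodule k A} (h : S ≤ S') (h' : T ≤ T') :
    S ⊡ T ≤ S' ⊡ T' :=
  Submodule.map₂_le_map₂ h h'

theorem sprod_assoc (S T U : Submodule k A) : S ⊡ T ⊡ U = S ⊡ (T ⊡ U) := by
  apply le_antisymm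
  · rw [sprod_le]
    intro x hx u hu
    have : S ⊡ T ≤ (S ⊡ (T ⊡ U)).comap (LinearMap.mulRight k u) := by
      rw [sprod_le]
      intro s hs t ht
      simpa [mul_assoc] using! mul_mem_sprod hs (mul_mem_sprod ht hu)
    exact this hx
  · rw [sprod_le]
    intro s hs x hx
    have : T ⊡ U ≤ (S ⊡ T ⊡ U).comap (LinearMap.mulLeft k s) := by
      rw [sprod_le]
      intro t ht u hu
      simpa [mul_assoc] using! mul_mem_sprod (mul_mem_sprod hs ht) hu
    exact this hx

end SubmoduleProducts

section Gradings

/-- A grading of the `k`-algebra `A` by the group `G`: `A = ⨁ₜ Aₜ` as `k`-modules and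
`Aₛ Aₜ ⊆ Aₛₜ`. -/
structure GroupGrading (k : Type uk) (G : Type uG) (A : Type uA) [CommRing k] [Group G]
    [NonUnitalRing A] [Module k A] [IsScalarTower k A A] [SMulCommClass k A A] where
  comp : G → Submodule k A
  indep : iSupIndep comp
  iSup_eq_top : ⨆ t, comp t = ⊤
  mul_mem : ∀ (s t : G) (a b : A), a ∈ comp s → b ∈ comp t → a * b ∈ comp (s * t)

variable {k : Type uk} {G : Type uG} {A : Type uA} [CommRing k] [Group G]
    [NonUnitalRing A] [Module k A] [IsScalarTower k A A] [SMulCommClass k A A]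

/-- The two-sided ideal `Dₜ = Aₜ Aₜ⁻¹` of `A₁`. -/
def GroupGrading.D (𝒜 : GroupGrading k G A) (t : G) : Submodule k A :=
  𝒜.comp t ⊡ 𝒜.comp t⁻¹

/-- `A` is partially-strongly-graded: `Aₜ = Aₜ Aₜ⁻¹ Aₜ` for all `t`. -/
def GroupGrading.IsPartiallyStrong (𝒜 : GroupGrading k G A) : Prop :=
  ∀ t : G, 𝒜.comp t = 𝒜.comp t ⊡ 𝒜.comp t⁻¹ ⊡ 𝒜.comp t

namespace GroupGrading

variable {𝒜 : GroupGrading k G A}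

theorem sprod_comp_le (s t : G) : 𝒜.comp s ⊡ 𝒜.comp t ≤ 𝒜.comp (s * t) :=
  sprod_le.2 fun a ha b hb => 𝒜.mul_mem s t a b ha hb

theorem D_le (t : G) : 𝒜.D t ≤ 𝒜.comp 1 := by
  have h := sprod_comp_le (𝒜 := 𝒜) t t⁻¹
  rwa [mul_inv_cancel] at h

theorem inv_mul_comp (h : 𝒜.IsPartiallyStrong) (r s : G) :
    𝒜.comp r⁻¹ ⊡ (𝒜.comp r ⊡ 𝒜.comp s) = 𝒜.comp r⁻¹ ⊡ 𝒜.comp (r * s) := by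
  apply le_antisymm
  · exact sprod_mono le_rfl (sprod_comp_le r s)
  · have h1 := h r⁻¹
    rw [inv_inv] at h1
    have h2 := sprod_comp_le (𝒜 := 𝒜) r⁻¹ (r * s)
    rw [inv_mul_cancel_left] at h2
    calc 𝒜.comp r⁻¹ ⊡ 𝒜.comp (r * s)
        = 𝒜.comp r⁻¹ ⊡ 𝒜.comp r ⊡ 𝒜.comp r⁻¹ ⊡ 𝒜.comp (r * s) := by rw [← h1]
      _ = 𝒜.comp r⁻¹ ⊡ (𝒜.comp r ⊡ (𝒜.comp r⁻¹ ⊡ 𝒜.comp (r * s))) := by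
          simp only [sprod_assoc]
      _ ≤ _ := sprod_mono le_rfl (sprod_mono le_rfl h2)

theorem mul_comp_inv (h : 𝒜.IsPartiallyStrong) (s r : G) :
    𝒜.comp s ⊡ (𝒜.comp r ⊡ 𝒜.comp r⁻¹) = 𝒜.comp (s * r) ⊡ 𝒜.comp r⁻¹ := by
  apply le_antisymm
  · rw [← sprod_assoc]
    exact sprod_mono (sprod_comp_le s r) le_rfl
  · have h1 := h r⁻¹
    rw [inv_inv] at h1
    have h2 := sprod_comp_le (𝒜 := 𝒜) (s * r) r⁻¹
    rw [mul_inv_cancel_right] at h2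
    calc 𝒜.comp (s * r) ⊡ 𝒜.comp r⁻¹
        = 𝒜.comp (s * r) ⊡ (𝒜.comp r⁻¹ ⊡ 𝒜.comp r ⊡ 𝒜.comp r⁻¹) := by rw [← h1]
      _ = 𝒜.comp (s * r) ⊡ 𝒜.comp r⁻¹ ⊡ (𝒜.comp r ⊡ 𝒜.comp r⁻¹) := by
          simp only [sprod_assoc]
      _ ≤ _ := sprod_mono h2 le_rfl

theorem comp_D (h : 𝒜.IsPartiallyStrong) (t s : G) :
    𝒜.comp t ⊡ 𝒜.D s = 𝒜.D (t * s) ⊡ 𝒜.comp t := by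
  have h1 := inv_mul_comp h (t * s)⁻¹ t
  rw [inv_inv] at h1
  rw [D, D, mul_comp_inv h, sprod_assoc, h1]
  congr 2
  group

theorem D_comm (h : 𝒜.IsPartiallyStrong) (s t : G) : 𝒜.D s ⊡ 𝒜.D t = 𝒜.D t ⊡ 𝒜.D s := by
  calc 𝒜.D s ⊡ 𝒜.D t = 𝒜.comp s ⊡ (𝒜.comp s⁻¹ ⊡ 𝒜.D t) := by rw [D, sprod_assoc]
    _ = 𝒜.comp s ⊡ 𝒜.D (s⁻¹ * t) ⊡ 𝒜.comp s⁻¹ := by rw [comp_D h, sprod_assoc]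
    _ = 𝒜.D t ⊡ 𝒜.D s := by rw [comp_D h, mul_inv_cancel_left, sprod_assoc, ← D]

theorem D_comp (h : 𝒜.IsPartiallyStrong) (t : G) : 𝒜.D t ⊡ 𝒜.comp t = 𝒜.comp t :=
  (h t).symm

theorem D_idem (h : 𝒜.IsPartiallyStrong) (t : G) : 𝒜.D t ⊡ 𝒜.D t = 𝒜.D t := by
  calc 𝒜.D t ⊡ 𝒜.D t = 𝒜.D t ⊡ 𝒜.comp t ⊡ 𝒜.comp t⁻¹ := by rw [sprod_assoc, ← D]
    _ = 𝒜.D t := by rw [D_comp h, ← D]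

theorem one_comp (h : 𝒜.IsPartiallyStrong) (t : G) : 𝒜.comp 1 ⊡ 𝒜.comp t = 𝒜.comp t := by
  apply le_antisymm
  · simpa using 𝒜.sprod_comp_le 1 t
  · calc 𝒜.comp t = 𝒜.D t ⊡ 𝒜.comp t := (D_comp h t).symm
      _ ≤ _ := sprod_mono (D_le t) le_rfl

theorem D_one (h : 𝒜.IsPartiallyStrong) : 𝒜.D 1 = 𝒜.comp 1 := by
  rw [D, inv_one, one_comp h]

theorem one_D (h : 𝒜.IsPartiallyStrong) (t : G) : 𝒜.comp 1 ⊡ 𝒜.D t = 𝒜.D t := by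
  rw [D, ← sprod_assoc, one_comp h]

theorem D_one_D (h : 𝒜.IsPartiallyStrong) (t : G) : 𝒜.D 1 ⊡ 𝒜.D t = 𝒜.D t := by
  rw [D_one h, one_D h]

theorem D_D_le (h : 𝒜.IsPartiallyStrong) (s t : G) : 𝒜.D s ⊡ 𝒜.D t ≤ 𝒜.D t := by
  calc 𝒜.D s ⊡ 𝒜.D t ≤ 𝒜.comp 1 ⊡ 𝒜.D t := sprod_mono (D_le s) le_rfl
    _ = _ := one_D h t

end GroupGrading

end Gradings

section PartialActions

/-- A product partial action of `G` on the `k`-algebra `A`: two-sided ideals `Dₜ` and algebra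
isomorphisms `αₜ : Dₜ⁻¹ → Dₜ` such that `α₁ = id_A`, `Dₜ² = Dₜ`, `Dₛ Dₜ = Dₜ Dₛ`,
`αₛ (Dₛ⁻¹ Dₜ) = Dₛ Dₛₜ`, and `αₛ (αₜ x) = αₛₜ x` for `x ∈ Dₜ⁻¹ D₍ₛₜ₎⁻¹`. -/
structure ProductPartialAction (k : Type uk) (G : Type uG) (A : Type uA) [CommRing k] [Group G]
    [NonUnitalRing A] [Module k A] [IsScalarTower k A A] [SMulCommClass k A A] where
  D : G → Submodule k A
  mul_mem_left : ∀ (t : G) (a x : A), x ∈ D t → a * x ∈ D t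
  mul_mem_right : ∀ (t : G) (x a : A), x ∈ D t → x * a ∈ D t
  α : ∀ t : G, D t⁻¹ ≃ₗ[k] D t
  map_mul : ∀ (t : G) (x y : D t⁻¹) (hxy : (x : A) * y ∈ D t⁻¹),
    (α t ⟨x * y, hxy⟩ : A) = α t x * α t y
  D_one : D 1 = ⊤
  α_one : ∀ x : D 1⁻¹, (α 1 x : A) = x
  D_idem : ∀ t : G, D t ⊡ D t = D t
  D_comm : ∀ s t : G, D s ⊡ D t = D t ⊡ D s
  image_eq : ∀ s t : G,
    ((D s⁻¹ ⊡ D t).comap (D s⁻¹).subtype).map ((D s).subtype ∘ₗ (α s).toLinearMap) =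
      D s ⊡ D (s * t)
  -- the memberships `h₁`, `h₂`, `h₃` follow from `x ∈ D t⁻¹ ⊡ D (s * t)⁻¹` and the other axioms
  comp_eq : ∀ (s t : G) (x : A), x ∈ D t⁻¹ ⊡ D (s * t)⁻¹ →
    ∀ (h₁ : x ∈ D t⁻¹) (h₂ : x ∈ D (s * t)⁻¹) (h₃ : (α t ⟨x, h₁⟩ : A) ∈ D s⁻¹),
      (α s ⟨α t ⟨x, h₁⟩, h₃⟩ : A) = α (s * t) ⟨x, h₂⟩

end PartialActions

section FiniteMatrices

/-- The `G × G` matrices over `B` with only finitely many non-zero entries. -/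
def FMat (G : Type uG) (B : Type uB) [Zero B] : Type (max uG uB) := G × G →₀ B

namespace FMat

variable {G : Type uG} {B : Type uB}

instance [Zero B] : FunLike (FMat G B) (G × G) B :=
  inferInstanceAs (FunLike (G × G →₀ B) (G × G) B)

noncomputable instance [NonUnitalRing B] : AddCommGroup (FMat G B) :=
  inferInstanceAs (AddCommGroup (G × G →₀ B))

noncomputable instance {k : Type uk} [CommRing k] [NonUnitalRing B] [Module k B] :
    Module k (FMat G B) :=
  inferInstanceAs (Module k (G × G →₀ B))

/-- The matrix with entry `b` at the position `p` and `0` elsewhere. -/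
noncomputable def single [Zero B] (p : G × G) (b : B) : FMat G B := Finsupp.single p b

variable [NonUnitalRing B]

open Classical in
/-- Matrix multiplication: the biadditive extension of
`(a e_{r,s}) (b e_{u,v}) = [s = u] a b e_{r,v}`. -/
noncomputable def mulAux (M N : G × G →₀ B) : G × G →₀ B :=
  M.sum fun p a => N.sum fun q b => if p.2 = q.1 then Finsupp.single (p.1, q.2) (a * b) else 0

noncomputable instance : Mul (FMat G B) where
  mul M N := mulAux M N

theorem single_zero (p : G × G) : single p (0 : B) = 0 := Finsupp.single_zero p

theorem single_add (p : G × G) (a b : B) : single p (a + b) = single p a + single p b :=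
  Finsupp.single_add p a b

theorem mulAux_add (M N P : G × G →₀ B) : mulAux M (N + P) = mulAux M N + mulAux M P := by
  classical
  simp only [mulAux]
  rw [← Finsupp.sum_add]
  refine Finsupp.sum_congr fun p _ => ?_
  refine Finsupp.sum_add_index' ?_ ?_
  · intro q; simp
  · intro q b c; split_ifs <;> simp [mul_add]

theorem add_mulAux (M N P : G × G →₀ B) : mulAux (M + N) P = mulAux M P + mulAux N P := by
  classical
  simp only [mulAux]
  refine Finsupp.sum_add_index' ?_ ?_
  · intro q; simp
  · intro q b c
    rw [← Finsupp.sum_add]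
    refine Finsupp.sum_congr fun p _ => ?_
    split_ifs <;> simp [add_mul]

open Classical in
theorem single_mulAux_single (p q : G × G) (a b : B) :
    mulAux (Finsupp.single p a) (Finsupp.single q b) =
      if p.2 = q.1 then Finsupp.single (p.1, q.2) (a * b) else 0 := by
  rw [mulAux, Finsupp.sum_single_index, Finsupp.sum_single_index]
  · simp
  · simp

protected theorem mul_add (M N P : FMat G B) : M * (N + P) = M * N + M * P :=
  mulAux_add M N P

protected theorem add_mul (M N P : FMat G B) : (M + N) * P = M * P + N * P :=
  add_mulAux M N P

protected theorem zero_mul (M : FMat G B) : 0 * M = 0 := by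
  simpa using FMat.add_mul 0 0 M

protected theorem mul_zero (M : FMat G B) : M * 0 = 0 := by
  simpa using FMat.mul_add M 0 0

open Classical in
theorem single_mul_single (p q : G × G) (a b : B) :
    single p a * single q b = if p.2 = q.1 then single (p.1, q.2) (a * b) else 0 :=
  single_mulAux_single p q a b

theorem induction_on {P : FMat G B → Prop} (M : FMat G B) (h0 : P 0)
    (hadd : ∀ M N, P M → P N → P (M + N)) (hs : ∀ p b, P (single p b)) : P M :=
  Finsupp.induction_linear M h0 hadd hs

protected theorem mul_assoc (M N P : FMat G B) : M * N * P = M * (N * P) := by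
  classical
  induction M using induction_on with
  | h0 => simp only [FMat.zero_mul]
  | hadd M M' h h' => simp only [FMat.add_mul, h, h']
  | hs p a =>
  induction N using induction_on with
  | h0 => simp only [FMat.zero_mul, FMat.mul_zero]
  | hadd M M' h h' => simp only [FMat.add_mul, FMat.mul_add, h, h']
  | hs q b =>
  induction P using induction_on with
  | h0 => simp only [FMat.mul_zero]
  | hadd M M' h h' => simp only [FMat.mul_add, h, h']
  | hs r c =>
  rw [single_mul_single, single_mul_single]
  split_ifs with h1 h2 h2
  · rw [single_mul_single, single_mul_single, if_pos h1, if_pos h2, mul_assoc]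
  · rw [single_mul_single, if_neg h2, FMat.mul_zero]
  · rw [single_mul_single, if_neg h1, FMat.zero_mul]
  · rw [FMat.zero_mul, FMat.mul_zero]

noncomputable instance : NonUnitalRing (FMat G B) :=
  { (inferInstance : AddCommGroup (FMat G B)), (inferInstance : Mul (FMat G B)) with
    left_distrib := FMat.mul_add
    right_distrib := FMat.add_mul
    zero_mul := FMat.zero_mul
    mul_zero := FMat.mul_zero
    mul_assoc := FMat.mul_assoc }

variable {k : Type uk} [CommRing k] [Module k B]

theorem smul_single (c : k) (p : G × G) (b : B) : c • single p b = single p (c • b) :=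
  Finsupp.smul_single c p b

instance [IsScalarTower k B B] : IsScalarTower k (FMat G B) (FMat G B) where
  smul_assoc c M N := by
    classical
    simp only [smul_eq_mul]
    induction M using induction_on with
    | h0 => simp only [smul_zero, zero_mul]
    | hadd M M' h h' => simp only [smul_add, add_mul, h, h']
    | hs p a =>
    induction N using induction_on with
    | h0 => simp only [smul_zero, mul_zero]
    | hadd M M' h h' => simp only [smul_add, mul_add, h, h']
    | hs q b =>
    rw [smul_single, single_mul_single, single_mul_single]
    split_ifs
    · rw [smul_single, smul_mul_assoc]
    · rw [smul_zero]

instance [SMulCommClass k B B] : SMulCommClass k (FMat G B) (FMat G B) where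
  smul_comm c M N := by
    classical
    simp only [smul_eq_mul]
    induction M using induction_on with
    | h0 => simp only [smul_zero, zero_mul]
    | hadd M M' h h' => simp only [smul_add, add_mul, h, h']
    | hs p a =>
    induction N using induction_on with
    | h0 => simp only [smul_zero, mul_zero]
    | hadd M M' h h' => simp only [smul_add, mul_add, h, h']
    | hs q b =>
    rw [smul_single, single_mul_single, single_mul_single]
    split_ifs
    · rw [smul_single, mul_smul_comm]
    · rw [smul_zero]

/-- For submodules `S r s ⊆ B`, the submodule `⨁_{r,s} (S r s) e_{r,s}` of all finite matrices
whose `(r,s)`-entry lies in `S r s`. -/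
def entrywise (S : G → G → Submodule k B) : Submodule k (FMat G B) where
  carrier := {M | ∀ r s : G, M (r, s) ∈ S r s}
  add_mem' := fun {_ _} h h' r s => (S r s).add_mem (h r s) (h' r s)
  zero_mem' := fun r s => (S r s).zero_mem
  smul_mem' := fun c _ h r s => (S r s).smul_mem c (h r s)

theorem mem_entrywise {S : G → G → Submodule k B} {M : FMat G B} :
    M ∈ entrywise S ↔ ∀ r s : G, M (r, s) ∈ S r s := Iff.rfl

theorem single_mem {S : G → G → Submodule k B} {p : G × G} {b : B} (hb : b ∈ S p.1 p.2) :
    single p b ∈ entrywise S := by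
  classical
  intro r s
  change (Finsupp.single p b) (r, s) ∈ S r s
  rw [Finsupp.single_apply]
  split_ifs with h
  · subst h; exact hb
  · exact zero_mem _

theorem entrywise_le {S : G → G → Submodule k B} {U : Submodule k (FMat G B)}
    (h : ∀ (p : G × G), ∀ b ∈ S p.1 p.2, single p b ∈ U) : entrywise S ≤ U := by
  intro M hM
  have : M = Finsupp.sum M fun p b => single p b := (Finsupp.sum_single M).symm
  rw [this]
  exact Submodule.sum_mem _ fun p _ => h p _ (hM p.1 p.2)

theorem entrywise_mono {S T : G → G → Submodule k B} (h : ∀ r s, S r s ≤ T r s) :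
    entrywise S ≤ entrywise T := fun _ hM r s => h r s (hM r s)

theorem entrywise_sprod [IsScalarTower k B B] [SMulCommClass k B B]
    (S T : G → G → Submodule k B) :
    entrywise S ⊡ entrywise T = entrywise fun r v => ⨆ u, S r u ⊡ T u v := by
  classical
  apply le_antisymm
  · have key : ∀ (p : G × G), ∀ a ∈ S p.1 p.2, ∀ (q : G × G), ∀ b ∈ T q.1 q.2,
        single p a * single q b ∈ entrywise fun r v => ⨆ u, S r u ⊡ T u v := by
      intro p a ha q b hb
      rw [single_mul_single]
      split_ifs with h
      · refine single_mem (Submodule.mem_iSup_of_mem p.2 (mul_mem_sprod ha ?_))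
        rw [h]; exact hb
      · exact zero_mem _
    rw [sprod_le]
    intro M hM N hN
    have h1 : ∀ (q : G × G), ∀ b ∈ T q.1 q.2,
        M * single q b ∈ entrywise fun r v => ⨆ u, S r u ⊡ T u v := by
      intro q b hb
      have : entrywise S ≤ (entrywise fun r v => ⨆ u, S r u ⊡ T u v).comap
          (LinearMap.mulRight k (single q b)) := entrywise_le fun p a ha => key p a ha q b hb
      exact this hM
    have h2 : entrywise T ≤ (entrywise fun r v => ⨆ u, S r u ⊡ T u v).comap
          (LinearMap.mulLeft k M) := entrywise_le fun q b hb => h1 q b hb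
    exact h2 hN
  · refine entrywise_le fun p => ?_
    have : (⨆ u, S p.1 u ⊡ T u p.2) ≤
        (entrywise S ⊡ entrywise T).comap (Finsupp.lsingle (R := k) p : B →ₗ[k] FMat G B) := by
      refine iSup_le fun u => sprod_le.2 fun a ha b hb => ?_
      change single p (a * b) ∈ entrywise S ⊡ entrywise T
      have h1 := single_mul_single (p.1, u) (u, p.2) a b
      rw [if_pos rfl] at h1
      rw [show p = (p.1, p.2) from rfl, ← h1]
      exact mul_mem_sprod (single_mem ha) (single_mem hb)
    exact fun b hb => Submodule.mem_comap.1 (this hb)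

variable [Group G]

/-- The action of `G` on matrices, `(t · M) (r, s) = M (t⁻¹ r, t⁻¹ s)`, that is
`t · (b e_{r,s}) = b e_{tr,ts}`. -/
noncomputable def shift (k : Type uk) [CommRing k] [Module k B] (t : G) :
    FMat G B ≃ₗ[k] FMat G B :=
  Finsupp.domLCongr ((Equiv.mulLeft t).prodCongr (Equiv.mulLeft t))

theorem shift_apply (t : G) (M : FMat G B) (r s : G) :
    shift k t M (r, s) = M (t⁻¹ * r, t⁻¹ * s) := rfl

theorem shift_single (t : G) (p : G × G) (b : B) :
    shift k t (single p b) = single (t * p.1, t * p.2) b :=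
  Finsupp.equivMapDomain_single _ _ _

theorem shift_one (M : FMat G B) : shift k 1 M = M := by
  refine DFunLike.ext _ _ fun p => ?_
  obtain ⟨r, s⟩ := p
  rw [shift_apply, inv_one, one_mul, one_mul]

theorem shift_shift (s t : G) (M : FMat G B) : shift k s (shift k t M) = shift k (s * t) M := by
  refine DFunLike.ext _ _ fun p => ?_
  obtain ⟨r, s⟩ := p
  simp only [shift_apply, mul_inv_rev, mul_assoc]

theorem shift_mul (t : G) (M N : FMat G B) : shift k t (M * N) = shift k t M * shift k t N := by
  classical
  induction M using induction_on with
  | h0 => simp only [map_zero, zero_mul]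
  | hadd M M' h h' => simp only [map_add, add_mul, h, h']
  | hs p a =>
  induction N using induction_on with
  | h0 => simp only [map_zero, mul_zero]
  | hadd M M' h h' => simp only [map_add, mul_add, h, h']
  | hs q b =>
  rw [shift_single, shift_single, single_mul_single, single_mul_single]
  simp only [mul_right_inj]
  split_ifs
  · rw [shift_single]
  · rw [map_zero]

theorem map_shift_entrywise (t : G) (S : G → G → Submodule k B) :
    (entrywise S).map (shift k t).toLinearMap =
      entrywise fun r s => S (t⁻¹ * r) (t⁻¹ * s) := by
  ext M
  constructor
  · rintro ⟨N, hN, rfl⟩ r s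
    exact hN _ _
  · intro hM
    refine ⟨shift k t⁻¹ M, fun r s => ?_, ?_⟩
    · have := hM (t * r) (t * s)
      rw [shift_apply]
      simpa using this
    · change shift k t (shift k t⁻¹ M) = M
      rw [shift_shift, mul_inv_cancel, shift_one]

end FMat

end FiniteMatrices

section CanonicalPartialAction

variable {k : Type uk} {G : Type uG} {B : Type uB} [CommRing k] [Group G]
    [NonUnitalRing B] [Module k B] [IsScalarTower k B B] [SMulCommClass k B B]

namespace GroupGrading

/-- The smash product `B # G = ⨁_{r,s} B_{r⁻¹s} e_{r,s}`, as a subalgebra of the algebra of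
finite `G × G` matrices. -/
def smash (ℬ : GroupGrading k G B) : NonUnitalSubalgebra k (FMat G B) :=
  { FMat.entrywise (fun r s => ℬ.comp (r⁻¹ * s)) with
    mul_mem' := by
      intro M N hM hN
      have h : FMat.entrywise (fun r s => ℬ.comp (r⁻¹ * s)) ⊡
          FMat.entrywise (fun r s => ℬ.comp (r⁻¹ * s)) ≤
          FMat.entrywise (fun r s => ℬ.comp (r⁻¹ * s)) := by
        rw [FMat.entrywise_sprod]
        refine FMat.entrywise_mono fun r s => iSup_le fun u => ?_
        have := sprod_comp_le (𝒜 := ℬ) (r⁻¹ * u) (u⁻¹ * s)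
        rwa [mul_assoc, mul_inv_cancel_left] at this
      exact h (mul_mem_sprod hM hN) }

/-- The underlying submodule `⨁_{r,s} B_{r⁻¹} B_s e_{r,s}` of the partial smash product. -/
def partialSmashSubmodule (ℬ : GroupGrading k G B) : Submodule k (FMat G B) :=
  FMat.entrywise fun r s => ℬ.comp r⁻¹ ⊡ ℬ.comp s

theorem partialSmashSubmodule_le (ℬ : GroupGrading k G B) :
    ℬ.partialSmashSubmodule ≤ ℬ.smash.toSubmodule :=
  FMat.entrywise_mono fun r s => sprod_comp_le r⁻¹ s

theorem smash_sprod_partialSmash_le (ℬ : GroupGrading k G B) :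
    ℬ.smash.toSubmodule ⊡ ℬ.partialSmashSubmodule ≤ ℬ.partialSmashSubmodule := by
  refine (FMat.entrywise_sprod _ _).trans_le (FMat.entrywise_mono fun r s => iSup_le fun u => ?_)
  rw [← sprod_assoc]
  refine sprod_mono ?_ le_rfl
  simpa using sprod_comp_le (𝒜 := ℬ) (r⁻¹ * u) u⁻¹

theorem partialSmash_sprod_smash_le (ℬ : GroupGrading k G B) :
    ℬ.partialSmashSubmodule ⊡ ℬ.smash.toSubmodule ≤ ℬ.partialSmashSubmodule := by
  refine (FMat.entrywise_sprod _ _).trans_le (FMat.entrywise_mono fun r s => iSup_le fun u => ?_)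
  rw [sprod_assoc]
  refine sprod_mono le_rfl ?_
  simpa using sprod_comp_le (𝒜 := ℬ) u (u⁻¹ * s)

/-- The partial smash product `I = ⨁_{r,s} B_{r⁻¹} B_s e_{r,s}`, a two-sided ideal of `B # G`
(by the three preceding facts), as an algebra. -/
def partialSmash (ℬ : GroupGrading k G B) : NonUnitalSubalgebra k (FMat G B) :=
  { ℬ.partialSmashSubmodule with
    mul_mem' := fun {_ _} hM hN =>
      ℬ.smash_sprod_partialSmash_le (mul_mem_sprod (ℬ.partialSmashSubmodule_le hM) hN) }

/-- The domain `Iₜ = I βₜ(I)`, where `β` is the dual action `βₜ (b e_{r,s}) = b e_{tr,ts}`. -/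
noncomputable def smashDomain (ℬ : GroupGrading k G B) (t : G) : Submodule k (FMat G B) :=
  ℬ.partialSmashSubmodule ⊡ ℬ.partialSmashSubmodule.map (FMat.shift k t).toLinearMap

variable {ℬ : GroupGrading k G B}

theorem smashDomain_eq (h : ℬ.IsPartiallyStrong) (t : G) : ℬ.smashDomain t =
    FMat.entrywise fun r s => ℬ.comp r⁻¹ ⊡ (ℬ.D t ⊡ ℬ.comp s) := by
  rw [smashDomain, partialSmashSubmodule, FMat.map_shift_entrywise, FMat.entrywise_sprod]
  congr 1
  funext r s
  have term : ∀ u : G, ℬ.comp r⁻¹ ⊡ ℬ.comp u ⊡ (ℬ.comp (t⁻¹ * u)⁻¹ ⊡ ℬ.comp (t⁻¹ * s)) =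
      ℬ.comp r⁻¹ ⊡ (ℬ.D u ⊡ ℬ.D t ⊡ ℬ.comp s) := by
    intro u
    have h1 := inv_mul_comp h u⁻¹ t
    have h2 := inv_mul_comp h t⁻¹ s
    rw [inv_inv] at h1 h2
    rw [mul_inv_rev, inv_inv]
    calc _ = ℬ.comp r⁻¹ ⊡ (ℬ.comp u ⊡ ℬ.comp (u⁻¹ * t) ⊡ ℬ.comp (t⁻¹ * s)) := by
            simp only [sprod_assoc]
      _ = ℬ.comp r⁻¹ ⊡ (ℬ.comp u ⊡ (ℬ.comp u⁻¹ ⊡ (ℬ.comp t ⊡ ℬ.comp (t⁻¹ * s)))) := by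
            rw [← h1]; simp only [sprod_assoc]
      _ = _ := by rw [← h2]; simp only [D, sprod_assoc]
  simp only [term]
  apply le_antisymm
  · exact iSup_le fun u => sprod_mono le_rfl (sprod_mono (D_D_le h u t) le_rfl)
  · refine le_trans (le_of_eq ?_) (le_iSup _ 1)
    rw [D_one_D h]

theorem smashDomain_sprod (h : ℬ.IsPartiallyStrong) (s t : G) :
    ℬ.smashDomain s ⊡ ℬ.smashDomain t =
      FMat.entrywise fun r v => ℬ.comp r⁻¹ ⊡ (ℬ.D s ⊡ ℬ.D t ⊡ ℬ.comp v) := by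
  rw [smashDomain_eq h, smashDomain_eq h, FMat.entrywise_sprod]
  congr 1
  funext r v
  have term : ∀ u : G, ℬ.comp r⁻¹ ⊡ (ℬ.D s ⊡ ℬ.comp u) ⊡ (ℬ.comp u⁻¹ ⊡ (ℬ.D t ⊡ ℬ.comp v)) =
      ℬ.comp r⁻¹ ⊡ (ℬ.D s ⊡ (ℬ.D u ⊡ ℬ.D t) ⊡ ℬ.comp v) := by
    intro u
    simp only [D, sprod_assoc]
  simp only [term]
  apply le_antisymm
  · exact iSup_le fun u => sprod_mono le_rfl
      (sprod_mono (sprod_mono le_rfl (D_D_le h u t)) le_rfl)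
  · refine le_trans (le_of_eq ?_) (le_iSup _ 1)
    rw [D_one_D h]

theorem map_shift_smashDomain_sprod (h : ℬ.IsPartiallyStrong) (s t : G) :
    (ℬ.smashDomain s⁻¹ ⊡ ℬ.smashDomain t).map (FMat.shift k s).toLinearMap =
      ℬ.smashDomain s ⊡ ℬ.smashDomain (s * t) := by
  rw [smashDomain_sprod h, smashDomain_sprod h, FMat.map_shift_entrywise]
  congr 1
  funext r v
  have h1 := mul_comp_inv h r⁻¹ s
  have h2 := inv_mul_comp h s⁻¹ v
  rw [inv_inv] at h2
  rw [mul_inv_rev, inv_inv]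
  calc _ = ℬ.comp (r⁻¹ * s) ⊡ ℬ.comp s⁻¹ ⊡ (ℬ.comp s ⊡ ℬ.D t ⊡ ℬ.comp (s⁻¹ * v)) := by
          simp only [D, sprod_assoc, inv_inv]
    _ = ℬ.comp r⁻¹ ⊡ ℬ.D s ⊡ (ℬ.D (s * t) ⊡ (ℬ.comp s ⊡ ℬ.comp (s⁻¹ * v))) := by
          rw [← h1, comp_D h, ← D, sprod_assoc (ℬ.D (s * t))]
    _ = ℬ.comp r⁻¹ ⊡ (ℬ.D s ⊡ (ℬ.D (s * t) ⊡ ℬ.D s) ⊡ ℬ.comp v) := by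
          rw [← h2]; simp only [D, sprod_assoc]
    _ = _ := by rw [D_comm h (s * t) s, ← sprod_assoc (ℬ.D s), D_idem h]

theorem smashDomain_one (h : ℬ.IsPartiallyStrong) :
    ℬ.smashDomain 1 = ℬ.partialSmashSubmodule := by
  rw [smashDomain_eq h, partialSmashSubmodule]
  simp only [D_one h, one_comp h]

theorem smashDomain_idem (h : ℬ.IsPartiallyStrong) (t : G) :
    ℬ.smashDomain t ⊡ ℬ.smashDomain t = ℬ.smashDomain t := by
  rw [smashDomain_sprod h, D_idem h, smashDomain_eq h]

theorem smashDomain_comm (h : ℬ.IsPartiallyStrong) (s t : G) :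
    ℬ.smashDomain s ⊡ ℬ.smashDomain t = ℬ.smashDomain t ⊡ ℬ.smashDomain s := by
  rw [smashDomain_sprod h, smashDomain_sprod h, D_comm h]

theorem one_smashDomain (h : ℬ.IsPartiallyStrong) (t : G) :
    ℬ.partialSmashSubmodule ⊡ ℬ.smashDomain t = ℬ.smashDomain t := by
  rw [← smashDomain_one h, smashDomain_sprod h, D_one_D h, smashDomain_eq h]

theorem smashDomain_le (h : ℬ.IsPartiallyStrong) (t : G) :
    ℬ.smashDomain t ≤ ℬ.partialSmashSubmodule := by
  rw [smashDomain_eq h]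
  refine FMat.entrywise_mono fun r s => sprod_mono le_rfl ?_
  calc _ ≤ ℬ.comp 1 ⊡ ℬ.comp s := sprod_mono (D_le t) le_rfl
    _ = _ := one_comp h s

theorem shift_mem_smashDomain (h : ℬ.IsPartiallyStrong) (t : G) {M : FMat G B}
    (hM : M ∈ ℬ.smashDomain t⁻¹) : FMat.shift k t M ∈ ℬ.smashDomain t := by
  have h1 := map_shift_smashDomain_sprod h t 1
  rw [mul_one, smashDomain_idem h, smashDomain_comm h, smashDomain_one h,
    one_smashDomain h] at h1
  rw [← h1]
  exact ⟨M, hM, rfl⟩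

/-- The inclusion of `I` in the algebra of finite matrices. -/
def partialSmashIncl (ℬ : GroupGrading k G B) : ℬ.partialSmash →ₗ[k] FMat G B where
  toFun x := x.1
  map_add' _ _ := rfl
  map_smul' _ _ := rfl

/-- `Iₜ` as a submodule of the algebra `I`. -/
noncomputable def smashIdeal (ℬ : GroupGrading k G B) (t : G) : Submodule k ℬ.partialSmash :=
  (ℬ.smashDomain t).comap ℬ.partialSmashIncl

theorem mem_smashIdeal {t : G} {x : ℬ.partialSmash} :
    x ∈ ℬ.smashIdeal t ↔ (x : FMat G B) ∈ ℬ.smashDomain t := Iff.rfl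

theorem smashIdeal_sprod (h : ℬ.IsPartiallyStrong) (s t : G) :
    ℬ.smashIdeal s ⊡ ℬ.smashIdeal t =
      (ℬ.smashDomain s ⊡ ℬ.smashDomain t).comap ℬ.partialSmashIncl := by
  apply le_antisymm
  · rw [sprod_le]
    intro a ha b hb
    exact mul_mem_sprod (mem_smashIdeal.1 ha) (mem_smashIdeal.1 hb)
  · have key : ℬ.smashDomain s ⊡ ℬ.smashDomain t ≤
        (ℬ.smashIdeal s ⊡ ℬ.smashIdeal t).map ℬ.partialSmashIncl := by
      rw [sprod_le]
      intro a ha b hb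
      exact ⟨(⟨a, smashDomain_le h s ha⟩ : ℬ.partialSmash) * ⟨b, smashDomain_le h t hb⟩,
        mul_mem_sprod (mem_smashIdeal.2 ha) (mem_smashIdeal.2 hb), rfl⟩
    intro x hx
    obtain ⟨y, hy, hyx⟩ := key hx
    have : y = x := Subtype.ext hyx
    exact this ▸ hy

/-- The map `γₜ : Iₜ⁻¹ → Iₜ`, the restriction of `βₜ`. -/
noncomputable def smashMap (h : ℬ.IsPartiallyStrong) (t : G) :
    ℬ.smashIdeal t⁻¹ ≃ₗ[k] ℬ.smashIdeal t where
  toFun x := ⟨⟨FMat.shift k t x.1.1, smashDomain_le h t (shift_mem_smashDomain h t x.2)⟩,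
    shift_mem_smashDomain h t x.2⟩
  map_add' x y := by
    apply Subtype.ext; apply Subtype.ext
    exact map_add (FMat.shift k t) x.1.1 y.1.1
  map_smul' c x := by
    apply Subtype.ext; apply Subtype.ext
    exact map_smul (FMat.shift k t) c x.1.1
  invFun x := ⟨⟨FMat.shift k t⁻¹ x.1.1, smashDomain_le h t⁻¹ (shift_mem_smashDomain h t⁻¹
      (by rw [inv_inv]; exact x.2))⟩,
    shift_mem_smashDomain h t⁻¹ (by rw [inv_inv]; exact x.2)⟩
  left_inv x := by
    apply Subtype.ext; apply Subtype.ext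
    change FMat.shift k t⁻¹ (FMat.shift k t x.1.1) = x.1.1
    rw [FMat.shift_shift, inv_mul_cancel, FMat.shift_one]
  right_inv x := by
    apply Subtype.ext; apply Subtype.ext
    change FMat.shift k t (FMat.shift k t⁻¹ x.1.1) = x.1.1
    rw [FMat.shift_shift, mul_inv_cancel, FMat.shift_one]

theorem smashMap_coe (h : ℬ.IsPartiallyStrong) (t : G) (x : ℬ.smashIdeal t⁻¹) :
    ((smashMap h t x : ℬ.partialSmash) : FMat G B) = FMat.shift k t x.1.1 := rfl

/-- The canonical partial action `γ` of `G` on the partial smash product `I` of a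
partially-strongly-graded algebra: the restriction to `I` of the dual action `β` of `G` on
`B # G`, with domains `Iₜ = I βₜ(I)`. -/
noncomputable def canonicalPartialAction (ℬ : GroupGrading k G B) (h : ℬ.IsPartiallyStrong) :
    ProductPartialAction k G ℬ.partialSmash where
  D := ℬ.smashIdeal
  mul_mem_left t a x hx := by
    rw [mem_smashIdeal, ← one_smashDomain h]
    exact mul_mem_sprod a.2 hx
  mul_mem_right t x a hx := by
    rw [mem_smashIdeal, ← one_smashDomain h, ← smashDomain_one h, smashDomain_comm h,
      smashDomain_one h]
    exact mul_mem_sprod hx a.2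
  α := smashMap h
  map_mul t x y hxy := Subtype.ext (FMat.shift_mul t x.1.1 y.1.1)
  D_one := by
    rw [eq_top_iff]
    intro x _
    rw [mem_smashIdeal, smashDomain_one h]
    exact x.2
  α_one x := Subtype.ext (FMat.shift_one x.1.1)
  D_idem t := by rw [smashIdeal_sprod h, smashDomain_idem h]; rfl
  D_comm s t := by rw [smashIdeal_sprod h, smashIdeal_sprod h, smashDomain_comm h]
  image_eq s t := by
    rw [smashIdeal_sprod h, smashIdeal_sprod h, ← map_shift_smashDomain_sprod h]
    ext x
    constructor
    · rintro ⟨y, hy, rfl⟩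
      exact ⟨y.1.1, hy, rfl⟩
    · rintro ⟨M, hM, hMx⟩
      have hM' : M ∈ ℬ.smashDomain s⁻¹ := by
        have h1 : ℬ.smashDomain s⁻¹ ⊡ ℬ.smashDomain t ≤ ℬ.smashDomain s⁻¹ := by
          rw [smashDomain_comm h]
          calc _ ≤ ℬ.partialSmashSubmodule ⊡ ℬ.smashDomain s⁻¹ :=
                sprod_mono (smashDomain_le h t) le_rfl
            _ = _ := one_smashDomain h _
        exact h1 hM
      exact ⟨⟨⟨M, smashDomain_le h _ hM'⟩, hM'⟩, hM, Subtype.ext hMx⟩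
  comp_eq s t x _ h₁ h₂ h₃ := Subtype.ext (FMat.shift_shift s t x.1)

end GroupGrading

end CanonicalPartialAction

section MoritaContexts

/-- A Morita context `(A, B, X, Y, τ_A, τ_B)`: an `(A, B)`-bimodule `X`, a `(B, A)`-bimodule `Y`,
an `(A, A)`-bimodule map `τ_A : X ⊗_B Y → A` and a `(B, B)`-bimodule map `τ_B : Y ⊗_A X → B` with
`τ_A(x ⊗ y) x' = x τ_B(y ⊗ x')` and `τ_B(y ⊗ x) y' = y τ_A(x ⊗ y')`. The maps out of the balanced
tensor products are given as balanced `k`-bilinear maps. -/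
structure MoritaContext (k : Type uk) (A : Type uA) (B : Type uB) (X : Type uX) (Y : Type uY)
    [CommRing k]
    [NonUnitalRing A] [Module k A] [IsScalarTower k A A] [SMulCommClass k A A]
    [NonUnitalRing B] [Module k B] [IsScalarTower k B B] [SMulCommClass k B B]
    [AddCommGroup X] [Module k X] [AddCommGroup Y] [Module k Y] where
  /-- the left action `a x` on `X` -/
  lX : A →ₗ[k] X →ₗ[k] X
  /-- the right action `x b` on `X` -/
  rX : X →ₗ[k] B →ₗ[k] X
  /-- the left action `b y` on `Y` -/
  lY : B →ₗ[k] Y →ₗ[k] Y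
  /-- the right action `y a` on `Y` -/
  rY : Y →ₗ[k] A →ₗ[k] Y
  τA : X →ₗ[k] Y →ₗ[k] A
  τB : Y →ₗ[k] X →ₗ[k] B
  lX_mul : ∀ (a a' : A) (x : X), lX (a * a') x = lX a (lX a' x)
  rX_mul : ∀ (x : X) (b b' : B), rX x (b * b') = rX (rX x b) b'
  X_assoc : ∀ (a : A) (x : X) (b : B), rX (lX a x) b = lX a (rX x b)
  lY_mul : ∀ (b b' : B) (y : Y), lY (b * b') y = lY b (lY b' y)
  rY_mul : ∀ (y : Y) (a a' : A), rY y (a * a') = rY (rY y a) a'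
  Y_assoc : ∀ (b : B) (y : Y) (a : A), rY (lY b y) a = lY b (rY y a)
  τA_left : ∀ (a : A) (x : X) (y : Y), τA (lX a x) y = a * τA x y
  τA_right : ∀ (x : X) (y : Y) (a : A), τA x (rY y a) = τA x y * a
  τA_balanced : ∀ (x : X) (b : B) (y : Y), τA (rX x b) y = τA x (lY b y)
  τB_left : ∀ (b : B) (y : Y) (x : X), τB (lY b y) x = b * τB y x
  τB_right : ∀ (y : Y) (x : X) (b : B), τB y (rX x b) = τB y x * b
  τB_balanced : ∀ (y : Y) (a : A) (x : X), τB (rY y a) x = τB y (lX a x)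
  τA_smul : ∀ (x : X) (y : Y) (x' : X), lX (τA x y) x' = rX x (τB y x')
  τB_smul : ∀ (y : Y) (x : X) (y' : Y), lY (τB y x) y' = rY y (τA x y')

variable {k : Type uk} {A : Type uA} {B : Type uB} {X : Type uX} {Y : Type uY} [CommRing k]
    [NonUnitalRing A] [Module k A] [IsScalarTower k A A] [SMulCommClass k A A]
    [NonUnitalRing B] [Module k B] [IsScalarTower k B B] [SMulCommClass k B B]
    [AddCommGroup X] [Module k X] [AddCommGroup Y] [Module k Y]

/-- The context is a Morita equivalence: the bimodules are unital (`A X = X = X B`,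
`B Y = Y = Y A`) and `τ_A`, `τ_B` are surjective. -/
structure MoritaContext.IsEquivalence (M : MoritaContext k A B X Y) : Prop where
  lX_unital : Submodule.map₂ M.lX ⊤ ⊤ = ⊤
  rX_unital : Submodule.map₂ M.rX ⊤ ⊤ = ⊤
  lY_unital : Submodule.map₂ M.lY ⊤ ⊤ = ⊤
  rY_unital : Submodule.map₂ M.rY ⊤ ⊤ = ⊤
  τA_surjective : Submodule.map₂ M.τA ⊤ ⊤ = ⊤
  τB_surjective : Submodule.map₂ M.τB ⊤ ⊤ = ⊤

/-- The context algebra of `M`: the matrices `(a x; y b)` with entrywise addition and the matrix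
product given by the bimodule structures, `τ_A` and `τ_B`. -/
@[ext]
structure MoritaContext.Ctx (M : MoritaContext k A B X Y) where
  a : A
  x : X
  y : Y
  b : B

namespace MoritaContext

variable {M : MoritaContext k A B X Y}

namespace Ctx

/-- The underlying `k`-module of the context algebra is `A × X × Y × B`. -/
def equivProd (M : MoritaContext k A B X Y) : M.Ctx ≃ A × X × Y × B where
  toFun c := (c.a, c.x, c.y, c.b)
  invFun c := ⟨c.1, c.2.1, c.2.2.1, c.2.2.2⟩
  left_inv _ := rfl
  right_inv _ := rfl

instance : AddCommGroup M.Ctx := (equivProd M).addCommGroup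

instance : Module k M.Ctx := (equivProd M).module k

instance : Mul M.Ctx where
  mul c d :=
    { a := c.a * d.a + M.τA c.x d.y
      x := M.lX c.a d.x + M.rX c.x d.b
      y := M.rY c.y d.a + M.lY c.b d.y
      b := M.τB c.y d.x + c.b * d.b }

variable (c d : M.Ctx) (r : k)

@[simp] theorem add_a : (c + d).a = c.a + d.a := rfl
@[simp] theorem add_x : (c + d).x = c.x + d.x := rfl
@[simp] theorem add_y : (c + d).y = c.y + d.y := rfl
@[simp] theorem add_b : (c + d).b = c.b + d.b := rfl
@[simp] theorem zero_a : (0 : M.Ctx).a = 0 := rfl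
@[simp] theorem zero_x : (0 : M.Ctx).x = 0 := rfl
@[simp] theorem zero_y : (0 : M.Ctx).y = 0 := rfl
@[simp] theorem zero_b : (0 : M.Ctx).b = 0 := rfl
@[simp] theorem smul_a : (r • c).a = r • c.a := rfl
@[simp] theorem smul_x : (r • c).x = r • c.x := rfl
@[simp] theorem smul_y : (r • c).y = r • c.y := rfl
@[simp] theorem smul_b : (r • c).b = r • c.b := rfl
@[simp] theorem mul_a : (c * d).a = c.a * d.a + M.τA c.x d.y := rfl
@[simp] theorem mul_x : (c * d).x = M.lX c.a d.x + M.rX c.x d.b := rfl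
@[simp] theorem mul_y : (c * d).y = M.rY c.y d.a + M.lY c.b d.y := rfl
@[simp] theorem mul_b : (c * d).b = M.τB c.y d.x + c.b * d.b := rfl

end Ctx

instance : NonUnitalRing M.Ctx :=
  { (inferInstance : AddCommGroup M.Ctx), (inferInstance : Mul M.Ctx) with
    left_distrib := by
      intro a b c
      apply Ctx.ext <;> simp [mul_add] <;> abel
    right_distrib := by
      intro a b c
      apply Ctx.ext <;> simp [add_mul] <;> abel
    zero_mul := by
      intro a
      apply Ctx.ext <;> simp
    mul_zero := by
      intro a
      apply Ctx.ext <;> simp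
    mul_assoc := by
      intro a b c
      apply Ctx.ext <;>
      simp [add_mul, mul_add, M.lX_mul, M.rX_mul,
        M.X_assoc, M.lY_mul, M.rY_mul, M.Y_assoc, M.τA_left, M.τA_right, M.τA_balanced,
        M.τB_left, M.τB_right, M.τB_balanced, M.τA_smul, M.τB_smul, mul_assoc] <;> abel }

instance : IsScalarTower k M.Ctx M.Ctx where
  smul_assoc r c d := by
    apply Ctx.ext <;> simp [smul_mul_assoc, smul_add]

instance : SMulCommClass k M.Ctx M.Ctx where
  smul_comm r c d := by
    apply Ctx.ext <;> simp [mul_smul_comm, smul_add]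

variable (M)

/-- The embedding `a ↦ (a 0; 0 0)` of `A` in the context algebra. -/
def cornerA : A →ₗ[k] M.Ctx where
  toFun a := ⟨a, 0, 0, 0⟩
  map_add' a a' := by apply Ctx.ext <;> simp
  map_smul' c a := by apply Ctx.ext <;> simp

/-- The embedding `b ↦ (0 0; 0 b)` of `B` in the context algebra. -/
def cornerB : B →ₗ[k] M.Ctx where
  toFun b := ⟨0, 0, 0, b⟩
  map_add' b b' := by apply Ctx.ext <;> simp
  map_smul' c b := by apply Ctx.ext <;> simp

end MoritaContext

end MoritaContexts

section MoritaEquivalenceOfPartialActions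

variable {k : Type uk} {G : Type uG} {A : Type uA} {B : Type uB} [CommRing k] [Group G]
    [NonUnitalRing A] [Module k A] [IsScalarTower k A A] [SMulCommClass k A A]
    [NonUnitalRing B] [Module k B] [IsScalarTower k B B] [SMulCommClass k B B]

/-- For an embedding `ι : A → C`, the product partial action `θ` on `C` restricts to `α` on `A`:
the domains of `α` are the intersections of those of `θ` with `A`, and `θₜ` agrees with `αₜ`
there. -/
def ProductPartialAction.RestrictsTo {C : Type uX} [NonUnitalRing C] [Module k C]
    [IsScalarTower k C C] [SMulCommClass k C C] (θ : ProductPartialAction k G C) (ι : A →ₗ[k] C)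
    (α : ProductPartialAction k G A) : Prop :=
  (∀ t : G, α.D t = (θ.D t).comap ι) ∧
    ∀ (t : G) (a : α.D t⁻¹) (h : ι a ∈ θ.D t⁻¹), (θ.α t ⟨ι a, h⟩ : C) = ι (α.α t a)

/-- Morita equivalence of product partial actions: there are a Morita equivalence between `A` and
`B` and a product partial action `θ` on its context algebra such that `Y Dₜ X = D'ₜ` for all `t`,
and `θ` restricts to `α` on `A` and to `α'` on `B`. -/
def ProductPartialAction.MoritaEquivalent (α : ProductPartialAction k G A)
    (α' : ProductPartialAction k G B) : Prop :=
  ∃ (X Y : Type (max uG uA uB)) (_ : AddCommGroup X) (_ : Module k X) (_ : AddCommGroup Y)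
    (_ : Module k Y) (M : MoritaContext k A B X Y) (θ : ProductPartialAction k G M.Ctx),
    M.IsEquivalence ∧
    (∀ t : G, Submodule.map₂ M.τB (Submodule.map₂ M.rY ⊤ (α.D t)) ⊤ = α'.D t) ∧
    θ.RestrictsTo M.cornerA α ∧ θ.RestrictsTo M.cornerB α'

end MoritaEquivalenceOfPartialActions

section StrongGradedEquivalence

variable {k : Type uk} {G : Type uG} {A : Type uA} {B : Type uB} [CommRing k] [Group G]
    [NonUnitalRing A] [Module k A] [IsScalarTower k A A] [SMulCommClass k A A]
    [NonUnitalRing B] [Module k B] [IsScalarTower k B B] [SMulCommClass k B B]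

/-- A graded Morita context between the `G`-graded algebras `A` and `B`: a Morita context with
gradings `X = ⨁ₜ Xₜ` and `Y = ⨁ₜ Yₜ` of the bimodules such that `τ_A(X_r ⊗ Y_s) ⊆ A_{rs}` and
`τ_B(Y_r ⊗ X_s) ⊆ B_{rs}`. -/
structure GradedMoritaContext (𝒜 : GroupGrading k G A) (ℬ : GroupGrading k G B)
    (X : Type uX) (Y : Type uY) [AddCommGroup X] [Module k X] [AddCommGroup Y] [Module k Y]
    extends MoritaContext k A B X Y where
  Xc : G → Submodule k X
  Yc : G → Submodule k Y
  X_indep : iSupIndep Xc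
  X_iSup : ⨆ t, Xc t = ⊤
  Y_indep : iSupIndep Yc
  Y_iSup : ⨆ t, Yc t = ⊤
  lX_mem : ∀ (s t : G) (a : A) (x : X), a ∈ 𝒜.comp s → x ∈ Xc t → lX a x ∈ Xc (s * t)
  rX_mem : ∀ (s t : G) (x : X) (b : B), x ∈ Xc s → b ∈ ℬ.comp t → rX x b ∈ Xc (s * t)
  lY_mem : ∀ (s t : G) (b : B) (y : Y), b ∈ ℬ.comp s → y ∈ Yc t → lY b y ∈ Yc (s * t)
  rY_mem : ∀ (s t : G) (y : Y) (a : A), y ∈ Yc s → a ∈ 𝒜.comp t → rY y a ∈ Yc (s * t)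
  τA_mem : ∀ (s t : G) (x : X) (y : Y), x ∈ Xc s → y ∈ Yc t → τA x y ∈ 𝒜.comp (s * t)
  τB_mem : ∀ (s t : G) (y : Y) (x : X), y ∈ Yc s → x ∈ Xc t → τB y x ∈ ℬ.comp (s * t)

/-- The graded Morita context is a strong-graded-equivalence: each `Xₜ` is a unital
`(Dₜ^A, Dₜ⁻¹^B)`-bimodule, each `Yₜ` is a unital `(Dₜ^B, Dₜ⁻¹^A)`-bimodule, `τ_A` and `τ_B` are
surjective, `τ_A(Xₜ ⊗ Yₜ⁻¹) = Dₜ^A` and `τ_B(Yₜ ⊗ Xₜ⁻¹) = Dₜ^B`. -/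
structure GradedMoritaContext.IsStrongEquivalence {𝒜 : GroupGrading k G A}
    {ℬ : GroupGrading k G B} {X : Type uX} {Y : Type uY} [AddCommGroup X] [Module k X]
    [AddCommGroup Y] [Module k Y] (M : GradedMoritaContext 𝒜 ℬ X Y) : Prop where
  lX_unital : ∀ t : G, Submodule.map₂ M.lX (𝒜.D t) (M.Xc t) = M.Xc t
  rX_unital : ∀ t : G, Submodule.map₂ M.rX (M.Xc t) (ℬ.D t⁻¹) = M.Xc t
  lY_unital : ∀ t : G, Submodule.map₂ M.lY (ℬ.D t) (M.Yc t) = M.Yc t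
  rY_unital : ∀ t : G, Submodule.map₂ M.rY (M.Yc t) (𝒜.D t⁻¹) = M.Yc t
  τA_surjective : Submodule.map₂ M.τA ⊤ ⊤ = ⊤
  τB_surjective : Submodule.map₂ M.τB ⊤ ⊤ = ⊤
  τA_comp : ∀ t : G, Submodule.map₂ M.τA (M.Xc t) (M.Yc t⁻¹) = 𝒜.D t
  τB_comp : ∀ t : G, Submodule.map₂ M.τB (M.Yc t) (M.Xc t⁻¹) = ℬ.D t

/-- `A` and `B` are strongly-graded-equivalent (for graded algebras such that `A`, `B` and all the
`Dₜ^A`, `Dₜ^B` are idempotent, as is the case for partially-strongly-graded algebras). -/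
def StronglyGradedEquivalent (𝒜 : GroupGrading k G A) (ℬ : GroupGrading k G B) : Prop :=
  ∃ (X Y : Type (max uG uA uB)) (_ : AddCommGroup X) (_ : Module k X) (_ : AddCommGroup Y)
    (_ : Module k Y) (M : GradedMoritaContext 𝒜 ℬ X Y), M.IsStrongEquivalence

end StrongGradedEquivalence

end GradedMorita

set_option linter.unusedSectionVars false

/-! Both bimodules, both algebras and all pairings are realised as submodules of one ambient
algebra. The conditions on actions and pairings then become identities between products `⊡` of
submodules (`map_map₂_eq_sprod`, `InternalContext`). On the graded side everything is governed by
degree one. If $P=X_1$ and $Q=Y_1$, then $X_t=A_tP=PB_t$, $Y_t=B_tQ=QA_t$, $PQ=A_1$ and $QP=B_1$.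
Conversely, submodules $P$, $Q$ with these commutation and product rules rebuild the graded context,
provided the sums of the $A_tP$ and of the $B_tQ$ are direct. This is `CornerEquivalence`.

From graded algebras to partial actions: let $C$ be the context algebra of a
strong-graded-equivalence, with $C_t$ made of $A_t,X_t,Y_t,B_t$. It is partially-strongly-graded and
$C_t=(A_t\oplus B_t)C_1$. Hence the diagonal corners of $C_rD^C_tC_s$ are $A_rD_t^AA_s$ and
$B_rD_t^BB_s$. So $\gamma^C$ restricts to $\gamma^A$ and $\gamma^B$ under the entrywise embeddings
of $A$ and $B$ in $C$. Moreover $I^C$ is the context algebra of a Morita equivalence between $I^A$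
and $I^B$ whose bimodules are the matrices with entries in $A_{r^{-1}}X_1B_s$ and
$B_{r^{-1}}Y_1A_s$. Transporting $\gamma^C$ gives the required action (`range_ctxMap_smash`,
`ctxPartialAction`).

From partial actions to graded algebras: let $\theta$ act on the context algebra of $I^A$ and $I^B$,
and form its partial skew group ring $\bigoplus_t\bar D_t\delta_t$, which is associative because the
$\bar D_t$ are idempotent (`twisted_assoc`). The map $a\mapsto a\,e_{1,t}\delta_t$ for $a\in A_t$
embeds $A$ as a full corner of the skew group ring of $\gamma^A$ (`toSkew_mul`, `comp_full`,
`row_comp_row`), and likewise for $B$. The bimodules of the context, placed in degree one, link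
these two skew group rings. Compatibility with degree $t$ amounts to $\theta_t(D_{t^{-1}}X)\subseteq
X$ (`act_mul_mem_X`), where the hypothesis $YD_tX=D'_t$ enters. Cutting down by the corners,
$P=A_1XB_1$ and $Q=B_1YA_1$ form a corner equivalence (`FullCorners.cornerEquivalence`). The sums
are direct since $A_tP$ and $B_tQ$ are homogeneous of degree $t$. -/

namespace GradedMorita

/-! ### Products of submodules. -/

section SubmoduleCalculus

variable {k : Type uk} [CommRing k] {S : Type uA} [NonUnitalRing S] [Module k S]
  [IsScalarTower k S S] [SMulCommClass k S S]
  {T : Type uB} [NonUnitalRing T] [Module k T] [IsScalarTower k T T] [SMulCommClass k T T]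

attribute [gcongr] sprod_mono

theorem sup_sprod (U V W : Submodule k S) : (U ⊔ V) ⊡ W = U ⊡ W ⊔ V ⊡ W :=
  Submodule.map₂_sup_left _ _ _ _

theorem sprod_sup (U V W : Submodule k S) : U ⊡ (V ⊔ W) = U ⊡ V ⊔ U ⊡ W :=
  Submodule.map₂_sup_right _ _ _ _

theorem bot_sprod (U : Submodule k S) : (⊥ : Submodule k S) ⊡ U = ⊥ :=
  Submodule.map₂_bot_left _ _

theorem sprod_bot (U : Submodule k S) : U ⊡ (⊥ : Submodule k S) = ⊥ :=
  Submodule.map₂_bot_right _ _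

/-- If a bilinear map becomes the multiplication of `S` after applying linear maps, then so does
the product of submodules it induces. -/
theorem map_map₂_eq_sprod {M : Type*} {N : Type*} {P : Type*} [AddCommGroup M] [Module k M]
    [AddCommGroup N] [Module k N] [AddCommGroup P] [Module k P]
    (f : M →ₗ[k] N →ₗ[k] P) (g : P →ₗ[k] S) (i : M →ₗ[k] S) (j : N →ₗ[k] S)
    (h : ∀ m n, g (f m n) = i m * j n) (U : Submodule k M) (V : Submodule k N) :
    (Submodule.map₂ f U V).map g = U.map i ⊡ V.map j := by
  apply le_antisymm
  · rw [Submodule.map_le_iff_le_comap, Submodule.map₂_le]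
    intro m hm n hn
    rw [Submodule.mem_comap, h]
    exact mul_mem_sprod ⟨m, hm, rfl⟩ ⟨n, hn, rfl⟩
  · rw [sprod_le]
    rintro _ ⟨m, hm, rfl⟩ _ ⟨n, hn, rfl⟩
    exact ⟨f m n, Submodule.apply_mem_map₂ f hm hn, h m n⟩

theorem map_sprod (f : S →ₗ[k] T) (hf : ∀ a b, f (a * b) = f a * f b) (U V : Submodule k S) :
    (U ⊡ V).map f = U.map f ⊡ V.map f :=
  map_map₂_eq_sprod (LinearMap.mul k S) f f f hf U V

end SubmoduleCalculus

/-! ### Corner equivalences, and their construction from full corners. -/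

section CornerEquivalences

variable {k : Type uk} {G : Type uG} [CommRing k] [Group G] {S : Type uA} [NonUnitalRing S]
  [Module k S] [IsScalarTower k S S] [SMulCommClass k S S]

/-- A family of submodules of an algebra, indexed by a group, which multiplies like the
components of a partially-strongly-graded algebra. -/
structure IsPartiallyStrongFamily (a : G → Submodule k S) : Prop where
  mul_le : ∀ s t, a s ⊡ a t ≤ a (s * t)
  strong : ∀ t, a t ⊡ (a t⁻¹ ⊡ a t) = a t

namespace IsPartiallyStrongFamily

variable {a : G → Submodule k S}

theorem inv_mul_le (h : IsPartiallyStrongFamily a) (t : G) : a t⁻¹ ⊡ a t ≤ a 1 := by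
  simpa using h.mul_le t⁻¹ t

theorem mul_inv_le (h : IsPartiallyStrongFamily a) (t : G) : a t ⊡ a t⁻¹ ≤ a 1 := by
  simpa using h.mul_le t t⁻¹

theorem one_mul (h : IsPartiallyStrongFamily a) (t : G) : a 1 ⊡ a t = a t := by
  apply le_antisymm
  · simpa using h.mul_le 1 t
  · calc a t = a t ⊡ a t⁻¹ ⊡ a t := by rw [sprod_assoc, h.strong]
      _ ≤ _ := sprod_mono (h.mul_inv_le t) le_rfl

theorem mul_one (h : IsPartiallyStrongFamily a) (t : G) : a t ⊡ a 1 = a t := by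
  apply le_antisymm
  · simpa using h.mul_le t 1
  · calc a t = a t ⊡ (a t⁻¹ ⊡ a t) := by rw [h.strong]
      _ ≤ _ := sprod_mono le_rfl (h.inv_mul_le t)

end IsPartiallyStrongFamily

theorem GroupGrading.isPartiallyStrongFamily_map {A : Type uB} [NonUnitalRing A] [Module k A]
    [IsScalarTower k A A] [SMulCommClass k A A] {𝒜 : GroupGrading k G A}
    (h : 𝒜.IsPartiallyStrong) (f : A →ₗ[k] S) (hf : ∀ a b, f (a * b) = f a * f b) :
    IsPartiallyStrongFamily fun t => (𝒜.comp t).map f where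
  mul_le s t := by
    rw [← map_sprod f hf]
    exact Submodule.map_mono (sprod_comp_le s t)
  strong t := by rw [← map_sprod f hf, ← map_sprod f hf, ← sprod_assoc, ← h t]

/-- Two partially strong families `a` and `b` in an algebra linked by submodules `P` and `Q` which
behave like the components of degree `1` of the bimodules of a strong-graded-equivalence. -/
structure CornerEquivalence (a b : G → Submodule k S) (P Q : Submodule k S) : Prop where
  left : IsPartiallyStrongFamily a
  right : IsPartiallyStrongFamily b
  one_P : a 1 ⊡ P = P
  one_Q : b 1 ⊡ Q = Q
  PQ : P ⊡ Q = a 1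
  QP : Q ⊡ P = b 1
  comm_P : ∀ t, a t ⊡ P = P ⊡ b t
  comm_Q : ∀ t, b t ⊡ Q = Q ⊡ a t

namespace CornerEquivalence

variable {a b : G → Submodule k S} {P Q : Submodule k S}

theorem symm (h : CornerEquivalence a b P Q) : CornerEquivalence b a Q P :=
  ⟨h.right, h.left, h.one_Q, h.one_P, h.QP, h.PQ, h.comm_Q, h.comm_P⟩

end CornerEquivalence

/-- Families `I`, `J` linked by a Morita equivalence `X`, `Y`, containing full corners
`a` and `b`. -/
structure FullCorners (I J a b : G → Submodule k S) (X Y : Submodule k S) : Prop where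
  left : IsPartiallyStrongFamily a
  right : IsPartiallyStrongFamily b
  XY : X ⊡ Y = I 1
  YX : Y ⊡ X = J 1
  IX : I 1 ⊡ X = X
  XJ : X ⊡ J 1 = X
  JY : J 1 ⊡ Y = Y
  YI : Y ⊡ I 1 = Y
  a_le : ∀ t, a t ≤ I t
  b_le : ∀ t, b t ≤ J t
  YIX : ∀ t, Y ⊡ (I t ⊡ X) ≤ J t
  XJY : ∀ t, X ⊡ (J t ⊡ Y) ≤ I t
  Ia : ∀ t, I t ⊡ a 1 ≤ I 1 ⊡ a t
  Jb : ∀ t, J t ⊡ b 1 ≤ J 1 ⊡ b t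
  aI : ∀ t, a 1 ⊡ I t ≤ a t ⊡ I 1
  bJ : ∀ t, b 1 ⊡ J t ≤ b t ⊡ J 1
  I_full : I 1 ≤ I 1 ⊡ (a 1 ⊡ I 1)
  J_full : J 1 ≤ J 1 ⊡ (b 1 ⊡ J 1)
  a_corner : a 1 ⊡ (I 1 ⊡ a 1) ≤ a 1
  b_corner : b 1 ⊡ (J 1 ⊡ b 1) ≤ b 1

namespace FullCorners

variable {I J a b : G → Submodule k S} {X Y : Submodule k S}

theorem symm (h : FullCorners I J a b X Y) : FullCorners J I b a Y X :=
  ⟨h.right, h.left, h.YX, h.XY, h.JY, h.YI, h.IX, h.XJ, h.b_le, h.a_le, h.XJY, h.YIX, h.Jb, h.Ia,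
    h.bJ, h.aI, h.J_full, h.I_full, h.b_corner, h.a_corner⟩

/-- For `≤`, replace `b 1` by `J 1`, use `X J Y = I` and fall back into the corner `a 1`. For `≥`,
write `a 1` inside `a 1 ⊡ (I 1 ⊡ a 1)`, expand `I 1` as `X J Y`, and insert `b 1` by fullness, `J ≤
J b J`. The extra factors `J` are absorbed by `X` and `Y`. -/
theorem corner_sprod_corner (h : FullCorners I J a b X Y) :
    a 1 ⊡ (X ⊡ b 1) ⊡ (b 1 ⊡ (Y ⊡ a 1)) = a 1 := by
  have hb : b 1 ⊡ (b 1 ⊡ (Y ⊡ a 1)) = b 1 ⊡ (Y ⊡ a 1) := by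
    rw [← sprod_assoc, h.right.one_mul]
  have e : a 1 ⊡ (X ⊡ b 1) ⊡ (b 1 ⊡ (Y ⊡ a 1)) = a 1 ⊡ (X ⊡ (b 1 ⊡ (Y ⊡ a 1))) := by
    simp only [sprod_assoc, hb]
  rw [e]
  apply le_antisymm
  · calc a 1 ⊡ (X ⊡ (b 1 ⊡ (Y ⊡ a 1))) ≤ a 1 ⊡ (X ⊡ (J 1 ⊡ (Y ⊡ a 1))) := by
          gcongr; exact h.b_le 1
      _ = a 1 ⊡ (X ⊡ J 1 ⊡ Y ⊡ a 1) := by simp only [sprod_assoc]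
      _ = a 1 ⊡ (I 1 ⊡ a 1) := by rw [h.XJ, h.XY]
      _ ≤ a 1 := h.a_corner
  · calc a 1 = a 1 ⊡ (a 1 ⊡ a 1) := by rw [h.left.one_mul, h.left.one_mul]
      _ ≤ a 1 ⊡ (I 1 ⊡ a 1) := by gcongr; exact h.a_le 1
      _ = a 1 ⊡ (X ⊡ J 1 ⊡ Y ⊡ a 1) := by rw [h.XJ, h.XY]
      _ ≤ a 1 ⊡ (X ⊡ (J 1 ⊡ (b 1 ⊡ J 1)) ⊡ Y ⊡ a 1) := by gcongr; exact h.J_full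
      _ = a 1 ⊡ (X ⊡ J 1 ⊡ (b 1 ⊡ (J 1 ⊡ Y ⊡ a 1))) := by simp only [sprod_assoc]
      _ = _ := by rw [h.XJ, h.JY]

/-- To move the degree across `X`, insert `I 1 = X Y`: then `a t X b 1` lies in `a 1 X (Y I t X) b
1`, hence in `a 1 X (J t b 1)`. The rule `Jb` transfers the degree from `J t` to `b t`, and the
remaining `J 1` is absorbed by `X`. The reverse inclusion is the mirror image, with `XJY` and `aI`.
-/
theorem comm_corner (h : FullCorners I J a b X Y) (t : G) :
    a t ⊡ (a 1 ⊡ (X ⊡ b 1)) = a 1 ⊡ (X ⊡ b 1) ⊡ b t := by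
  have e1 : a t ⊡ (a 1 ⊡ (X ⊡ b 1)) = a t ⊡ (X ⊡ b 1) := by
    rw [← sprod_assoc, h.left.mul_one]
  have e2 : a 1 ⊡ (X ⊡ b 1) ⊡ b t = a 1 ⊡ (X ⊡ b t) := by
    rw [sprod_assoc, sprod_assoc, h.right.one_mul]
  rw [e1, e2]
  apply le_antisymm
  · calc a t ⊡ (X ⊡ b 1) = a 1 ⊡ (a 1 ⊡ a t) ⊡ (X ⊡ b 1) := by
          rw [h.left.one_mul, h.left.one_mul]
      _ ≤ a 1 ⊡ (I 1 ⊡ I t) ⊡ (X ⊡ b 1) := by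
          gcongr
          · exact h.a_le 1
          · exact h.a_le t
      _ = a 1 ⊡ (X ⊡ (Y ⊡ (I t ⊡ X) ⊡ b 1)) := by rw [← h.XY]; simp only [sprod_assoc]
      _ ≤ a 1 ⊡ (X ⊡ (J t ⊡ b 1)) := by gcongr; exact h.YIX t
      _ ≤ a 1 ⊡ (X ⊡ (J 1 ⊡ b t)) := sprod_mono le_rfl (sprod_mono le_rfl (h.Jb t))
      _ = _ := by rw [← sprod_assoc X, h.XJ]
  · calc a 1 ⊡ (X ⊡ b t) = a 1 ⊡ (X ⊡ (b t ⊡ b 1 ⊡ b 1)) := by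
          rw [h.right.mul_one, h.right.mul_one]
      _ ≤ a 1 ⊡ (X ⊡ (J t ⊡ J 1 ⊡ b 1)) := by
          gcongr
          · exact h.b_le t
          · exact h.b_le 1
      _ = a 1 ⊡ (X ⊡ (J t ⊡ Y) ⊡ (X ⊡ b 1)) := by rw [← h.YX]; simp only [sprod_assoc]
      _ ≤ a 1 ⊡ (I t ⊡ (X ⊡ b 1)) := by gcongr; exact h.XJY t
      _ = a 1 ⊡ I t ⊡ (X ⊡ b 1) := by rw [sprod_assoc]
      _ ≤ a t ⊡ I 1 ⊡ (X ⊡ b 1) := sprod_mono (h.aI t) le_rfl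
      _ = _ := by rw [sprod_assoc, ← sprod_assoc (I 1), h.IX]

theorem cornerEquivalence (h : FullCorners I J a b X Y) :
    CornerEquivalence a b (a 1 ⊡ (X ⊡ b 1)) (b 1 ⊡ (Y ⊡ a 1)) where
  left := h.left
  right := h.right
  one_P := by rw [← sprod_assoc, h.left.one_mul]
  one_Q := by rw [← sprod_assoc, h.right.one_mul]
  PQ := h.corner_sprod_corner
  QP := h.symm.corner_sprod_corner
  comm_P := h.comm_corner
  comm_Q := h.symm.comm_corner

end FullCorners

end CornerEquivalences

/-! ### Morita contexts inside an ambient algebra. -/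

section InternalContexts

variable {k : Type uk} {A : Type uA} {B : Type uB} {S : Type uX} [CommRing k]
    [NonUnitalRing A] [Module k A] [IsScalarTower k A A] [SMulCommClass k A A]
    [NonUnitalRing B] [Module k B] [IsScalarTower k B B] [SMulCommClass k B B]
    [NonUnitalRing S] [Module k S] [IsScalarTower k S S] [SMulCommClass k S S]

/-- Submodules `X`, `Y` of an algebra `S` which form a Morita context with the images of
embeddings `φ : A → S` and `ψ : B → S`. -/
structure InternalContext (φ : A →ₗ[k] S) (ψ : B →ₗ[k] S) (X Y : Submodule k S) : Prop where
  φ_mul : ∀ a a', φ (a * a') = φ a * φ a'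
  ψ_mul : ∀ b b', ψ (b * b') = ψ b * ψ b'
  φ_inj : Function.Injective φ
  ψ_inj : Function.Injective ψ
  lX : ∀ a, ∀ x ∈ X, φ a * x ∈ X
  rX : ∀ x ∈ X, ∀ b, x * ψ b ∈ X
  lY : ∀ b, ∀ y ∈ Y, ψ b * y ∈ Y
  rY : ∀ y ∈ Y, ∀ a, y * φ a ∈ Y
  XY : ∀ x ∈ X, ∀ y ∈ Y, x * y ∈ LinearMap.range φ
  YX : ∀ y ∈ Y, ∀ x ∈ X, y * x ∈ LinearMap.range ψ

namespace InternalContext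

variable {φ : A →ₗ[k] S} {ψ : B →ₗ[k] S} {X Y : Submodule k S}

theorem symm (h : InternalContext φ ψ X Y) : InternalContext ψ φ Y X :=
  ⟨h.ψ_mul, h.φ_mul, h.ψ_inj, h.φ_inj, h.lY, h.rY, h.lX, h.rX, h.YX, h.XY⟩

/-- Multiplication in `S` as a left action of `A` on `X`. -/
def left (h : InternalContext φ ψ X Y) : A →ₗ[k] X →ₗ[k] X :=
  LinearMap.mk₂ k (fun a x => ⟨φ a * x, h.lX a x x.2⟩)
    (fun a a' x => Subtype.ext (by simp [add_mul]))
    (fun c a x => Subtype.ext (by simp [smul_mul_assoc]))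
    (fun a x x' => Subtype.ext (by simp [mul_add]))
    (fun c a x => Subtype.ext (by simp [mul_smul_comm]))

/-- Multiplication in `S` as a right action of `B` on `X`. -/
def right (h : InternalContext φ ψ X Y) : X →ₗ[k] B →ₗ[k] X :=
  LinearMap.mk₂ k (fun x b => ⟨x * ψ b, h.rX x x.2 b⟩)
    (fun x x' b => Subtype.ext (by simp [add_mul]))
    (fun c x b => Subtype.ext (by simp [smul_mul_assoc]))
    (fun x b b' => Subtype.ext (by simp [mul_add]))
    (fun c x b => Subtype.ext (by simp [mul_smul_comm]))

/-- Multiplication in `S` as a pairing `X × Y → A`. -/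
noncomputable def pairing (h : InternalContext φ ψ X Y) : X →ₗ[k] Y →ₗ[k] A :=
  LinearMap.compr₂ (Pₗ := LinearMap.range φ)
    (LinearMap.mk₂ k (fun (x : X) (y : Y) => ⟨(x : S) * y, h.XY x x.2 y y.2⟩)
      (fun x x' y => Subtype.ext (by simp [add_mul]))
      (fun c x y => Subtype.ext (by simp [smul_mul_assoc]))
      (fun x y y' => Subtype.ext (by simp [mul_add]))
      (fun c x y => Subtype.ext (by simp [mul_smul_comm])))
    (LinearEquiv.ofInjective φ h.φ_inj).symm.toLinearMap

theorem left_coe (h : InternalContext φ ψ X Y) (a : A) (x : X) : (h.left a x : S) = φ a * x := rfl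

theorem right_coe (h : InternalContext φ ψ X Y) (x : X) (b : B) :
    (h.right x b : S) = x * ψ b := rfl

theorem map_pairing (h : InternalContext φ ψ X Y) (x : X) (y : Y) :
    φ (h.pairing x y) = x * y := by
  have := LinearEquiv.apply_symm_apply (LinearEquiv.ofInjective φ h.φ_inj)
    ⟨(x : S) * y, h.XY x x.2 y y.2⟩
  exact congrArg Subtype.val this

/-- The Morita context given by multiplication in `S`. -/
noncomputable def toMoritaContext (h : InternalContext φ ψ X Y) : MoritaContext k A B X Y where
  lX := h.left
  rX := h.right
  lY := h.symm.left
  rY := h.symm.right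
  τA := h.pairing
  τB := h.symm.pairing
  lX_mul a a' x := Subtype.ext (by simp only [left_coe, h.φ_mul, mul_assoc])
  rX_mul x b b' := Subtype.ext (by simp only [right_coe, h.ψ_mul, mul_assoc])
  X_assoc a x b := Subtype.ext (by simp only [left_coe, right_coe, mul_assoc])
  lY_mul b b' y := Subtype.ext (by simp only [left_coe, h.ψ_mul, mul_assoc])
  rY_mul y a a' := Subtype.ext (by simp only [right_coe, h.φ_mul, mul_assoc])
  Y_assoc b y a := Subtype.ext (by simp only [left_coe, right_coe, mul_assoc])
  τA_left a x y := h.φ_inj (by simp only [left_coe, map_pairing, h.φ_mul, mul_assoc])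
  τA_right x y a := h.φ_inj (by simp only [right_coe, map_pairing, h.φ_mul, mul_assoc])
  τA_balanced x b y := h.φ_inj (by simp only [right_coe, left_coe, map_pairing, mul_assoc])
  τB_left b y x := h.ψ_inj (by simp only [left_coe, map_pairing, h.ψ_mul, mul_assoc])
  τB_right y x b := h.ψ_inj (by simp only [right_coe, map_pairing, h.ψ_mul, mul_assoc])
  τB_balanced y a x := h.ψ_inj (by simp only [right_coe, left_coe, map_pairing, mul_assoc])
  τA_smul x y x' := Subtype.ext (by simp only [left_coe, right_coe, map_pairing, mul_assoc])
  τB_smul y x y' := Subtype.ext (by simp only [left_coe, right_coe, map_pairing, mul_assoc])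

theorem map_left (h : InternalContext φ ψ X Y) (U : Submodule k A) (V : Submodule k X) :
    (Submodule.map₂ h.left U V).map X.subtype = U.map φ ⊡ V.map X.subtype :=
  map_map₂_eq_sprod _ _ _ _ h.left_coe U V

theorem map_right (h : InternalContext φ ψ X Y) (U : Submodule k X) (V : Submodule k B) :
    (Submodule.map₂ h.right U V).map X.subtype = U.map X.subtype ⊡ V.map ψ :=
  map_map₂_eq_sprod _ _ _ _ h.right_coe U V

theorem map_map₂_pairing (h : InternalContext φ ψ X Y) (U : Submodule k X) (V : Submodule k Y) :
    (Submodule.map₂ h.pairing U V).map φ = U.map X.subtype ⊡ V.map Y.subtype :=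
  map_map₂_eq_sprod _ _ _ _ h.map_pairing U V

end InternalContext

end InternalContexts

/-! ### From a corner equivalence to a strong-graded-equivalence. -/

section CornerEquivalenceToGraded

variable {k : Type uk} {G : Type uG} [CommRing k] [Group G] {S : Type uX} [NonUnitalRing S]
  [Module k S] [IsScalarTower k S S] [SMulCommClass k S S]

theorem sprod_iSup_iSup_le {ι κ : Type*} {U : ι → Submodule k S} {V : κ → Submodule k S}
    {W : Submodule k S} (h : ∀ i j, U i ⊡ V j ≤ W) : (⨆ i, U i) ⊡ (⨆ j, V j) ≤ W := by
  rw [sprod, Submodule.map₂_iSup_left]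
  refine iSup_le fun i => ?_
  rw [Submodule.map₂_iSup_right]
  exact iSup_le fun j => h i j

theorem iSupIndep_comap_subtype {ι : Type*} {M : Type*} [AddCommGroup M] [Module k M]
    {U : ι → Submodule k M} (h : iSupIndep U) (X : Submodule k M) :
    iSupIndep fun i => (U i).comap X.subtype := by
  intro i
  rw [Submodule.disjoint_def]
  intro x hx hx'
  have h1 : (x : M) ∈ ⨆ j, ⨆ _ : j ≠ i, U j := by
    have h2 : (⨆ j, ⨆ _ : j ≠ i, (U j).comap X.subtype) ≤
        (⨆ j, ⨆ _ : j ≠ i, U j).comap X.subtype :=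
      iSup₂_le fun j hj => Submodule.comap_mono (le_iSup₂_of_le j hj le_rfl)
    exact h2 hx'
  exact Subtype.ext (Submodule.disjoint_def.1 (h i) _ hx h1)

theorem iSup_comap_subtype_iSup {ι : Type*} {M : Type*} [AddCommGroup M] [Module k M]
    (U : ι → Submodule k M) : ⨆ i, (U i).comap (⨆ i, U i).subtype = ⊤ := by
  refine Submodule.map_injective_of_injective (⨆ i, U i).injective_subtype ?_
  rw [Submodule.map_iSup, Submodule.map_top, Submodule.range_subtype]
  refine iSup_congr fun i => ?_
  rw [Submodule.map_comap_subtype, inf_eq_right]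
  exact le_iSup U i

namespace CornerEquivalence

variable {a b : G → Submodule k S} {P Q : Submodule k S}

theorem comp_sprod_P_le (h : CornerEquivalence a b P Q) (s t : G) :
    a s ⊡ (a t ⊡ P) ≤ a (s * t) ⊡ P := by
  rw [← sprod_assoc]
  exact sprod_mono (h.left.mul_le s t) le_rfl

theorem sprod_P_sprod (h : CornerEquivalence a b P Q) (s t : G) :
    a s ⊡ P ⊡ b t = a s ⊡ (a t ⊡ P) := by
  rw [sprod_assoc, h.comm_P]

/-- Commuting `b t` past `Q` brings `P` next to `Q`, and `PQ = a 1` is absorbed. This computes every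
pairing of homogeneous components: its inclusion in `a (s * t)` is the grading condition, the case
`t = s⁻¹` gives `D`. -/
theorem sprod_P_sprod_Q (h : CornerEquivalence a b P Q) (s t : G) :
    a s ⊡ P ⊡ (b t ⊡ Q) = a s ⊡ a t := by
  rw [h.comm_Q, sprod_assoc, ← sprod_assoc P, h.PQ, h.left.one_mul]

variable {A : Type uA} {B : Type uB} [NonUnitalRing A] [Module k A] [IsScalarTower k A A]
  [SMulCommClass k A A] [NonUnitalRing B] [Module k B] [IsScalarTower k B B] [SMulCommClass k B B]
  {𝒜 : GroupGrading k G A} {ℬ : GroupGrading k G B} {φ : A →ₗ[k] S} {ψ : B →ₗ[k] S}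

theorem map_mul_mem (h : CornerEquivalence (fun t => (𝒜.comp t).map φ)
    (fun t => (ℬ.comp t).map ψ) P Q) (x : A) :
    ∀ z ∈ ⨆ t, (𝒜.comp t).map φ ⊡ P, φ x * z ∈ ⨆ t, (𝒜.comp t).map φ ⊡ P := by
  intro z hz
  have hx : φ x ∈ ⨆ t, (𝒜.comp t).map φ := by
    rw [← Submodule.map_iSup, 𝒜.iSup_eq_top]
    exact ⟨x, trivial, rfl⟩
  exact sprod_iSup_iSup_le (fun s t => (h.comp_sprod_P_le s t).trans
    (le_iSup (fun t => (𝒜.comp t).map φ ⊡ P) (s * t))) (mul_mem_sprod hx hz)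

theorem mul_map_mem (h : CornerEquivalence (fun t => (𝒜.comp t).map φ)
    (fun t => (ℬ.comp t).map ψ) P Q) :
    ∀ z ∈ ⨆ t, (𝒜.comp t).map φ ⊡ P, ∀ y : B, z * ψ y ∈ ⨆ t, (𝒜.comp t).map φ ⊡ P := by
  intro z hz y
  have hy : ψ y ∈ ⨆ t, (ℬ.comp t).map ψ := by
    rw [← Submodule.map_iSup, ℬ.iSup_eq_top]
    exact ⟨y, trivial, rfl⟩
  exact sprod_iSup_iSup_le (fun s t => ((h.sprod_P_sprod s t).trans_le
    (h.comp_sprod_P_le s t)).trans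
    (le_iSup (fun t => (𝒜.comp t).map φ ⊡ P) (s * t))) (mul_mem_sprod hz hy)

theorem mul_mem_range (h : CornerEquivalence (fun t => (𝒜.comp t).map φ)
    (fun t => (ℬ.comp t).map ψ) P Q) :
    ∀ z ∈ ⨆ t, (𝒜.comp t).map φ ⊡ P, ∀ w ∈ ⨆ t, (ℬ.comp t).map ψ ⊡ Q,
      z * w ∈ LinearMap.range φ := by
  intro z hz w hw
  refine sprod_iSup_iSup_le (fun s t => ?_) (mul_mem_sprod hz hw)
  exact (h.sprod_P_sprod_Q s t).trans_le ((h.left.mul_le s t).trans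
    LinearMap.map_le_range)

theorem internalContext (h : CornerEquivalence (fun t => (𝒜.comp t).map φ)
    (fun t => (ℬ.comp t).map ψ) P Q) (hφ : ∀ a a', φ (a * a') = φ a * φ a')
    (hψ : ∀ b b', ψ (b * b') = ψ b * ψ b') (hφi : Function.Injective φ)
    (hψi : Function.Injective ψ) :
    InternalContext φ ψ (⨆ t, (𝒜.comp t).map φ ⊡ P) (⨆ t, (ℬ.comp t).map ψ ⊡ Q) where
  φ_mul := hφ
  ψ_mul := hψ
  φ_inj := hφi
  ψ_inj := hψi
  lX := h.map_mul_mem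
  rX := h.mul_map_mem
  lY := h.symm.map_mul_mem
  rY := h.symm.mul_map_mem
  XY := h.mul_mem_range
  YX := h.symm.mul_mem_range

theorem map_left_D (h : CornerEquivalence (fun t => (𝒜.comp t).map φ)
    (fun t => (ℬ.comp t).map ψ) P Q) (hφ : ∀ a a', φ (a * a') = φ a * φ a') (t : G) :
    (𝒜.D t).map φ ⊡ ((𝒜.comp t).map φ ⊡ P) = (𝒜.comp t).map φ ⊡ P := by
  rw [GroupGrading.D, map_sprod φ hφ, ← sprod_assoc, sprod_assoc, sprod_assoc,
    ← sprod_assoc (Submodule.map φ (𝒜.comp t⁻¹)), ← sprod_assoc, h.left.strong]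

/-- Commuting the two factors of $D_{t^{-1}}^B=B_{t^{-1}}B_t$ to the left of `P` turns the product
into $A_tA_{t^{-1}}A_tP$, so that unitality on the right also reduces to strongness of the family on
the left. -/
theorem map_right_D (h : CornerEquivalence (fun t => (𝒜.comp t).map φ)
    (fun t => (ℬ.comp t).map ψ) P Q) (hψ : ∀ b b', ψ (b * b') = ψ b * ψ b') (t : G) :
    (𝒜.comp t).map φ ⊡ P ⊡ (ℬ.D t⁻¹).map ψ = (𝒜.comp t).map φ ⊡ P := by
  rw [GroupGrading.D, map_sprod ψ hψ, inv_inv, ← sprod_assoc, h.sprod_P_sprod, sprod_assoc,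
    sprod_assoc, ← h.comm_P, ← sprod_assoc (Submodule.map φ (𝒜.comp t⁻¹)), ← sprod_assoc,
    h.left.strong]

/-- The components $X_t$ and $Y_1$ already pair onto $A_tA_1=A_t$, and the $A_t$ span $A$. -/
theorem map₂_pairing_top (h : CornerEquivalence (fun t => (𝒜.comp t).map φ)
    (fun t => (ℬ.comp t).map ψ) P Q)
    (H : InternalContext φ ψ (⨆ t, (𝒜.comp t).map φ ⊡ P) (⨆ t, (ℬ.comp t).map ψ ⊡ Q)) :
    Submodule.map₂ H.pairing ⊤ ⊤ = ⊤ := by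
  refine Submodule.map_injective_of_injective H.φ_inj ?_
  rw [H.map_map₂_pairing, Submodule.map_subtype_top, Submodule.map_subtype_top, Submodule.map_top]
  apply le_antisymm
  · exact sprod_le.2 h.mul_mem_range
  · rw [← Submodule.map_top, ← 𝒜.iSup_eq_top, Submodule.map_iSup]
    refine iSup_le fun t => ?_
    calc (𝒜.comp t).map φ = (𝒜.comp t).map φ ⊡ (𝒜.comp 1).map φ := (h.left.mul_one t).symm
      _ = (𝒜.comp t).map φ ⊡ P ⊡ ((ℬ.comp 1).map ψ ⊡ Q) := (h.sprod_P_sprod_Q t 1).symm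
      _ ≤ _ := sprod_mono (le_iSup (fun t => (𝒜.comp t).map φ ⊡ P) t)
        (le_iSup (fun t => (ℬ.comp t).map ψ ⊡ Q) 1)

/-- The graded Morita context on `⨁ₜ aₜ P` and `⨁ₜ bₜ Q` given by a corner equivalence. -/
noncomputable def gradedMoritaContext (h : CornerEquivalence (fun t => (𝒜.comp t).map φ)
    (fun t => (ℬ.comp t).map ψ) P Q)
    (H : InternalContext φ ψ (⨆ t, (𝒜.comp t).map φ ⊡ P) (⨆ t, (ℬ.comp t).map ψ ⊡ Q))
    (hP : iSupIndep fun t => (𝒜.comp t).map φ ⊡ P)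
    (hQ : iSupIndep fun t => (ℬ.comp t).map ψ ⊡ Q) :
    GradedMoritaContext 𝒜 ℬ (⨆ t, (𝒜.comp t).map φ ⊡ P : Submodule k S)
      (⨆ t, (ℬ.comp t).map ψ ⊡ Q : Submodule k S) where
  toMoritaContext := H.toMoritaContext
  Xc t := ((𝒜.comp t).map φ ⊡ P).comap (Submodule.subtype _)
  Yc t := ((ℬ.comp t).map ψ ⊡ Q).comap (Submodule.subtype _)
  X_indep := iSupIndep_comap_subtype hP _
  X_iSup := iSup_comap_subtype_iSup _
  Y_indep := iSupIndep_comap_subtype hQ _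
  Y_iSup := iSup_comap_subtype_iSup _
  lX_mem s t a x ha hx := h.comp_sprod_P_le s t (mul_mem_sprod ⟨a, ha, rfl⟩ hx)
  rX_mem s t x b hx hb := h.comp_sprod_P_le s t
    ((h.sprod_P_sprod s t).le (mul_mem_sprod hx ⟨b, hb, rfl⟩))
  lY_mem s t b y hb hy := h.symm.comp_sprod_P_le s t (mul_mem_sprod ⟨b, hb, rfl⟩ hy)
  rY_mem s t y a hy ha := h.symm.comp_sprod_P_le s t
    ((h.symm.sprod_P_sprod s t).le (mul_mem_sprod hy ⟨a, ha, rfl⟩))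
  τA_mem s t x y hx hy := by
    obtain ⟨c, hc, hcx⟩ := h.left.mul_le s t ((h.sprod_P_sprod_Q s t).le (mul_mem_sprod hx hy))
    -- The grading of the product is known only for the image under `φ`; injectivity brings it back
    -- to the value of the pairing.
    have : c = H.pairing x y := H.φ_inj (hcx.trans (H.map_pairing x y).symm)
    exact this ▸ hc
  τB_mem s t y x hy hx := by
    obtain ⟨c, hc, hcx⟩ := h.symm.left.mul_le s t
      ((h.symm.sprod_P_sprod_Q s t).le (mul_mem_sprod hy hx))
    have : c = H.symm.pairing y x := H.ψ_inj (hcx.trans (H.symm.map_pairing y x).symm)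
    exact this ▸ hc

theorem map_comap_component (t : G) : (((𝒜.comp t).map φ ⊡ P).comap
    (⨆ t, (𝒜.comp t).map φ ⊡ P).subtype).map (⨆ t, (𝒜.comp t).map φ ⊡ P).subtype =
      (𝒜.comp t).map φ ⊡ P := by
  rw [Submodule.map_comap_subtype, inf_eq_right]
  exact le_iSup (fun t => (𝒜.comp t).map φ ⊡ P) t

theorem left_unital (h : CornerEquivalence (fun t => (𝒜.comp t).map φ)
    (fun t => (ℬ.comp t).map ψ) P Q)
    (H : InternalContext φ ψ (⨆ t, (𝒜.comp t).map φ ⊡ P) (⨆ t, (ℬ.comp t).map ψ ⊡ Q)) (t : G) :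
    Submodule.map₂ H.left (𝒜.D t) (((𝒜.comp t).map φ ⊡ P).comap (Submodule.subtype _)) =
      ((𝒜.comp t).map φ ⊡ P).comap (Submodule.subtype _) := by
  refine Submodule.map_injective_of_injective (Submodule.injective_subtype _) ?_
  rw [H.map_left, map_comap_component, h.map_left_D H.φ_mul]

theorem right_unital (h : CornerEquivalence (fun t => (𝒜.comp t).map φ)
    (fun t => (ℬ.comp t).map ψ) P Q)
    (H : InternalContext φ ψ (⨆ t, (𝒜.comp t).map φ ⊡ P) (⨆ t, (ℬ.comp t).map ψ ⊡ Q)) (t : G) :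
    Submodule.map₂ H.right (((𝒜.comp t).map φ ⊡ P).comap (Submodule.subtype _)) (ℬ.D t⁻¹) =
      ((𝒜.comp t).map φ ⊡ P).comap (Submodule.subtype _) := by
  refine Submodule.map_injective_of_injective (Submodule.injective_subtype _) ?_
  rw [H.map_right, map_comap_component, h.map_right_D H.ψ_mul]

theorem map₂_pairing_component (h : CornerEquivalence (fun t => (𝒜.comp t).map φ)
    (fun t => (ℬ.comp t).map ψ) P Q)
    (H : InternalContext φ ψ (⨆ t, (𝒜.comp t).map φ ⊡ P) (⨆ t, (ℬ.comp t).map ψ ⊡ Q)) (t : G) :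
    Submodule.map₂ H.pairing (((𝒜.comp t).map φ ⊡ P).comap (Submodule.subtype _))
      (((ℬ.comp t⁻¹).map ψ ⊡ Q).comap (Submodule.subtype _)) = 𝒜.D t := by
  refine Submodule.map_injective_of_injective H.φ_inj ?_
  rw [H.map_map₂_pairing, map_comap_component, map_comap_component, h.sprod_P_sprod_Q,
    GroupGrading.D, map_sprod φ H.φ_mul]

end CornerEquivalence

/-- Directness of the two sums is the only condition that the product rules do not supply, hence the
hypotheses `hP` and `hQ`. The universe of `S` is the one prescribed for the bimodules, which are
submodules of `S`. -/
theorem CornerEquivalence.stronglyGradedEquivalent {A : Type uA} {B : Type uB} [NonUnitalRing A]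
    [Module k A] [IsScalarTower k A A] [SMulCommClass k A A] [NonUnitalRing B] [Module k B]
    [IsScalarTower k B B] [SMulCommClass k B B]
    {𝒜 : GroupGrading k G A} {ℬ : GroupGrading k G B} {S : Type (max uG uA uB)} [NonUnitalRing S]
    [Module k S] [IsScalarTower k S S] [SMulCommClass k S S] {φ : A →ₗ[k] S} {ψ : B →ₗ[k] S}
    {P Q : Submodule k S} (h : CornerEquivalence (fun t => (𝒜.comp t).map φ)
    (fun t => (ℬ.comp t).map ψ) P Q) (hφ : ∀ a a', φ (a * a') = φ a * φ a')
    (hψ : ∀ b b', ψ (b * b') = ψ b * ψ b') (hφi : Function.Injective φ)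
    (hψi : Function.Injective ψ) (hP : iSupIndep fun t => (𝒜.comp t).map φ ⊡ P)
    (hQ : iSupIndep fun t => (ℬ.comp t).map ψ ⊡ Q) : StronglyGradedEquivalent 𝒜 ℬ := by
  have H := h.internalContext hφ hψ hφi hψi
  exact ⟨_, _, inferInstance, inferInstance, inferInstance, inferInstance,
    h.gradedMoritaContext H hP hQ,
    { lX_unital := h.left_unital H
      rX_unital := h.right_unital H
      lY_unital := h.symm.left_unital H.symm
      rY_unital := h.symm.right_unital H.symm
      τA_surjective := h.map₂_pairing_top H
      τB_surjective := h.symm.map₂_pairing_top H.symm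
      τA_comp := h.map₂_pairing_component H
      τB_comp := h.symm.map₂_pairing_component H.symm }⟩

end CornerEquivalenceToGraded

/-! ### Corners and boxes in a context algebra. -/

section ContextAlgebra

variable {k : Type uk} {A : Type uA} {B : Type uB} {X : Type uX} {Y : Type uY} [CommRing k]
    [NonUnitalRing A] [Module k A] [IsScalarTower k A A] [SMulCommClass k A A]
    [NonUnitalRing B] [Module k B] [IsScalarTower k B B] [SMulCommClass k B B]
    [AddCommGroup X] [Module k X] [AddCommGroup Y] [Module k Y]

namespace MoritaContext

variable (M : MoritaContext k A B X Y)

/-- The embedding `x ↦ (0 x; 0 0)` of `X` in the context algebra. -/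
def cornerX : X →ₗ[k] M.Ctx where
  toFun x := ⟨0, x, 0, 0⟩
  map_add' x x' := by apply Ctx.ext <;> simp
  map_smul' c x := by apply Ctx.ext <;> simp

/-- The embedding `y ↦ (0 0; y 0)` of `Y` in the context algebra. -/
def cornerY : Y →ₗ[k] M.Ctx where
  toFun y := ⟨0, 0, y, 0⟩
  map_add' y y' := by apply Ctx.ext <;> simp
  map_smul' c y := by apply Ctx.ext <;> simp

/-- The projection `(a x; y b) ↦ a`. -/
def projA : M.Ctx →ₗ[k] A where
  toFun c := c.a
  map_add' _ _ := rfl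
  map_smul' _ _ := rfl

/-- The projection `(a x; y b) ↦ x`. -/
def projX : M.Ctx →ₗ[k] X where
  toFun c := c.x
  map_add' _ _ := rfl
  map_smul' _ _ := rfl

/-- The projection `(a x; y b) ↦ y`. -/
def projY : M.Ctx →ₗ[k] Y where
  toFun c := c.y
  map_add' _ _ := rfl
  map_smul' _ _ := rfl

/-- The projection `(a x; y b) ↦ b`. -/
def projB : M.Ctx →ₗ[k] B where
  toFun c := c.b
  map_add' _ _ := rfl
  map_smul' _ _ := rfl

@[simp] theorem projA_apply (c : M.Ctx) : M.projA c = c.a := rfl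
@[simp] theorem projX_apply (c : M.Ctx) : M.projX c = c.x := rfl
@[simp] theorem projY_apply (c : M.Ctx) : M.projY c = c.y := rfl
@[simp] theorem projB_apply (c : M.Ctx) : M.projB c = c.b := rfl
@[simp] theorem cornerA_a (a : A) : (M.cornerA a).a = a := rfl
@[simp] theorem cornerA_x (a : A) : (M.cornerA a).x = 0 := rfl
@[simp] theorem cornerA_y (a : A) : (M.cornerA a).y = 0 := rfl
@[simp] theorem cornerA_b (a : A) : (M.cornerA a).b = 0 := rfl
@[simp] theorem cornerX_a (x : X) : (M.cornerX x).a = 0 := rfl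
@[simp] theorem cornerX_x (x : X) : (M.cornerX x).x = x := rfl
@[simp] theorem cornerX_y (x : X) : (M.cornerX x).y = 0 := rfl
@[simp] theorem cornerX_b (x : X) : (M.cornerX x).b = 0 := rfl
@[simp] theorem cornerY_a (y : Y) : (M.cornerY y).a = 0 := rfl
@[simp] theorem cornerY_x (y : Y) : (M.cornerY y).x = 0 := rfl
@[simp] theorem cornerY_y (y : Y) : (M.cornerY y).y = y := rfl
@[simp] theorem cornerY_b (y : Y) : (M.cornerY y).b = 0 := rfl
@[simp] theorem cornerB_a (b : B) : (M.cornerB b).a = 0 := rfl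
@[simp] theorem cornerB_x (b : B) : (M.cornerB b).x = 0 := rfl
@[simp] theorem cornerB_y (b : B) : (M.cornerB b).y = 0 := rfl
@[simp] theorem cornerB_b (b : B) : (M.cornerB b).b = b := rfl

theorem eq_sum_corners (c : M.Ctx) :
    c = M.cornerA c.a + M.cornerX c.x + M.cornerY c.y + M.cornerB c.b := by
  apply Ctx.ext <;> simp

theorem cornerA_injective : Function.Injective M.cornerA := fun _ _ h => congrArg Ctx.a h
theorem cornerB_injective : Function.Injective M.cornerB := fun _ _ h => congrArg Ctx.b h

theorem cornerA_mul (a a' : A) : M.cornerA (a * a') = M.cornerA a * M.cornerA a' := by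
  apply Ctx.ext <;> simp

theorem cornerB_mul (b b' : B) : M.cornerB (b * b') = M.cornerB b * M.cornerB b' := by
  apply Ctx.ext <;> simp

theorem cornerX_lX (a : A) (x : X) : M.cornerX (M.lX a x) = M.cornerA a * M.cornerX x := by
  apply Ctx.ext <;> simp

theorem cornerX_rX (x : X) (b : B) : M.cornerX (M.rX x b) = M.cornerX x * M.cornerB b := by
  apply Ctx.ext <;> simp

theorem cornerY_lY (b : B) (y : Y) : M.cornerY (M.lY b y) = M.cornerB b * M.cornerY y := by
  apply Ctx.ext <;> simp

theorem cornerY_rY (y : Y) (a : A) : M.cornerY (M.rY y a) = M.cornerY y * M.cornerA a := by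
  apply Ctx.ext <;> simp

theorem cornerA_τA (x : X) (y : Y) : M.cornerA (M.τA x y) = M.cornerX x * M.cornerY y := by
  apply Ctx.ext <;> simp

theorem cornerB_τB (y : Y) (x : X) : M.cornerB (M.τB y x) = M.cornerY y * M.cornerX x := by
  apply Ctx.ext <;> simp

theorem map_cornerA_sprod_cornerB (U : Submodule k A) (V : Submodule k B) :
    U.map M.cornerA ⊡ V.map M.cornerB = ⊥ := by
  rw [eq_bot_iff, sprod_le]
  rintro _ ⟨a, -, rfl⟩ _ ⟨b, -, rfl⟩
  rw [Submodule.mem_bot]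
  apply Ctx.ext <;> simp

theorem map_cornerB_sprod_cornerA (U : Submodule k B) (V : Submodule k A) :
    U.map M.cornerB ⊡ V.map M.cornerA = ⊥ := by
  rw [eq_bot_iff, sprod_le]
  rintro _ ⟨b, -, rfl⟩ _ ⟨a, -, rfl⟩
  rw [Submodule.mem_bot]
  apply Ctx.ext <;> simp

/-- The submodule of the matrices with entries in given submodules. -/
def box (U : Submodule k A) (V : Submodule k X) (W : Submodule k Y) (Z : Submodule k B) :
    Submodule k M.Ctx :=
  U.comap M.projA ⊓ V.comap M.projX ⊓ (W.comap M.projY ⊓ Z.comap M.projB)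

theorem mem_box {U : Submodule k A} {V : Submodule k X} {W : Submodule k Y} {Z : Submodule k B}
    {c : M.Ctx} : c ∈ M.box U V W Z ↔ (c.a ∈ U ∧ c.x ∈ V) ∧ (c.y ∈ W ∧ c.b ∈ Z) := Iff.rfl

theorem box_mono {U U' : Submodule k A} {V V' : Submodule k X} {W W' : Submodule k Y}
    {Z Z' : Submodule k B} (hU : U ≤ U') (hV : V ≤ V') (hW : W ≤ W') (hZ : Z ≤ Z') :
    M.box U V W Z ≤ M.box U' V' W' Z' :=
  fun _ h => ⟨⟨hU h.1.1, hV h.1.2⟩, ⟨hW h.2.1, hZ h.2.2⟩⟩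

theorem box_eq_sup (U : Submodule k A) (V : Submodule k X) (W : Submodule k Y)
    (Z : Submodule k B) : M.box U V W Z =
      U.map M.cornerA ⊔ V.map M.cornerX ⊔ W.map M.cornerY ⊔ Z.map M.cornerB := by
  apply le_antisymm
  · intro c hc
    rw [M.eq_sum_corners c]
    exact Submodule.add_mem_sup (Submodule.add_mem_sup (Submodule.add_mem_sup
      ⟨c.a, hc.1.1, rfl⟩ ⟨c.x, hc.1.2, rfl⟩) ⟨c.y, hc.2.1, rfl⟩) ⟨c.b, hc.2.2, rfl⟩
  · refine sup_le (sup_le (sup_le ?_ ?_) ?_) ?_ <;> rintro _ ⟨z, hz, rfl⟩ <;>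
      simp only [mem_box, cornerA_a, cornerA_x, cornerA_y, cornerA_b, cornerX_a, cornerX_x,
        cornerX_y, cornerX_b, cornerY_a, cornerY_x, cornerY_y, cornerY_b, cornerB_a, cornerB_x,
        cornerB_y, cornerB_b, zero_mem, and_true, true_and] <;> exact hz

theorem iSupIndep_box {ι : Type*} {U : ι → Submodule k A} {V : ι → Submodule k X}
    {W : ι → Submodule k Y} {Z : ι → Submodule k B} (hU : iSupIndep U) (hV : iSupIndep V)
    (hW : iSupIndep W) (hZ : iSupIndep Z) :
    iSupIndep fun i => M.box (U i) (V i) (W i) (Z i) := by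
  intro i
  rw [Submodule.disjoint_def]
  intro c hc hc'
  have h1 : c ∈ M.box (⨆ j, ⨆ _ : j ≠ i, U j) (⨆ j, ⨆ _ : j ≠ i, V j) (⨆ j, ⨆ _ : j ≠ i, W j)
      (⨆ j, ⨆ _ : j ≠ i, Z j) := by
    have h2 : (⨆ j, ⨆ _ : j ≠ i, M.box (U j) (V j) (W j) (Z j)) ≤
        M.box (⨆ j, ⨆ _ : j ≠ i, U j) (⨆ j, ⨆ _ : j ≠ i, V j) (⨆ j, ⨆ _ : j ≠ i, W j)
          (⨆ j, ⨆ _ : j ≠ i, Z j) :=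
      iSup₂_le fun j hj => M.box_mono (le_iSup₂_of_le j hj le_rfl) (le_iSup₂_of_le j hj le_rfl)
        (le_iSup₂_of_le j hj le_rfl) (le_iSup₂_of_le j hj le_rfl)
    exact h2 hc'
  exact Ctx.ext (Submodule.disjoint_def.1 (hU i) _ hc.1.1 h1.1.1)
    (Submodule.disjoint_def.1 (hV i) _ hc.1.2 h1.1.2)
    (Submodule.disjoint_def.1 (hW i) _ hc.2.1 h1.2.1)
    (Submodule.disjoint_def.1 (hZ i) _ hc.2.2 h1.2.2)

theorem iSup_box {ι : Type*} {U : ι → Submodule k A} {V : ι → Submodule k X}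
    {W : ι → Submodule k Y} {Z : ι → Submodule k B} (hU : ⨆ i, U i = ⊤) (hV : ⨆ i, V i = ⊤)
    (hW : ⨆ i, W i = ⊤) (hZ : ⨆ i, Z i = ⊤) :
    ⨆ i, M.box (U i) (V i) (W i) (Z i) = ⊤ := by
  have h : M.box ⊤ ⊤ ⊤ ⊤ = ⊤ := by
    rw [eq_top_iff]
    exact fun c _ => ⟨⟨trivial, trivial⟩, ⟨trivial, trivial⟩⟩
  simp only [box_eq_sup, iSup_sup_eq]
  rw [← Submodule.map_iSup, ← Submodule.map_iSup, ← Submodule.map_iSup, ← Submodule.map_iSup,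
    hU, hV, hW, hZ, ← box_eq_sup, h]

end MoritaContext

end ContextAlgebra

/-! ### The graded context algebra of a strong-graded-equivalence. -/

section GradedContextAlgebra

variable {k : Type uk} {G : Type uG} {A : Type uA} {B : Type uB} {X : Type uX} {Y : Type uY}
    [CommRing k] [Group G]
    [NonUnitalRing A] [Module k A] [IsScalarTower k A A] [SMulCommClass k A A]
    [NonUnitalRing B] [Module k B] [IsScalarTower k B B] [SMulCommClass k B B]
    [AddCommGroup X] [Module k X] [AddCommGroup Y] [Module k Y]
    {𝒜 : GroupGrading k G A} {ℬ : GroupGrading k G B}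

section ModuleFamilies

variable {S : Type*} [NonUnitalRing S] [Module k S] [IsScalarTower k S S] [SMulCommClass k S S]

/-- Unitality over $D_t$ gives $x_t=a_t(a_{t^{-1}}x_t)\subseteq a_tx_1$. This is how all components
of a bimodule are recovered from the one of degree one. -/
theorem sprod_one_of_unital {a x : G → Submodule k S} (hax : ∀ s t, a s ⊡ x t ≤ x (s * t))
    (hu : ∀ t, a t ⊡ a t⁻¹ ⊡ x t = x t) (t : G) : a t ⊡ x 1 = x t := by
  apply le_antisymm
  · simpa using hax t 1
  · calc x t = a t ⊡ (a t⁻¹ ⊡ x t) := by rw [← sprod_assoc, hu]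
      _ ≤ _ := sprod_mono le_rfl (by simpa using hax t⁻¹ t)

theorem one_sprod_of_unital {b x : G → Submodule k S} (hxb : ∀ s t, x s ⊡ b t ≤ x (s * t))
    (hu : ∀ t, x t ⊡ (b t⁻¹ ⊡ b t) = x t) (t : G) : x 1 ⊡ b t = x t := by
  apply le_antisymm
  · simpa using hxb 1 t
  · calc x t = x t ⊡ b t⁻¹ ⊡ b t := by rw [sprod_assoc, hu]
      _ ≤ _ := sprod_mono (by simpa using hxb t t⁻¹) le_rfl

/-- Wherever two factors `C` are adjacent, the left one may be replaced by its diagonal part `d`.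
Doing so from left to right leaves a single non-diagonal factor, `C 1`, at the end. -/
theorem sprod_sprod_of_diagonal {C d : G → Submodule k S}
    (h : ∀ s t, C s ⊡ C t = d s ⊡ C t) {s : G} (h1 : C s = d s ⊡ C 1) (r t u : G) :
    C r ⊡ (C t ⊡ C u ⊡ C s) = d r ⊡ (d t ⊡ (d u ⊡ d s)) ⊡ C 1 := by
  calc C r ⊡ (C t ⊡ C u ⊡ C s) = C r ⊡ C t ⊡ (C u ⊡ C s) := by simp only [sprod_assoc]
    _ = d r ⊡ (C t ⊡ C u ⊡ C s) := by rw [h r t]; simp only [sprod_assoc]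
    _ = d r ⊡ (d t ⊡ (d u ⊡ C s)) := by rw [h t u, sprod_assoc, h u s]
    _ = _ := by rw [h1]; simp only [sprod_assoc]

end ModuleFamilies

namespace GradedMoritaContext

variable (M : GradedMoritaContext 𝒜 ℬ X Y)

/-- The grading of the context algebra of a graded Morita context. -/
def ctxGrading : GroupGrading k G M.Ctx where
  comp t := M.box (𝒜.comp t) (M.Xc t) (M.Yc t) (ℬ.comp t)
  indep := M.iSupIndep_box 𝒜.indep M.X_indep M.Y_indep ℬ.indep
  iSup_eq_top := M.iSup_box 𝒜.iSup_eq_top M.X_iSup M.Y_iSup ℬ.iSup_eq_top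
  mul_mem s t c d hc hd := by
    obtain ⟨⟨ha, hx⟩, hy, hb⟩ := hc
    obtain ⟨⟨ha', hx'⟩, hy', hb'⟩ := hd
    exact ⟨⟨add_mem (𝒜.mul_mem s t _ _ ha ha') (M.τA_mem s t _ _ hx hy'),
      add_mem (M.lX_mem s t _ _ ha hx') (M.rX_mem s t _ _ hx hb')⟩,
      add_mem (M.rY_mem s t _ _ hy ha') (M.lY_mem s t _ _ hb hy'),
      add_mem (M.τB_mem s t _ _ hy hx') (ℬ.mul_mem s t _ _ hb hb')⟩

variable {M}

theorem map_comp_sprod_Xc (hM : M.IsStrongEquivalence) (t : G) :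
    (𝒜.comp t).map M.cornerA ⊡ (M.Xc 1).map M.cornerX = (M.Xc t).map M.cornerX := by
  refine sprod_one_of_unital (a := fun t => (𝒜.comp t).map M.cornerA)
    (x := fun t => (M.Xc t).map M.cornerX) (fun s t => ?_) (fun t => ?_) t
  · rw [← map_map₂_eq_sprod M.lX M.cornerX _ _ M.cornerX_lX]
    exact Submodule.map_mono (Submodule.map₂_le.2 fun a ha x hx => M.lX_mem s t a x ha hx)
  · rw [← map_sprod _ M.cornerA_mul, ← map_map₂_eq_sprod M.lX M.cornerX _ _ M.cornerX_lX]
    exact congrArg _ (hM.lX_unital t)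

theorem Xc_sprod_map_comp (hM : M.IsStrongEquivalence) (t : G) :
    (M.Xc 1).map M.cornerX ⊡ (ℬ.comp t).map M.cornerB = (M.Xc t).map M.cornerX := by
  refine one_sprod_of_unital (b := fun t => (ℬ.comp t).map M.cornerB)
    (x := fun t => (M.Xc t).map M.cornerX) (fun s t => ?_) (fun t => ?_) t
  · rw [← map_map₂_eq_sprod M.rX M.cornerX _ _ M.cornerX_rX]
    exact Submodule.map_mono (Submodule.map₂_le.2 fun x hx b hb => M.rX_mem s t x b hx hb)
  · rw [← map_sprod _ M.cornerB_mul, ← map_map₂_eq_sprod M.rX M.cornerX _ _ M.cornerX_rX]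
    refine congrArg _ ?_
    have := hM.rX_unital t
    rwa [GroupGrading.D, inv_inv] at this

theorem map_comp_sprod_Yc (hM : M.IsStrongEquivalence) (t : G) :
    (ℬ.comp t).map M.cornerB ⊡ (M.Yc 1).map M.cornerY = (M.Yc t).map M.cornerY := by
  refine sprod_one_of_unital (a := fun t => (ℬ.comp t).map M.cornerB)
    (x := fun t => (M.Yc t).map M.cornerY) (fun s t => ?_) (fun t => ?_) t
  · rw [← map_map₂_eq_sprod M.lY M.cornerY _ _ M.cornerY_lY]
    exact Submodule.map_mono (Submodule.map₂_le.2 fun a ha x hx => M.lY_mem s t a x ha hx)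
  · rw [← map_sprod _ M.cornerB_mul, ← map_map₂_eq_sprod M.lY M.cornerY _ _ M.cornerY_lY]
    exact congrArg _ (hM.lY_unital t)

theorem Yc_sprod_map_comp (hM : M.IsStrongEquivalence) (t : G) :
    (M.Yc 1).map M.cornerY ⊡ (𝒜.comp t).map M.cornerA = (M.Yc t).map M.cornerY := by
  refine one_sprod_of_unital (b := fun t => (𝒜.comp t).map M.cornerA)
    (x := fun t => (M.Yc t).map M.cornerY) (fun s t => ?_) (fun t => ?_) t
  · rw [← map_map₂_eq_sprod M.rY M.cornerY _ _ M.cornerY_rY]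
    exact Submodule.map_mono (Submodule.map₂_le.2 fun x hx b hb => M.rY_mem s t x b hx hb)
  · rw [← map_sprod _ M.cornerA_mul, ← map_map₂_eq_sprod M.rY M.cornerY _ _ M.cornerY_rY]
    refine congrArg _ ?_
    have := hM.rY_unital t
    rwa [GroupGrading.D, inv_inv] at this

/-- Both $A_tX_1$ and $X_1B_t$ equal $X_t$, which gives the commutation rule. The product rules are
the pairing conditions at $t=1$, where $D_1$ is the whole component of degree one. -/
theorem cornerEquivalence (hM : M.IsStrongEquivalence) (hA : 𝒜.IsPartiallyStrong)
    (hB : ℬ.IsPartiallyStrong) :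
    CornerEquivalence (fun t => (𝒜.comp t).map M.cornerA) (fun t => (ℬ.comp t).map M.cornerB)
      ((M.Xc 1).map M.cornerX) ((M.Yc 1).map M.cornerY) where
  left := GroupGrading.isPartiallyStrongFamily_map hA _ M.cornerA_mul
  right := GroupGrading.isPartiallyStrongFamily_map hB _ M.cornerB_mul
  one_P := map_comp_sprod_Xc hM 1
  one_Q := map_comp_sprod_Yc hM 1
  PQ := by
    have h := hM.τA_comp 1
    rw [inv_one, GroupGrading.D_one hA] at h
    rw [← map_map₂_eq_sprod M.τA M.cornerA _ _ M.cornerA_τA, h]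
  QP := by
    have h := hM.τB_comp 1
    rw [inv_one, GroupGrading.D_one hB] at h
    rw [← map_map₂_eq_sprod M.τB M.cornerB _ _ M.cornerB_τB, h]
  comm_P t := (map_comp_sprod_Xc hM t).trans (Xc_sprod_map_comp hM t).symm
  comm_Q t := (map_comp_sprod_Yc hM t).trans (Yc_sprod_map_comp hM t).symm

theorem ctxGrading_comp (M : GradedMoritaContext 𝒜 ℬ X Y) (t : G) : M.ctxGrading.comp t =
    (𝒜.comp t).map M.cornerA ⊔ (M.Xc t).map M.cornerX ⊔ (M.Yc t).map M.cornerY ⊔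
      (ℬ.comp t).map M.cornerB := M.box_eq_sup _ _ _ _

theorem cornerA_le (M : GradedMoritaContext 𝒜 ℬ X Y) (t : G) :
    (𝒜.comp t).map M.cornerA ≤ M.ctxGrading.comp t := by
  rw [ctxGrading_comp]
  exact le_sup_left.trans (le_sup_left.trans le_sup_left)

theorem cornerX_le (M : GradedMoritaContext 𝒜 ℬ X Y) (t : G) :
    (M.Xc t).map M.cornerX ≤ M.ctxGrading.comp t := by
  rw [ctxGrading_comp]
  exact le_sup_right.trans (le_sup_left.trans le_sup_left)

theorem cornerY_le (M : GradedMoritaContext 𝒜 ℬ X Y) (t : G) :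
    (M.Yc t).map M.cornerY ≤ M.ctxGrading.comp t := by
  rw [ctxGrading_comp]
  exact le_sup_right.trans le_sup_left

theorem cornerB_le (M : GradedMoritaContext 𝒜 ℬ X Y) (t : G) :
    (ℬ.comp t).map M.cornerB ≤ M.ctxGrading.comp t := by
  rw [ctxGrading_comp]
  exact le_sup_right

/-- Each block of $C_t$ absorbs $A_tA_{t^{-1}}$ or $B_tB_{t^{-1}}$ on its left, so the diagonal
blocks alone suffice for the first two factors of $C_tC_{t^{-1}}C_t$. The other inclusion holds in
every grading. -/
theorem ctxGrading_isPartiallyStrong (hM : M.IsStrongEquivalence) (hA : 𝒜.IsPartiallyStrong)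
    (hB : ℬ.IsPartiallyStrong) : M.ctxGrading.IsPartiallyStrong := by
  have h := cornerEquivalence hM hA hB
  intro t
  apply le_antisymm
  · rw [sprod_assoc]
    conv_lhs => rw [ctxGrading_comp]
    refine sup_le (sup_le (sup_le ?_ ?_) ?_) ?_
    · rw [← h.left.strong t]
      exact sprod_mono (M.cornerA_le t) (sprod_mono (M.cornerA_le _) (M.cornerA_le t))
    · rw [← map_comp_sprod_Xc hM t, ← h.left.strong t, sprod_assoc, sprod_assoc,
        map_comp_sprod_Xc hM t]
      exact sprod_mono (M.cornerA_le t) (sprod_mono (M.cornerA_le _) (M.cornerX_le t))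
    · rw [← map_comp_sprod_Yc hM t, ← h.right.strong t, sprod_assoc, sprod_assoc,
        map_comp_sprod_Yc hM t]
      exact sprod_mono (M.cornerB_le t) (sprod_mono (M.cornerB_le _) (M.cornerY_le t))
    · rw [← h.right.strong t]
      exact sprod_mono (M.cornerB_le t) (sprod_mono (M.cornerB_le _) (M.cornerB_le t))
  · refine (sprod_mono (GroupGrading.sprod_comp_le _ _) le_rfl).trans
      ((GroupGrading.sprod_comp_le _ _).trans ?_)
    rw [mul_inv_cancel, one_mul]

/-- The rows of $C_t$ are $A_t(A_1\;X_1)$ and $B_t(Y_1\;B_1)$, so the degree can be carried entirely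
by diagonal matrices. -/
theorem ctxGrading_comp_eq (hM : M.IsStrongEquivalence) (hA : 𝒜.IsPartiallyStrong)
    (hB : ℬ.IsPartiallyStrong) (t : G) : M.ctxGrading.comp t =
      ((𝒜.comp t).map M.cornerA ⊔ (ℬ.comp t).map M.cornerB) ⊡ M.ctxGrading.comp 1 := by
  have h := cornerEquivalence hM hA hB
  apply le_antisymm
  · conv_lhs => rw [ctxGrading_comp]
    refine sup_le (sup_le (sup_le ?_ ?_) ?_) ?_
    · exact (h.left.mul_one t).ge.trans (sprod_mono le_sup_left (M.cornerA_le 1))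
    · exact (map_comp_sprod_Xc hM t).ge.trans (sprod_mono le_sup_left (M.cornerX_le 1))
    · exact (map_comp_sprod_Yc hM t).ge.trans (sprod_mono le_sup_right (M.cornerY_le 1))
    · exact (h.right.mul_one t).ge.trans (sprod_mono le_sup_right (M.cornerB_le 1))
  · calc _ ≤ M.ctxGrading.comp t ⊡ M.ctxGrading.comp 1 :=
          sprod_mono (sup_le (M.cornerA_le t) (M.cornerB_le t)) le_rfl
      _ ≤ _ := by simpa using GroupGrading.sprod_comp_le (𝒜 := M.ctxGrading) t 1

theorem ctxGrading_comp_sprod (hM : M.IsStrongEquivalence) (hA : 𝒜.IsPartiallyStrong)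
    (hB : ℬ.IsPartiallyStrong) (s t : G) : M.ctxGrading.comp s ⊡ M.ctxGrading.comp t =
      ((𝒜.comp s).map M.cornerA ⊔ (ℬ.comp s).map M.cornerB) ⊡ M.ctxGrading.comp t := by
  rw [ctxGrading_comp_eq hM hA hB s, sprod_assoc,
    GroupGrading.one_comp (ctxGrading_isPartiallyStrong hM hA hB)]

/-- The product of two submodules of diagonal matrices. -/
theorem diagonal_sprod_diagonal (M : MoritaContext k A B X Y) (U U' : Submodule k A)
    (V V' : Submodule k B) :
    (U.map M.cornerA ⊔ V.map M.cornerB) ⊡ (U'.map M.cornerA ⊔ V'.map M.cornerB) =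
      (U ⊡ U').map M.cornerA ⊔ (V ⊡ V').map M.cornerB := by
  rw [sup_sprod, sprod_sup, sprod_sup, M.map_cornerA_sprod_cornerB, M.map_cornerB_sprod_cornerA,
    sup_bot_eq, bot_sup_eq, map_sprod _ M.cornerA_mul, map_sprod _ M.cornerB_mul]

/-- The left side is an entry of the domain of the canonical partial action of the context algebra,
up to $r\mapsto r^{-1}$. A product of diagonal matrices does not mix $A$ with $B$, so in this form
the two corners can be read off. -/
theorem smashDomain_entry (hM : M.IsStrongEquivalence) (hA : 𝒜.IsPartiallyStrong)
    (hB : ℬ.IsPartiallyStrong) (r t s : G) :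
    M.ctxGrading.comp r ⊡ (M.ctxGrading.D t ⊡ M.ctxGrading.comp s) =
      ((𝒜.comp r ⊡ (𝒜.D t ⊡ 𝒜.comp s)).map M.cornerA ⊔
        (ℬ.comp r ⊡ (ℬ.D t ⊡ ℬ.comp s)).map M.cornerB) ⊡ M.ctxGrading.comp 1 := by
  have h1 (s t : G) := ctxGrading_comp_sprod hM hA hB s t
  have h2 := ctxGrading_comp_eq hM hA hB s
  have h3 := diagonal_sprod_diagonal M.toMoritaContext (𝒜.comp t⁻¹) (𝒜.comp s) (ℬ.comp t⁻¹)
    (ℬ.comp s)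
  have h4 := diagonal_sprod_diagonal M.toMoritaContext (𝒜.comp t) (𝒜.comp t⁻¹ ⊡ 𝒜.comp s)
    (ℬ.comp t) (ℬ.comp t⁻¹ ⊡ ℬ.comp s)
  have h5 := diagonal_sprod_diagonal M.toMoritaContext (𝒜.comp r)
    (𝒜.comp t ⊡ (𝒜.comp t⁻¹ ⊡ 𝒜.comp s)) (ℬ.comp r) (ℬ.comp t ⊡ (ℬ.comp t⁻¹ ⊡ ℬ.comp s))
  rw [GroupGrading.D, sprod_sprod_of_diagonal
    (d := fun t => (𝒜.comp t).map M.cornerA ⊔ (ℬ.comp t).map M.cornerB) h1 h2, h3, h4, h5]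
  simp only [GroupGrading.D, sprod_assoc]

/-- With $U=A_rD_tA_s$, the upper left block of the product in `smashDomain_entry` is $UA_1$, which
equals $U$; the part starting in $B$ contributes nothing to that block. -/
theorem cornerA_mem_smashDomain_entry (hM : M.IsStrongEquivalence) (hA : 𝒜.IsPartiallyStrong)
    (hB : ℬ.IsPartiallyStrong) (r t s : G) (x : A) :
    M.cornerA x ∈ M.ctxGrading.comp r ⊡ (M.ctxGrading.D t ⊡ M.ctxGrading.comp s) ↔
      x ∈ 𝒜.comp r ⊡ (𝒜.D t ⊡ 𝒜.comp s) := by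
  rw [smashDomain_entry hM hA hB]
  constructor
  · have key : ((𝒜.comp r ⊡ (𝒜.D t ⊡ 𝒜.comp s)).map M.cornerA ⊔
        (ℬ.comp r ⊡ (ℬ.D t ⊡ ℬ.comp s)).map M.cornerB) ⊡ M.ctxGrading.comp 1 ≤
        (𝒜.comp r ⊡ (𝒜.D t ⊡ 𝒜.comp s)).comap M.projA := by
      have h1 : 𝒜.comp r ⊡ (𝒜.D t ⊡ 𝒜.comp s) ⊡ 𝒜.comp 1 ≤ 𝒜.comp r ⊡ (𝒜.D t ⊡ 𝒜.comp s) := by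
        rw [sprod_assoc, sprod_assoc]
        refine sprod_mono le_rfl (sprod_mono le_rfl ?_)
        simpa using GroupGrading.sprod_comp_le (𝒜 := 𝒜) s 1
      rw [sup_sprod]
      refine sup_le (sprod_le.2 ?_) (sprod_le.2 ?_)
      · rintro _ ⟨a, ha, rfl⟩ c hc
        refine h1 ?_
        simpa using mul_mem_sprod ha hc.1.1
      · rintro _ ⟨b, hb, rfl⟩ c hc
        simp
    exact fun hx => key hx
  · intro hx
    have h1 : 𝒜.comp r ⊡ (𝒜.D t ⊡ 𝒜.comp s) ≤ 𝒜.comp r ⊡ (𝒜.D t ⊡ 𝒜.comp s) ⊡ 𝒜.comp 1 := by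
      have : 𝒜.comp s ≤ 𝒜.comp s ⊡ 𝒜.comp 1 := by
        calc 𝒜.comp s = 𝒜.comp s ⊡ 𝒜.D s⁻¹ := by
              conv_lhs => rw [hA s]
              rw [GroupGrading.D, inv_inv, sprod_assoc]
          _ ≤ _ := sprod_mono le_rfl (GroupGrading.D_le _)
      rw [sprod_assoc, sprod_assoc]
      exact sprod_mono le_rfl (sprod_mono le_rfl this)
    have h2 : M.cornerA x ∈ (𝒜.comp r ⊡ (𝒜.D t ⊡ 𝒜.comp s) ⊡ 𝒜.comp 1).map M.cornerA :=
      ⟨x, h1 hx, rfl⟩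
    rw [map_sprod _ M.cornerA_mul] at h2
    exact sprod_mono le_sup_left (M.cornerA_le 1) h2

theorem cornerB_mem_smashDomain_entry (hM : M.IsStrongEquivalence) (hA : 𝒜.IsPartiallyStrong)
    (hB : ℬ.IsPartiallyStrong) (r t s : G) (x : B) :
    M.cornerB x ∈ M.ctxGrading.comp r ⊡ (M.ctxGrading.D t ⊡ M.ctxGrading.comp s) ↔
      x ∈ ℬ.comp r ⊡ (ℬ.D t ⊡ ℬ.comp s) := by
  rw [smashDomain_entry hM hA hB]
  constructor
  · have key : ((𝒜.comp r ⊡ (𝒜.D t ⊡ 𝒜.comp s)).map M.cornerA ⊔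
        (ℬ.comp r ⊡ (ℬ.D t ⊡ ℬ.comp s)).map M.cornerB) ⊡ M.ctxGrading.comp 1 ≤
        (ℬ.comp r ⊡ (ℬ.D t ⊡ ℬ.comp s)).comap M.projB := by
      have h1 : ℬ.comp r ⊡ (ℬ.D t ⊡ ℬ.comp s) ⊡ ℬ.comp 1 ≤ ℬ.comp r ⊡ (ℬ.D t ⊡ ℬ.comp s) := by
        rw [sprod_assoc, sprod_assoc]
        refine sprod_mono le_rfl (sprod_mono le_rfl ?_)
        simpa using GroupGrading.sprod_comp_le (𝒜 := ℬ) s 1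
      rw [sup_sprod]
      refine sup_le (sprod_le.2 ?_) (sprod_le.2 ?_)
      · rintro _ ⟨a, ha, rfl⟩ c hc
        simp
      · rintro _ ⟨b, hb, rfl⟩ c hc
        refine h1 ?_
        simpa using mul_mem_sprod hb hc.2.2
    exact fun hx => key hx
  · intro hx
    have h1 : ℬ.comp r ⊡ (ℬ.D t ⊡ ℬ.comp s) ≤ ℬ.comp r ⊡ (ℬ.D t ⊡ ℬ.comp s) ⊡ ℬ.comp 1 := by
      have : ℬ.comp s ≤ ℬ.comp s ⊡ ℬ.comp 1 := by
        calc ℬ.comp s = ℬ.comp s ⊡ ℬ.D s⁻¹ := by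
              conv_lhs => rw [hB s]
              rw [GroupGrading.D, inv_inv, sprod_assoc]
          _ ≤ _ := sprod_mono le_rfl (GroupGrading.D_le _)
      rw [sprod_assoc, sprod_assoc]
      exact sprod_mono le_rfl (sprod_mono le_rfl this)
    have h2 : M.cornerB x ∈ (ℬ.comp r ⊡ (ℬ.D t ⊡ ℬ.comp s) ⊡ ℬ.comp 1).map M.cornerB :=
      ⟨x, h1 hx, rfl⟩
    rw [map_sprod _ M.cornerB_mul] at h2
    exact sprod_mono le_sup_right (M.cornerB_le 1) h2

end GradedMoritaContext

end GradedContextAlgebra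

/-! ### Transport of product partial actions along isomorphisms. -/

section Transport

variable {k : Type uk} {G : Type uG} {A : Type uA} {B : Type uB} [CommRing k] [Group G]
    [NonUnitalRing A] [Module k A] [IsScalarTower k A A] [SMulCommClass k A A]
    [NonUnitalRing B] [Module k B] [IsScalarTower k B B] [SMulCommClass k B B]

theorem comap_sprod_comap (e : A ≃ₗ[k] B) (he : ∀ x y, e (x * y) = e x * e y)
    (U V : Submodule k B) :
    U.comap e.toLinearMap ⊡ V.comap e.toLinearMap = (U ⊡ V).comap e.toLinearMap := by
  refine Submodule.map_injective_of_injective (f := e.toLinearMap) e.injective ?_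
  rw [map_sprod e.toLinearMap he]
  simp only [Submodule.map_comap_eq_of_surjective (f := e.toLinearMap) e.surjective]

/-- Transport of a product partial action along an algebra isomorphism. -/
def ProductPartialAction.transport (β : ProductPartialAction k G B) (e : A ≃ₗ[k] B)
    (he : ∀ x y, e (x * y) = e x * e y) : ProductPartialAction k G A where
  D t := (β.D t).comap e.toLinearMap
  mul_mem_left t a x hx := by
    change e (a * x) ∈ β.D t
    rw [he]; exact β.mul_mem_left t _ _ hx
  mul_mem_right t a x hx := by
    change e (a * x) ∈ β.D t
    rw [he]; exact β.mul_mem_right t _ _ hx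
  α t :=
    (e.ofSubmodule' (β.D t⁻¹)).trans ((β.α t).trans (e.ofSubmodule' (β.D t)).symm)
  map_mul t x y hxy := by
    change e.symm (β.α t ⟨e (x.1 * y.1), hxy⟩) =
      e.symm (β.α t ⟨e x.1, x.2⟩) * e.symm (β.α t ⟨e y.1, y.2⟩)
    have h : e x.1 * e y.1 ∈ β.D t⁻¹ := by rw [← he]; exact hxy
    have h1 : (⟨e (x.1 * y.1), hxy⟩ : β.D t⁻¹) = ⟨e x.1 * e y.1, h⟩ := Subtype.ext (he _ _)
    apply e.injective
    rw [h1, he, e.apply_symm_apply, e.apply_symm_apply, e.apply_symm_apply]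
    exact β.map_mul t ⟨e x.1, x.2⟩ ⟨e y.1, y.2⟩ h
  D_one := by rw [β.D_one, Submodule.comap_top]
  α_one x := by
    change e.symm (β.α 1 ⟨e x.1, x.2⟩) = x
    rw [β.α_one, e.symm_apply_apply]
  D_idem t := by rw [comap_sprod_comap e he, β.D_idem]
  D_comm s t := by rw [comap_sprod_comap e he, comap_sprod_comap e he, β.D_comm]
  image_eq s t := by
    rw [comap_sprod_comap e he, comap_sprod_comap e he, ← β.image_eq]
    ext x
    constructor
    · rintro ⟨y, hy, rfl⟩
      exact ⟨⟨e y.1, y.2⟩, hy, (e.apply_symm_apply _).symm⟩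
    · rintro ⟨y, hy, hyx⟩
      refine ⟨⟨e.symm y.1, ?_⟩, ?_, ?_⟩
      · rw [Submodule.mem_comap, LinearEquiv.coe_coe, e.apply_symm_apply]; exact y.2
      · change e (e.symm y.1) ∈ β.D s⁻¹ ⊡ β.D t
        rw [e.apply_symm_apply]; exact hy
      · change e.symm (β.α s ⟨e (e.symm y.1), _⟩) = x
        rw [e.symm_apply_eq]
        refine Eq.trans ?_ hyx
        change (β.α s ⟨e (e.symm y.1), _⟩ : B) = β.α s y
        congr 2
        exact Subtype.ext (e.apply_symm_apply _)
  comp_eq s t x hx h₁ h₂ h₃ := by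
    change e x ∈ β.D t⁻¹ at h₁
    change e x ∈ β.D (s * t)⁻¹ at h₂
    change e (e.symm (β.α t ⟨e x, h₁⟩)) ∈ β.D s⁻¹ at h₃
    change e.symm (β.α s ⟨e (e.symm (β.α t ⟨e x, h₁⟩)), h₃⟩) = e.symm (β.α (s * t) ⟨e x, h₂⟩)
    rw [comap_sprod_comap e he] at hx
    congr 1
    have h4 : (β.α t ⟨e x, h₁⟩ : B) ∈ β.D s⁻¹ := by rwa [e.apply_symm_apply] at h₃
    rw [← β.comp_eq s t (e x) hx h₁ h₂ h4]
    congr 2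
    exact Subtype.ext (e.apply_symm_apply _)

end Transport

/-! ### The context algebra of an internal context, mapped to the ambient algebra. -/

section InternalContextAlgebra

variable {k : Type uk} {A : Type uA} {B : Type uB} {S : Type uX} [CommRing k]
    [NonUnitalRing A] [Module k A] [IsScalarTower k A A] [SMulCommClass k A A]
    [NonUnitalRing B] [Module k B] [IsScalarTower k B B] [SMulCommClass k B B]
    [NonUnitalRing S] [Module k S] [IsScalarTower k S S] [SMulCommClass k S S]
    {φ : A →ₗ[k] S} {ψ : B →ₗ[k] S} {X Y : Submodule k S}

namespace InternalContext

theorem of_sprod_le (hφ : ∀ a a', φ (a * a') = φ a * φ a') (hψ : ∀ b b', ψ (b * b') = ψ b * ψ b')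
    (hφi : Function.Injective φ) (hψi : Function.Injective ψ)
    (h1 : LinearMap.range φ ⊡ X ≤ X) (h2 : X ⊡ LinearMap.range ψ ≤ X)
    (h3 : LinearMap.range ψ ⊡ Y ≤ Y) (h4 : Y ⊡ LinearMap.range φ ≤ Y)
    (h5 : X ⊡ Y ≤ LinearMap.range φ) (h6 : Y ⊡ X ≤ LinearMap.range ψ) :
    InternalContext φ ψ X Y where
  φ_mul := hφ
  ψ_mul := hψ
  φ_inj := hφi
  ψ_inj := hψi
  lX a _ hx := h1 (mul_mem_sprod ⟨a, rfl⟩ hx)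
  rX _ hx b := h2 (mul_mem_sprod hx ⟨b, rfl⟩)
  lY b _ hy := h3 (mul_mem_sprod ⟨b, rfl⟩ hy)
  rY _ hy a := h4 (mul_mem_sprod hy ⟨a, rfl⟩)
  XY _ hx _ hy := h5 (mul_mem_sprod hx hy)
  YX _ hy _ hx := h6 (mul_mem_sprod hy hx)

theorem isEquivalence (h : InternalContext φ ψ X Y)
    (h1 : LinearMap.range φ ⊡ X = X) (h2 : X ⊡ LinearMap.range ψ = X)
    (h3 : LinearMap.range ψ ⊡ Y = Y) (h4 : Y ⊡ LinearMap.range φ = Y)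
    (h5 : X ⊡ Y = LinearMap.range φ) (h6 : Y ⊡ X = LinearMap.range ψ) :
    h.toMoritaContext.IsEquivalence where
  lX_unital := by
    refine Submodule.map_injective_of_injective X.injective_subtype ?_
    refine (h.map_left ⊤ ⊤).trans ?_
    rw [Submodule.map_subtype_top, Submodule.map_top, h1]
  rX_unital := by
    refine Submodule.map_injective_of_injective X.injective_subtype ?_
    refine (h.map_right ⊤ ⊤).trans ?_
    rw [Submodule.map_subtype_top, Submodule.map_top, h2]
  lY_unital := by
    refine Submodule.map_injective_of_injective Y.injective_subtype ?_
    refine (h.symm.map_left ⊤ ⊤).trans ?_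
    rw [Submodule.map_subtype_top, Submodule.map_top, h3]
  rY_unital := by
    refine Submodule.map_injective_of_injective Y.injective_subtype ?_
    refine (h.symm.map_right ⊤ ⊤).trans ?_
    rw [Submodule.map_subtype_top, Submodule.map_top, h4]
  τA_surjective := by
    refine Submodule.map_injective_of_injective h.φ_inj ?_
    refine (h.map_map₂_pairing ⊤ ⊤).trans ?_
    rw [Submodule.map_subtype_top, Submodule.map_subtype_top, Submodule.map_top, h5]
  τB_surjective := by
    refine Submodule.map_injective_of_injective h.ψ_inj ?_
    refine (h.symm.map_map₂_pairing ⊤ ⊤).trans ?_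
    rw [Submodule.map_subtype_top, Submodule.map_subtype_top, Submodule.map_top, h6]

/-- The map from the context algebra to the ambient algebra. -/
noncomputable def ctxMap (h : InternalContext φ ψ X Y) : h.toMoritaContext.Ctx →ₗ[k] S where
  toFun c := φ c.a + c.x + c.y + ψ c.b
  map_add' c d := by
    simp only [MoritaContext.Ctx.add_a, MoritaContext.Ctx.add_b, MoritaContext.Ctx.add_x,
      MoritaContext.Ctx.add_y, map_add, Submodule.coe_add]
    abel
  map_smul' r c := by
    simp only [MoritaContext.Ctx.smul_a, MoritaContext.Ctx.smul_b, MoritaContext.Ctx.smul_x,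
      MoritaContext.Ctx.smul_y, map_smul, Submodule.coe_smul, smul_add, RingHom.id_apply]

theorem ctxMap_apply (h : InternalContext φ ψ X Y) (c : h.toMoritaContext.Ctx) :
    h.ctxMap c = φ c.a + c.x + c.y + ψ c.b := rfl

/-- Of the sixteen products of two blocks, eight occur in the matrix product. The hypotheses say
that the other eight, whose inner indices do not match, vanish in the ambient algebra. -/
theorem ctxMap_mul (h : InternalContext φ ψ X Y)
    (h1 : LinearMap.range φ ⊡ Y = ⊥) (h2 : LinearMap.range φ ⊡ LinearMap.range ψ = ⊥)
    (h3 : X ⊡ LinearMap.range φ = ⊥) (h4 : X ⊡ X = ⊥)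
    (h5 : LinearMap.range ψ ⊡ X = ⊥) (h6 : LinearMap.range ψ ⊡ LinearMap.range φ = ⊥)
    (h7 : Y ⊡ LinearMap.range ψ = ⊥) (h8 : Y ⊡ Y = ⊥) (c d : h.toMoritaContext.Ctx) :
    h.ctxMap (c * d) = h.ctxMap c * h.ctxMap d := by
  have z {U V : Submodule k S} (hUV : U ⊡ V = ⊥) {u v : S} (hu : u ∈ U) (hv : v ∈ V) :
      u * v = 0 := by
    have := mul_mem_sprod hu hv
    rwa [hUV, Submodule.mem_bot] at this
  have e1 := z h1 ⟨c.a, rfl⟩ d.y.2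
  have e2 := z h2 ⟨c.a, rfl⟩ ⟨d.b, rfl⟩
  have e3 := z h3 c.x.2 ⟨d.a, rfl⟩
  have e4 := z h4 c.x.2 d.x.2
  have e5 := z h5 ⟨c.b, rfl⟩ d.x.2
  have e6 := z h6 ⟨c.b, rfl⟩ ⟨d.a, rfl⟩
  have e7 := z h7 c.y.2 ⟨d.b, rfl⟩
  have e8 := z h8 c.y.2 d.y.2
  have f1 : φ (h.toMoritaContext.τA c.x d.y) = c.x * d.y := h.map_pairing _ _
  have f2 : ψ (h.toMoritaContext.τB c.y d.x) = c.y * d.x := h.symm.map_pairing _ _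
  have f3 : (h.toMoritaContext.lX c.a d.x : S) = φ c.a * d.x := rfl
  have f4 : (h.toMoritaContext.rX c.x d.b : S) = c.x * ψ d.b := rfl
  have f5 : (h.toMoritaContext.lY c.b d.y : S) = ψ c.b * d.y := rfl
  have f6 : (h.toMoritaContext.rY c.y d.a : S) = c.y * φ d.a := rfl
  rw [ctxMap_apply, ctxMap_apply, ctxMap_apply, MoritaContext.Ctx.mul_a, MoritaContext.Ctx.mul_x,
    MoritaContext.Ctx.mul_y, MoritaContext.Ctx.mul_b, map_add, map_add, Submodule.coe_add,
    Submodule.coe_add, f1, f2, f3, f4, f5, f6, h.φ_mul, h.ψ_mul]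
  simp only [add_mul, mul_add, e1, e2, e3, e4, e5, e6, e7, e8]
  abel

theorem range_ctxMap (h : InternalContext φ ψ X Y) :
    LinearMap.range h.ctxMap = LinearMap.range φ ⊔ X ⊔ Y ⊔ LinearMap.range ψ := by
  apply le_antisymm
  · rintro _ ⟨c, rfl⟩
    exact Submodule.add_mem_sup (Submodule.add_mem_sup (Submodule.add_mem_sup ⟨_, rfl⟩ c.x.2)
      c.y.2) ⟨_, rfl⟩
  · refine sup_le (sup_le (sup_le ?_ ?_) ?_) ?_
    · rintro _ ⟨a, rfl⟩
      exact ⟨⟨a, 0, 0, 0⟩, by simp [ctxMap_apply]⟩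
    · intro x hx
      exact ⟨⟨0, ⟨x, hx⟩, 0, 0⟩, by simp [ctxMap_apply]⟩
    · intro y hy
      exact ⟨⟨0, 0, ⟨y, hy⟩, 0⟩, by simp [ctxMap_apply]⟩
    · rintro _ ⟨b, rfl⟩
      exact ⟨⟨0, 0, 0, b⟩, by simp [ctxMap_apply]⟩

end InternalContext

end InternalContextAlgebra

/-! ### Entrywise maps of finite matrices. -/

section MatrixMaps

variable {k : Type uk} {G : Type uG} {A : Type uA} {B : Type uB} [CommRing k]
    [NonUnitalRing A] [Module k A] [NonUnitalRing B] [Module k B]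

namespace FMat

/-- The entrywise application of a linear map. -/
noncomputable def map (f : A →ₗ[k] B) : FMat G A →ₗ[k] FMat G B :=
  Finsupp.mapRange.linearMap f

theorem map_single (f : A →ₗ[k] B) (p : G × G) (a : A) :
    map f (single p a) = single p (f a) :=
  Finsupp.mapRange_single (hf := map_zero f)

theorem map_injective {f : A →ₗ[k] B} (hf : Function.Injective f) :
    Function.Injective (map f : FMat G A →ₗ[k] FMat G B) :=
  Finsupp.mapRange_injective f (map_zero f) hf

theorem map_mul {f : A →ₗ[k] B} (hf : ∀ a a', f (a * a') = f a * f a') (M N : FMat G A) :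
    map f (M * N) = map f M * map f N := by
  classical
  induction M using induction_on with
  | h0 => simp only [map_zero, zero_mul]
  | hadd M M' h h' => simp only [map_add, add_mul, h, h']
  | hs p a =>
  induction N using induction_on with
  | h0 => simp only [map_zero, mul_zero]
  | hadd M M' h h' => simp only [map_add, mul_add, h, h']
  | hs q b =>
  rw [map_single, map_single, single_mul_single, single_mul_single]
  split_ifs
  · rw [map_single, hf]
  · rw [map_zero]

theorem map_shift [Group G] (f : A →ₗ[k] B) (t : G) (M : FMat G A) :
    map f (shift k t M) = shift k t (map f M) :=
  DFunLike.ext _ _ fun _ => rfl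

theorem map_map_entrywise (f : A →ₗ[k] B) (U : G → G → Submodule k A) :
    (entrywise U).map (map f) = entrywise fun r s => (U r s).map f := by
  apply le_antisymm
  · rintro _ ⟨M, hM, rfl⟩ r s
    exact ⟨M (r, s), hM r s, rfl⟩
  · refine entrywise_le fun p b hb => ?_
    obtain ⟨a, ha, rfl⟩ := hb
    exact ⟨single p a, single_mem ha, map_single f p a⟩

theorem entrywise_sup (U V : G → G → Submodule k B) :
    entrywise (fun r s => U r s ⊔ V r s) = entrywise U ⊔ entrywise V := by
  apply le_antisymm
  · refine entrywise_le fun p b hb => ?_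
    obtain ⟨u, hu, v, hv, rfl⟩ := Submodule.mem_sup.1 hb
    rw [single_add]
    exact Submodule.add_mem_sup (single_mem hu) (single_mem hv)
  · exact sup_le (entrywise_mono fun _ _ => le_sup_left) (entrywise_mono fun _ _ => le_sup_right)

end FMat

end MatrixMaps

/-! ### Products of bordered matrices. -/

section Bordered

variable {k : Type uk} {G : Type uG} {S : Type uX} [CommRing k] [Group G] [NonUnitalRing S]
  [Module k S] [IsScalarTower k S S] [SMulCommClass k S S]

/-- The matrices whose `(r,s)`-entry lies in `a_{r⁻¹} U b_s`. -/
def bordered (a : G → Submodule k S) (U : Submodule k S) (b : G → Submodule k S) :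
    Submodule k (FMat G S) :=
  FMat.entrywise fun r s => a r⁻¹ ⊡ (U ⊡ b s)

variable {a b b' c : G → Submodule k S}

/-- The sum over the inner index `u` is dominated by its term at `u = 1`, because `b u ⊡ b u⁻¹ ≤ b
1` and `U` absorbs `b 1`. Products of such matrix modules thus reduce to products of their middle
factors. -/
theorem bordered_sprod (hb : IsPartiallyStrongFamily b) {U V : Submodule k S} (hU : U ⊡ b 1 = U) :
    bordered a U b ⊡ bordered b V c = bordered a (U ⊡ V) c := by
  rw [bordered, bordered, FMat.entrywise_sprod, bordered]
  congr 1
  funext r s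
  apply le_antisymm
  · refine iSup_le fun u => ?_
    calc a r⁻¹ ⊡ (U ⊡ b u) ⊡ (b u⁻¹ ⊡ (V ⊡ c s)) = a r⁻¹ ⊡ (U ⊡ (b u ⊡ b u⁻¹) ⊡ (V ⊡ c s)) := by
          simp only [sprod_assoc]
      _ ≤ a r⁻¹ ⊡ (U ⊡ b 1 ⊡ (V ⊡ c s)) := by gcongr; exact hb.mul_inv_le u
      _ = _ := by rw [hU]; simp only [sprod_assoc]
  · refine le_trans (le_of_eq ?_) (le_iSup _ 1)
    rw [inv_one, hU, sprod_assoc (a r⁻¹), ← sprod_assoc U (b 1), hU, sprod_assoc]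

theorem bordered_sprod_eq_bot (hb : ∀ s t, b s ⊡ b' t = ⊥) (U V : Submodule k S) :
    bordered a U b ⊡ bordered b' V c = ⊥ := by
  rw [bordered, bordered, FMat.entrywise_sprod, eq_bot_iff]
  refine FMat.entrywise_le fun p x hx => ?_
  have h (u : G) : a p.1⁻¹ ⊡ (U ⊡ b u) ⊡ (b' u⁻¹ ⊡ (V ⊡ c p.2)) = ⊥ := by
    rw [sprod_assoc, sprod_assoc, ← sprod_assoc (b u), hb, bot_sprod, sprod_bot, sprod_bot]
  simp only [h, iSup_bot, Submodule.mem_bot] at hx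
  rw [hx, FMat.single_zero, Submodule.mem_bot]

end Bordered

/-! ### Partial smash products as bordered matrices. -/

section MatrixEmbedding

variable {k : Type uk} {G : Type uG} {A : Type uA} {S : Type uX} [CommRing k] [Group G]
    [NonUnitalRing A] [Module k A] [IsScalarTower k A A] [SMulCommClass k A A]
    [NonUnitalRing S] [Module k S] [IsScalarTower k S S] [SMulCommClass k S S]

namespace GroupGrading

/-- The partial smash product mapped into the matrices over another algebra. -/
noncomputable def smashEmbedding (𝒜 : GroupGrading k G A) (f : A →ₗ[k] S) :
    𝒜.partialSmash →ₗ[k] FMat G S :=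
  FMat.map f ∘ₗ 𝒜.partialSmashIncl

variable {𝒜 : GroupGrading k G A} {f : A →ₗ[k] S}

theorem smashEmbedding_mul (hf : ∀ a a', f (a * a') = f a * f a') (x y : 𝒜.partialSmash) :
    𝒜.smashEmbedding f (x * y) = 𝒜.smashEmbedding f x * 𝒜.smashEmbedding f y :=
  FMat.map_mul hf x.1 y.1

theorem smashEmbedding_injective (hf : Function.Injective f) :
    Function.Injective (𝒜.smashEmbedding f) :=
  fun _ _ h => Subtype.ext (FMat.map_injective hf h)

/-- The entries of $I_t$ are $A_{r^{-1}}D_tA_s$. In bordered form, with $D_t$ in the middle, the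
ideals can be multiplied by `bordered_sprod`. -/
theorem map_smashIdeal (hA : 𝒜.IsPartiallyStrong) (hf : ∀ a a', f (a * a') = f a * f a')
    (t : G) : (𝒜.smashIdeal t).map (𝒜.smashEmbedding f) =
      bordered (fun t => (𝒜.comp t).map f) ((𝒜.D t).map f) (fun t => (𝒜.comp t).map f) := by
  have h : (𝒜.smashIdeal t).map 𝒜.partialSmashIncl = 𝒜.smashDomain t := by
    rw [smashIdeal, Submodule.map_comap_eq, inf_eq_right]
    exact fun M hM => ⟨⟨M, smashDomain_le hA t hM⟩, rfl⟩
  rw [smashEmbedding, Submodule.map_comp, h, smashDomain_eq hA, FMat.map_map_entrywise, bordered]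
  simp only [map_sprod f hf]

theorem range_smashEmbedding (hA : 𝒜.IsPartiallyStrong) (hf : ∀ a a', f (a * a') = f a * f a') :
    LinearMap.range (𝒜.smashEmbedding f) =
      bordered (fun t => (𝒜.comp t).map f) ((𝒜.comp 1).map f) (fun t => (𝒜.comp t).map f) := by
  rw [← Submodule.map_top, ← (𝒜.canonicalPartialAction hA).D_one]
  exact (map_smashIdeal hA hf 1).trans (by rw [D_one hA])

end GroupGrading

end MatrixEmbedding

namespace CornerEquivalence

variable {k : Type uk} {G : Type uG} {S : Type uX} [CommRing k] [Group G] [NonUnitalRing S]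
  [Module k S] [IsScalarTower k S S] [SMulCommClass k S S]
  {a b : G → Submodule k S} {P Q : Submodule k S}

/-- Move `a s` to the left of `Q` and `a t` to the right of `P`; what remains in the middle is `QP =
b 1`. With `t = s⁻¹` this says that conjugation by `Q` and `P` carries $D_s^A$ to $D_s^B$. -/
theorem Q_sprod_sprod_P (h : CornerEquivalence a b P Q) (s t : G) :
    Q ⊡ (a s ⊡ a t) ⊡ P = b s ⊡ b t := by
  rw [← sprod_assoc, ← h.comm_Q, sprod_assoc, h.comm_P, sprod_assoc, ← sprod_assoc Q, h.QP,
    h.right.one_mul]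

/-- The cross terms vanish since `P` begins with `a 1` and `Q` with `b 1`. The four surviving terms
are the entries of the four bordered blocks. -/
theorem sup_sprod_sup (h : CornerEquivalence a b P Q) (hab : ∀ s t, a s ⊡ b t = ⊥)
    (hba : ∀ s t, b s ⊡ a t = ⊥) (s t : G) :
    (a s ⊔ b s) ⊡ (a t ⊔ P ⊡ b t ⊔ Q ⊡ a t ⊔ b t) =
      a s ⊡ (a 1 ⊡ a t) ⊔ a s ⊡ (P ⊡ b t) ⊔ b s ⊡ (Q ⊡ a t) ⊔ b s ⊡ (b 1 ⊡ b t) := by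
  have h1 : a s ⊡ (Q ⊡ a t) = ⊥ := by
    rw [← h.one_Q, sprod_assoc, ← sprod_assoc, hab, bot_sprod]
  have h2 : b s ⊡ (P ⊡ b t) = ⊥ := by
    rw [← h.one_P, sprod_assoc, ← sprod_assoc, hba, bot_sprod]
  rw [h.left.one_mul, h.right.one_mul]
  simp only [sup_sprod, sprod_sup, hab, hba, h1, h2, bot_sup_eq, sup_bot_eq, sup_assoc]

end CornerEquivalence

/-! ### From a strong-graded-equivalence to a Morita equivalence of partial actions. -/

section GradedToPartial

variable {k : Type uk} {G : Type uG} {A : Type uA} {B : Type uB} {X : Type uX} {Y : Type uY}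
    [CommRing k] [Group G]
    [NonUnitalRing A] [Module k A] [IsScalarTower k A A] [SMulCommClass k A A]
    [NonUnitalRing B] [Module k B] [IsScalarTower k B B] [SMulCommClass k B B]
    [AddCommGroup X] [Module k X] [AddCommGroup Y] [Module k Y]
    {𝒜 : GroupGrading k G A} {ℬ : GroupGrading k G B}

namespace GradedMoritaContext

variable {M : GradedMoritaContext 𝒜 ℬ X Y}

/-- The matrices over the context algebra whose `(r,s)`-entry lies in `A_{r⁻¹} X₁ B_s`. -/
def smashX (M : GradedMoritaContext 𝒜 ℬ X Y) : Submodule k (FMat G M.Ctx) :=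
  bordered (fun t => (𝒜.comp t).map M.cornerA) ((M.Xc 1).map M.cornerX)
    (fun t => (ℬ.comp t).map M.cornerB)

/-- The matrices over the context algebra whose `(r,s)`-entry lies in `B_{r⁻¹} Y₁ A_s`. -/
def smashY (M : GradedMoritaContext 𝒜 ℬ X Y) : Submodule k (FMat G M.Ctx) :=
  bordered (fun t => (ℬ.comp t).map M.cornerB) ((M.Yc 1).map M.cornerY)
    (fun t => (𝒜.comp t).map M.cornerA)

variable (hM : M.IsStrongEquivalence) (hA : 𝒜.IsPartiallyStrong) (hB : ℬ.IsPartiallyStrong)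
include hM hA hB

theorem smash_sprod :
    (LinearMap.range (𝒜.smashEmbedding M.cornerA) ⊡ M.smashX = M.smashX ∧
      M.smashX ⊡ LinearMap.range (ℬ.smashEmbedding M.cornerB) = M.smashX ∧
      M.smashX ⊡ M.smashY = LinearMap.range (𝒜.smashEmbedding M.cornerA)) ∧
    (LinearMap.range (ℬ.smashEmbedding M.cornerB) ⊡ M.smashY = M.smashY ∧
      M.smashY ⊡ LinearMap.range (𝒜.smashEmbedding M.cornerA) = M.smashY ∧
      M.smashY ⊡ M.smashX = LinearMap.range (ℬ.smashEmbedding M.cornerB)) := by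
  have h := cornerEquivalence hM hA hB
  have hP : (M.Xc 1).map M.cornerX ⊡ (ℬ.comp 1).map M.cornerB = (M.Xc 1).map M.cornerX :=
    Xc_sprod_map_comp hM 1
  have hQ : (M.Yc 1).map M.cornerY ⊡ (𝒜.comp 1).map M.cornerA = (M.Yc 1).map M.cornerY :=
    Yc_sprod_map_comp hM 1
  rw [GroupGrading.range_smashEmbedding hA M.cornerA_mul,
    GroupGrading.range_smashEmbedding hB M.cornerB_mul, smashX, smashY,
    bordered_sprod h.left (h.left.one_mul 1), bordered_sprod h.right hP,
    bordered_sprod h.right hP, bordered_sprod h.right (h.right.one_mul 1),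
    bordered_sprod h.left hQ, bordered_sprod h.left hQ, h.one_P, h.one_Q, hP, hQ, h.PQ, h.QP]
  exact ⟨⟨rfl, rfl, rfl⟩, rfl, rfl, rfl⟩

theorem smashContext : InternalContext (𝒜.smashEmbedding M.cornerA) (ℬ.smashEmbedding M.cornerB)
    M.smashX M.smashY := by
  obtain ⟨⟨h1, h2, h3⟩, h4, h5, h6⟩ := smash_sprod hM hA hB
  exact InternalContext.of_sprod_le (GroupGrading.smashEmbedding_mul M.cornerA_mul)
    (GroupGrading.smashEmbedding_mul M.cornerB_mul)
    (GroupGrading.smashEmbedding_injective M.cornerA_injective)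
    (GroupGrading.smashEmbedding_injective M.cornerB_injective) h1.le h2.le h4.le h5.le h3.le h6.le

theorem smashContext_isEquivalence :
    (smashContext hM hA hB).toMoritaContext.IsEquivalence := by
  obtain ⟨⟨h1, h2, h3⟩, h4, h5, h6⟩ := smash_sprod hM hA hB
  exact (smashContext hM hA hB).isEquivalence h1 h2 h4 h5 h3 h6

/-- After embedding in matrices this is a product of three bordered modules, whose middle factor is
$Y_1D_t^AX_1=D_t^B$. -/
theorem smashContext_ideal (t : G) :
    Submodule.map₂ (smashContext hM hA hB).toMoritaContext.τB
      (Submodule.map₂ (smashContext hM hA hB).toMoritaContext.rY ⊤ (𝒜.smashIdeal t)) ⊤ =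
        ℬ.smashIdeal t := by
  have h := cornerEquivalence hM hA hB
  have hQ : (M.Yc 1).map M.cornerY ⊡ (𝒜.comp 1).map M.cornerA = (M.Yc 1).map M.cornerY :=
    Yc_sprod_map_comp hM 1
  refine Submodule.map_injective_of_injective (smashContext hM hA hB).ψ_inj ?_
  refine ((smashContext hM hA hB).symm.map_map₂_pairing _ _).trans ?_
  have h1 := (smashContext hM hA hB).symm.map_right ⊤ (𝒜.smashIdeal t)
  refine (congrArg (fun U => U ⊡ _) h1).trans ?_
  rw [Submodule.map_subtype_top, Submodule.map_subtype_top,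
    GroupGrading.map_smashIdeal hA M.cornerA_mul, GroupGrading.map_smashIdeal hB M.cornerB_mul,
    smashX, smashY, bordered_sprod h.left hQ, bordered_sprod h.left, GroupGrading.D,
    GroupGrading.D, map_sprod _ M.cornerA_mul, map_sprod _ M.cornerB_mul]
  · congr 1
    exact h.Q_sprod_sprod_P t t⁻¹
  · rw [GroupGrading.D, map_sprod _ M.cornerA_mul, sprod_assoc, sprod_assoc]
    exact congrArg (fun U => _ ⊡ (_ ⊡ U)) (h.left.mul_one t⁻¹)

/-- Entry by entry, $C_{r^{-1}}C_s=(A_{r^{-1}}\oplus B_{r^{-1}})C_s$, and the blocks of $C_s$ are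
$A_s$, $X_1B_s$, $Y_1A_s$, $B_s$. Multiplying out gives exactly the entries of the two partial smash
products and of the two bimodules. -/
theorem range_ctxMap_smash : LinearMap.range (smashContext hM hA hB).ctxMap =
    M.ctxGrading.partialSmashSubmodule := by
  have h := cornerEquivalence hM hA hB
  rw [InternalContext.range_ctxMap, GroupGrading.range_smashEmbedding hA M.cornerA_mul,
    GroupGrading.range_smashEmbedding hB M.cornerB_mul, smashX, smashY, bordered, bordered,
    bordered, bordered, ← FMat.entrywise_sup, ← FMat.entrywise_sup, ← FMat.entrywise_sup,
    GroupGrading.partialSmashSubmodule]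
  congr 1
  funext r s
  rw [ctxGrading_comp_sprod hM hA hB, ctxGrading_comp, ← Xc_sprod_map_comp hM s,
    ← Yc_sprod_map_comp hM s]
  refine (h.sup_sprod_sup (fun s t => M.map_cornerA_sprod_cornerB _ _)
    (fun s t => M.map_cornerB_sprod_cornerA _ _) r⁻¹ s).symm

theorem ctxMap_smash_mul (c d : (smashContext hM hA hB).toMoritaContext.Ctx) :
    (smashContext hM hA hB).ctxMap (c * d) =
      (smashContext hM hA hB).ctxMap c * (smashContext hM hA hB).ctxMap d := by
  have h1 (s t : G) : (𝒜.comp s).map M.cornerA ⊡ (ℬ.comp t).map M.cornerB = ⊥ :=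
    M.map_cornerA_sprod_cornerB _ _
  have h2 (s t : G) : (ℬ.comp s).map M.cornerB ⊡ (𝒜.comp t).map M.cornerA = ⊥ :=
    M.map_cornerB_sprod_cornerA _ _
  have rA := GroupGrading.range_smashEmbedding hA M.cornerA_mul
  have rB := GroupGrading.range_smashEmbedding hB M.cornerB_mul
  refine InternalContext.ctxMap_mul _ ?_ ?_ ?_ ?_ ?_ ?_ ?_ ?_ c d
  · rw [rA, smashY]; exact bordered_sprod_eq_bot h1 _ _
  · rw [rA, rB]; exact bordered_sprod_eq_bot h1 _ _
  · rw [rA, smashX]; exact bordered_sprod_eq_bot h2 _ _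
  · rw [smashX]; exact bordered_sprod_eq_bot h2 _ _
  · rw [rB, smashX]; exact bordered_sprod_eq_bot h2 _ _
  · rw [rB, rA]; exact bordered_sprod_eq_bot h2 _ _
  · rw [rB, smashY]; exact bordered_sprod_eq_bot h1 _ _
  · rw [smashY]; exact bordered_sprod_eq_bot h1 _ _

/-- Every entry of a matrix in `smashX` lies in the corner $X$, and every entry of one in `smashY`
in the corner $Y$. The four summands of an entry therefore occupy different blocks and vanish
separately. -/
theorem ctxMap_smash_injective : Function.Injective (smashContext hM hA hB).ctxMap := by
  have hX (p : G × G) (x : M.smashX) : ∃ z, (x : FMat G M.Ctx) p = M.cornerX z := by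
    have hx : (x : FMat G M.Ctx) p ∈ (𝒜.comp p.1⁻¹).map M.cornerA ⊡
      ((M.Xc 1).map M.cornerX ⊡ (ℬ.comp p.2).map M.cornerB) := x.2 p.1 p.2
    rw [Xc_sprod_map_comp hM, ← map_map₂_eq_sprod M.lX M.cornerX _ _ M.cornerX_lX] at hx
    obtain ⟨z, -, hz⟩ := hx
    exact ⟨z, hz.symm⟩
  have hY (p : G × G) (y : M.smashY) : ∃ z, (y : FMat G M.Ctx) p = M.cornerY z := by
    have hy : (y : FMat G M.Ctx) p ∈ (ℬ.comp p.1⁻¹).map M.cornerB ⊡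
      ((M.Yc 1).map M.cornerY ⊡ (𝒜.comp p.2).map M.cornerA) := y.2 p.1 p.2
    rw [Yc_sprod_map_comp hM, ← map_map₂_eq_sprod M.lY M.cornerY _ _ M.cornerY_lY] at hy
    obtain ⟨z, -, hz⟩ := hy
    exact ⟨z, hz.symm⟩
  rw [injective_iff_map_eq_zero]
  intro c hc
  have key (p : G × G) : M.cornerA (c.a.1 p) + (c.x : FMat G M.Ctx) p +
      (c.y : FMat G M.Ctx) p + M.cornerB (c.b.1 p) = 0 := DFunLike.congr_fun hc p
  have key2 (p : G × G) : c.a.1 p = 0 ∧ (c.x : FMat G M.Ctx) p = 0 ∧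
      (c.y : FMat G M.Ctx) p = 0 ∧ c.b.1 p = 0 := by
    have h := key p
    obtain ⟨x, hx⟩ := hX p c.x
    obtain ⟨y, hy⟩ := hY p c.y
    rw [hx, hy] at h ⊢
    have e1 : c.a.1 p = 0 := by simpa using congrArg MoritaContext.Ctx.a h
    have e2 : x = 0 := by simpa using congrArg MoritaContext.Ctx.x h
    have e3 : y = 0 := by simpa using congrArg MoritaContext.Ctx.y h
    have e4 : c.b.1 p = 0 := by simpa using congrArg MoritaContext.Ctx.b h
    rw [e2, e3, map_zero, map_zero]
    exact ⟨e1, rfl, rfl, e4⟩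
  apply MoritaContext.Ctx.ext
  · exact Subtype.ext (DFunLike.ext _ _ fun p => (key2 p).1)
  · exact Subtype.ext (DFunLike.ext _ _ fun p => (key2 p).2.1)
  · exact Subtype.ext (DFunLike.ext _ _ fun p => (key2 p).2.2.1)
  · exact Subtype.ext (DFunLike.ext _ _ fun p => (key2 p).2.2.2)

/-- The context algebra of the context of partial smash products is the partial smash product of
the context algebra. -/
noncomputable def ctxSmashEquiv : (smashContext hM hA hB).toMoritaContext.Ctx ≃ₗ[k]
    M.ctxGrading.partialSmash :=
  LinearEquiv.ofBijective
    ((smashContext hM hA hB).ctxMap.codRestrict M.ctxGrading.partialSmash.toSubmodule fun c =>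
      (range_ctxMap_smash hM hA hB).le ⟨c, rfl⟩)
    ⟨fun _ _ h => ctxMap_smash_injective hM hA hB (congrArg Subtype.val h), fun x => by
      obtain ⟨c, hc⟩ := (range_ctxMap_smash hM hA hB).ge x.2
      exact ⟨c, Subtype.ext hc⟩⟩

theorem ctxSmashEquiv_coe (c : (smashContext hM hA hB).toMoritaContext.Ctx) :
    (ctxSmashEquiv hM hA hB c : FMat G M.Ctx) = (smashContext hM hA hB).ctxMap c := rfl

/-- The partial action on the context algebra of the partial smash products. -/
noncomputable def ctxPartialAction :
    ProductPartialAction k G (smashContext hM hA hB).toMoritaContext.Ctx :=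
  (M.ctxGrading.canonicalPartialAction (ctxGrading_isPartiallyStrong hM hA hB)).transport
    (ctxSmashEquiv hM hA hB) fun c d => Subtype.ext (ctxMap_smash_mul hM hA hB c d)

/-- The corner $I^A$ becomes the image of entrywise application of `cornerA`. The domains then agree
entry by entry, and the actions agree because entrywise maps commute with shifts. -/
theorem ctxPartialAction_restrictsTo_left :
    (ctxPartialAction hM hA hB).RestrictsTo (smashContext hM hA hB).toMoritaContext.cornerA
      (𝒜.canonicalPartialAction hA) := by
  have h0 (x : 𝒜.partialSmash) : (ctxSmashEquiv hM hA hB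
      ((smashContext hM hA hB).toMoritaContext.cornerA x) : FMat G M.Ctx) =
        FMat.map M.cornerA x.1 := by
    rw [ctxSmashEquiv_coe, InternalContext.ctxMap_apply]
    simp only [MoritaContext.cornerA_a, MoritaContext.cornerA_x, MoritaContext.cornerA_y,
      MoritaContext.cornerA_b, map_zero, ZeroMemClass.coe_zero, add_zero]
    rfl
  constructor
  · intro t
    ext x
    change x.1 ∈ 𝒜.smashDomain t ↔ (ctxSmashEquiv hM hA hB
      ((smashContext hM hA hB).toMoritaContext.cornerA x) : FMat G M.Ctx) ∈
        M.ctxGrading.smashDomain t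
    rw [h0, GroupGrading.smashDomain_eq hA,
      GroupGrading.smashDomain_eq (ctxGrading_isPartiallyStrong hM hA hB)]
    exact forall_congr' fun r => forall_congr' fun s =>
      (cornerA_mem_smashDomain_entry hM hA hB r⁻¹ t s _).symm
  · intro t a h
    apply (ctxSmashEquiv hM hA hB).injective
    refine ((ctxSmashEquiv hM hA hB).apply_symm_apply _).trans (Subtype.ext ?_)
    rw [h0]
    change FMat.shift k t (ctxSmashEquiv hM hA hB
      ((smashContext hM hA hB).toMoritaContext.cornerA a.1) : FMat G M.Ctx) = _
    rw [h0]
    exact (FMat.map_shift _ t _).symm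

theorem ctxPartialAction_restrictsTo_right :
    (ctxPartialAction hM hA hB).RestrictsTo (smashContext hM hA hB).toMoritaContext.cornerB
      (ℬ.canonicalPartialAction hB) := by
  have h0 (x : ℬ.partialSmash) : (ctxSmashEquiv hM hA hB
      ((smashContext hM hA hB).toMoritaContext.cornerB x) : FMat G M.Ctx) =
        FMat.map M.cornerB x.1 := by
    rw [ctxSmashEquiv_coe, InternalContext.ctxMap_apply]
    simp only [MoritaContext.cornerB_a, MoritaContext.cornerB_x, MoritaContext.cornerB_y,
      MoritaContext.cornerB_b, map_zero, ZeroMemClass.coe_zero, zero_add]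
    rfl
  constructor
  · intro t
    ext x
    change x.1 ∈ ℬ.smashDomain t ↔ (ctxSmashEquiv hM hA hB
      ((smashContext hM hA hB).toMoritaContext.cornerB x) : FMat G M.Ctx) ∈
        M.ctxGrading.smashDomain t
    rw [h0, GroupGrading.smashDomain_eq hB,
      GroupGrading.smashDomain_eq (ctxGrading_isPartiallyStrong hM hA hB)]
    exact forall_congr' fun r => forall_congr' fun s =>
      (cornerB_mem_smashDomain_entry hM hA hB r⁻¹ t s _).symm
  · intro t a h
    apply (ctxSmashEquiv hM hA hB).injective
    refine ((ctxSmashEquiv hM hA hB).apply_symm_apply _).trans (Subtype.ext ?_)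
    rw [h0]
    change FMat.shift k t (ctxSmashEquiv hM hA hB
      ((smashContext hM hA hB).toMoritaContext.cornerB a.1) : FMat G M.Ctx) = _
    rw [h0]
    exact (FMat.map_shift _ t _).symm

end GradedMoritaContext

end GradedToPartial

theorem StronglyGradedEquivalent.moritaEquivalent {k : Type uk} {G : Type uG} {A : Type uA}
    {B : Type uB} [CommRing k] [Group G]
    [NonUnitalRing A] [Module k A] [IsScalarTower k A A] [SMulCommClass k A A]
    [NonUnitalRing B] [Module k B] [IsScalarTower k B B] [SMulCommClass k B B]
    {𝒜 : GroupGrading k G A} {ℬ : GroupGrading k G B} (h : StronglyGradedEquivalent 𝒜 ℬ)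
    (hA : 𝒜.IsPartiallyStrong) (hB : ℬ.IsPartiallyStrong) :
    (𝒜.canonicalPartialAction hA).MoritaEquivalent (ℬ.canonicalPartialAction hB) := by
  obtain ⟨X, Y, _, _, _, _, M, hM⟩ := h
  exact ⟨M.smashX, M.smashY, inferInstance, inferInstance, inferInstance, inferInstance,
    (GradedMoritaContext.smashContext hM hA hB).toMoritaContext,
    GradedMoritaContext.ctxPartialAction hM hA hB,
    GradedMoritaContext.smashContext_isEquivalence hM hA hB,
    GradedMoritaContext.smashContext_ideal hM hA hB,
    GradedMoritaContext.ctxPartialAction_restrictsTo_left hM hA hB,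
    GradedMoritaContext.ctxPartialAction_restrictsTo_right hM hA hB⟩

/-! ### The partial skew group ring of a product partial action. -/

section SkewRings

variable {k : Type uk} {G : Type uG} {C : Type uX} [CommRing k] [Group G]
    [NonUnitalRing C] [Module k C] [IsScalarTower k C C] [SMulCommClass k C C]

/-- Closure of `p` under scalars is not needed: a scalar can be moved into the left factor, so the
elements all of whose multiples satisfy `p` form a submodule containing the products. -/
theorem sprod_induction {U V : Submodule k C} {p : C → Prop}
    (mul : ∀ u ∈ U, ∀ v ∈ V, p (u * v)) (add : ∀ x y, p x → p y → p (x + y)) {x : C}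
    (hx : x ∈ U ⊡ V) : p x := by
  let W : Submodule k C :=
    { carrier := {x | ∀ c : k, p (c • x)}
      zero_mem' := fun c => by
        have := mul 0 U.zero_mem 0 V.zero_mem
        rwa [mul_zero, ← smul_zero c] at this
      add_mem' := fun {x y} hx hy c => by
        rw [smul_add]
        exact add _ _ (hx c) (hy c)
      smul_mem' := fun c x hx c' => by
        rw [smul_smul]
        exact hx _ }
  have h : U ⊡ V ≤ W := sprod_le.2 fun u hu v hv c => by
    rw [← smul_mul_assoc]
    exact mul _ (U.smul_mem c hu) v hv
  simpa using h hx 1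

namespace ProductPartialAction

variable (θ : ProductPartialAction k G C)

theorem sprod_le_left (s t : G) : θ.D s ⊡ θ.D t ≤ θ.D s :=
  sprod_le.2 fun a ha b _ => θ.mul_mem_right s a b ha

theorem sprod_le_right (s t : G) : θ.D s ⊡ θ.D t ≤ θ.D t :=
  sprod_le.2 fun a _ b hb => θ.mul_mem_left t a b hb

theorem mul_mem_sprod_D (s t : G) {x : C} (hx : x ∈ θ.D s ⊡ θ.D t) (c : C) :
    x * c ∈ θ.D s ⊡ θ.D t := by
  have h : θ.D s ⊡ θ.D t ⊡ ⊤ ≤ θ.D s ⊡ θ.D t := by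
    rw [sprod_assoc]
    exact sprod_mono le_rfl (sprod_le.2 fun a ha b _ => θ.mul_mem_right t a b ha)
  exact h (mul_mem_sprod hx trivial)

open Classical in
/-- The partial isomorphism `αₜ`, extended by `0` outside its domain. -/
noncomputable def act (t : G) (x : C) : C := if h : x ∈ θ.D t⁻¹ then θ.α t ⟨x, h⟩ else 0

variable {θ} {s t : G} {x y : C}

theorem act_of_mem (h : x ∈ θ.D t⁻¹) : θ.act t x = θ.α t ⟨x, h⟩ := dif_pos h

theorem act_mem (h : x ∈ θ.D t⁻¹) : θ.act t x ∈ θ.D t := by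
  rw [act_of_mem h]; exact Subtype.prop _

theorem act_inv_mem (h : x ∈ θ.D t) : θ.act t⁻¹ x ∈ θ.D t⁻¹ :=
  act_mem (by rwa [inv_inv])

theorem act_add (hx : x ∈ θ.D t⁻¹) (hy : y ∈ θ.D t⁻¹) :
    θ.act t (x + y) = θ.act t x + θ.act t y := by
  rw [act_of_mem hx, act_of_mem hy, act_of_mem (add_mem hx hy), ← Submodule.coe_add, ← map_add]
  rfl

theorem act_smul (c : k) (hx : x ∈ θ.D t⁻¹) : θ.act t (c • x) = c • θ.act t x := by
  rw [act_of_mem hx, act_of_mem (Submodule.smul_mem _ c hx), ← Submodule.coe_smul, ← map_smul]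
  rfl

theorem act_mul (hx : x ∈ θ.D t⁻¹) (hy : y ∈ θ.D t⁻¹) :
    θ.act t (x * y) = θ.act t x * θ.act t y := by
  rw [act_of_mem hx, act_of_mem hy, act_of_mem (θ.mul_mem_left _ x y hy),
    ← θ.map_mul t ⟨x, hx⟩ ⟨y, hy⟩]

theorem mem_D_one (x : C) : x ∈ θ.D 1 := by
  rw [θ.D_one]; trivial

theorem act_one (x : C) : θ.act 1 x = x := by
  rw [act_of_mem (by rw [inv_one]; exact mem_D_one x), θ.α_one]

theorem act_mem_sprod (h : x ∈ θ.D s⁻¹ ⊡ θ.D t) : θ.act s x ∈ θ.D s ⊡ θ.D (s * t) := by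
  rw [← θ.image_eq, act_of_mem (θ.sprod_le_left _ _ h)]
  exact ⟨⟨x, θ.sprod_le_left _ _ h⟩, h, rfl⟩

theorem act_act (h : x ∈ θ.D t⁻¹ ⊡ θ.D (s * t)⁻¹) :
    θ.act s (θ.act t x) = θ.act (s * t) x := by
  have h1 := θ.sprod_le_left _ _ h
  have h2 := θ.sprod_le_right _ _ h
  -- The image axiom puts $\theta_t(x)$ in $D_tD_{t(st)^{-1}}$, and $t(st)^{-1}=s^{-1}$.
  have h3 : θ.act t x ∈ θ.D s⁻¹ := by
    have := θ.sprod_le_right _ _ (act_mem_sprod h)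
    rwa [mul_inv_rev, mul_inv_cancel_left] at this
  rw [act_of_mem h3, act_of_mem h2]
  have h4 := act_of_mem h1
  rw [← θ.comp_eq s t x h h1 h2 (h4 ▸ h3)]
  congr 2
  exact Subtype.ext h4

theorem act_inv_act (h : x ∈ θ.D t⁻¹) : θ.act t⁻¹ (θ.act t x) = x := by
  -- The composition rule asks for membership in a product of ideals; idempotence of $D_{t^{-1}}$
  -- provides it, as the second ideal is the whole algebra.
  have h1 : x ∈ θ.D t⁻¹ ⊡ θ.D (t⁻¹ * t)⁻¹ := by
    rw [inv_mul_cancel, inv_one, θ.D_one]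
    rw [← θ.D_idem] at h
    exact sprod_mono le_rfl le_top h
  rw [act_act h1, inv_mul_cancel, act_one]

theorem act_act_inv (h : x ∈ θ.D t) : θ.act t (θ.act t⁻¹ x) = x := by
  have := act_inv_act (θ := θ) (t := t⁻¹) (x := x) (by rwa [inv_inv])
  rwa [inv_inv] at this

theorem act_inv_mul_mem (hx : x ∈ θ.D s) (hy : y ∈ θ.D t) :
    θ.act s⁻¹ x * y ∈ θ.D s⁻¹ ⊡ θ.D t :=
  mul_mem_sprod (act_inv_mem hx) hy

theorem twisted_mem (hx : x ∈ θ.D s) (hy : y ∈ θ.D t) :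
    θ.act s (θ.act s⁻¹ x * y) ∈ θ.D s ⊡ θ.D (s * t) :=
  act_mem_sprod (act_inv_mul_mem hx hy)

theorem twisted_add_left (hx : x ∈ θ.D s) (hy : y ∈ θ.D s) (c : C) :
    θ.act s (θ.act s⁻¹ (x + y) * c) =
      θ.act s (θ.act s⁻¹ x * c) + θ.act s (θ.act s⁻¹ y * c) := by
  rw [act_add (by rwa [inv_inv]) (by rwa [inv_inv]), add_mul,
    act_add (θ.mul_mem_right _ _ c (act_inv_mem hx)) (θ.mul_mem_right _ _ c (act_inv_mem hy))]

theorem twisted_smul_left (r : k) (hx : x ∈ θ.D s) (c : C) :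
    θ.act s (θ.act s⁻¹ (r • x) * c) = r • θ.act s (θ.act s⁻¹ x * c) := by
  rw [act_smul r (by rwa [inv_inv]), smul_mul_assoc,
    act_smul r (θ.mul_mem_right _ _ c (act_inv_mem hx))]

theorem twisted_add_right (hx : x ∈ θ.D s) (c d : C) :
    θ.act s (θ.act s⁻¹ x * (c + d)) =
      θ.act s (θ.act s⁻¹ x * c) + θ.act s (θ.act s⁻¹ x * d) := by
  rw [mul_add,
    act_add (θ.mul_mem_right _ _ c (act_inv_mem hx)) (θ.mul_mem_right _ _ d (act_inv_mem hx))]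

theorem twisted_smul_right (r : k) (hx : x ∈ θ.D s) (c : C) :
    θ.act s (θ.act s⁻¹ x * r • c) = r • θ.act s (θ.act s⁻¹ x * c) := by
  rw [mul_smul_comm, act_smul r (θ.mul_mem_right _ _ c (act_inv_mem hx))]

/-- Left multiplications commute with right multiplications conjugated by `αₛ`. -/
theorem act_inv_mul (a c : C) {b : C} (hb : b ∈ θ.D s) :
    θ.act s (θ.act s⁻¹ (a * b) * c) = a * θ.act s (θ.act s⁻¹ b * c) := by
  have hb' := hb
  -- Idempotence makes $b$ a sum of products $uv$ with both factors in $D_s$. Then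
  -- $\theta_{s^{-1}}(auv)=\theta_{s^{-1}}(au)\theta_{s^{-1}}(v)$, so that $a$ meets only $u$ and
  -- $c$ only $v$. In a domain that is not idempotent this separation could not be made.
  rw [← θ.D_idem] at hb'
  refine (sprod_induction (p := fun b => b ∈ θ.D s ∧
    θ.act s (θ.act s⁻¹ (a * b) * c) = a * θ.act s (θ.act s⁻¹ b * c)) ?_ ?_ hb').2
  · intro u hu v hv
    refine ⟨θ.mul_mem_left s u v hv, ?_⟩
    have hu' : u ∈ θ.D s⁻¹⁻¹ := by rwa [inv_inv]
    have hv' : v ∈ θ.D s⁻¹⁻¹ := by rwa [inv_inv]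
    have hau := θ.mul_mem_left s a u hu
    have hau' := θ.mul_mem_left s⁻¹⁻¹ a u hu'
    have hvc := θ.mul_mem_right s⁻¹ _ c (act_inv_mem hv)
    rw [← mul_assoc a, act_mul hau' hv', act_mul hu' hv', mul_assoc, mul_assoc,
      act_mul (act_inv_mem hau) hvc, act_mul (act_inv_mem hu) hvc, act_act_inv hau,
      act_act_inv hu, mul_assoc]
  · rintro x y ⟨hx, hx'⟩ ⟨hy, hy'⟩
    refine ⟨add_mem hx hy, ?_⟩
    rw [mul_add, twisted_add_left (θ.mul_mem_left s a x hx) (θ.mul_mem_left s a y hy),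
      twisted_add_left hx hy, hx', hy', mul_add]

/-- This is associativity of the skew product on homogeneous elements. With
$w=\theta_{r^{-1}}(a)b\in D_{r^{-1}}D_s$, both sides equal $\theta_{rs}(\theta_{s^{-1}}(w)c)$: the
left one because $\theta_{(rs)^{-1}}\theta_r(w)=\theta_{s^{-1}}(w)$, the right one after pulling
$\theta_{r^{-1}}(a)$ inside $\theta_s$ by `act_inv_mul`. -/
theorem twisted_assoc {r : G} {a b : C} (ha : a ∈ θ.D r) (hb : b ∈ θ.D s) (c : C) :
    θ.act (r * s) (θ.act (r * s)⁻¹ (θ.act r (θ.act r⁻¹ a * b)) * c) =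
      θ.act r (θ.act r⁻¹ a * θ.act s (θ.act s⁻¹ b * c)) := by
  have h0 : θ.act r⁻¹ a * b ∈ θ.D r⁻¹ ⊡ θ.D s := act_inv_mul_mem ha hb
  have h1 : θ.act (r * s)⁻¹ (θ.act r (θ.act r⁻¹ a * b)) = θ.act s⁻¹ (θ.act r⁻¹ a * b) := by
    have h2 : (r * s)⁻¹ * r = s⁻¹ := by group
    rw [act_act (by rw [h2, inv_inv]; exact h0), h2]
  have h3 : θ.act s⁻¹ (θ.act r⁻¹ a * b) ∈ θ.D s⁻¹ ⊡ θ.D (r * s)⁻¹ := by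
    have h4 := act_mem_sprod (θ := θ) (s := s⁻¹) (t := r⁻¹) (x := θ.act r⁻¹ a * b)
      (by rw [inv_inv, θ.D_comm]; exact h0)
    rwa [← mul_inv_rev] at h4
  rw [h1, ← act_inv_mul _ _ hb, act_act (θ.mul_mem_sprod_D _ _ h3 c)]

variable (θ)

/-- The partial skew group ring of a product partial action. -/
def Skew : Type (max uG uX) := DirectSum G fun t => θ.D t

namespace Skew

noncomputable instance : AddCommGroup θ.Skew :=
  inferInstanceAs (AddCommGroup (DirectSum G fun t => θ.D t))

noncomputable instance : Module k θ.Skew :=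
  inferInstanceAs (Module k (DirectSum G fun t => θ.D t))

open Classical in
/-- The inclusion `a ↦ a δₜ` of the component of degree `t`. -/
noncomputable def of (t : G) : θ.D t →ₗ[k] θ.Skew := DirectSum.lof k G (fun t => θ.D t) t

/-- The coefficient of degree `t`. -/
noncomputable def coeff (t : G) : θ.Skew →ₗ[k] θ.D t := DirectSum.component k G (fun t => θ.D t) t

variable {θ}

theorem coeff_of_same (t : G) (a : θ.D t) : coeff θ t (of θ t a) = a := by
  classical
  exact DirectSum.component.lof_self (M := fun t => θ.D t) k t a

theorem coeff_of_ne {s t : G} (h : s ≠ t) (a : θ.D s) : coeff θ t (of θ s a) = 0 := by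
  classical
  refine (DirectSum.component.of (M := fun t => θ.D t) k t s a).trans ?_
  rw [dif_neg h]

theorem induction_on {p : θ.Skew → Prop} (x : θ.Skew) (zero : p 0)
    (of : ∀ t a, p (of θ t a)) (add : ∀ x y, p x → p y → p (x + y)) : p x := by
  classical
  exact DirectSum.induction_on x zero of add

theorem of_congr {s t : G} (h : s = t) {a : θ.D s} {b : θ.D t} (hab : (a : C) = b) :
    of θ s a = of θ t b := by
  subst h
  rw [Subtype.ext hab]

open Classical in
/-- A linear map from the partial skew group ring, given on the components. -/
noncomputable def lift {N : Type*} [AddCommGroup N] [Module k N] (f : ∀ t, θ.D t →ₗ[k] N) :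
    θ.Skew →ₗ[k] N := DirectSum.toModule k G N f

theorem lift_of {N : Type*} [AddCommGroup N] [Module k N] (f : ∀ t, θ.D t →ₗ[k] N) (t : G)
    (a : θ.D t) : lift f (of θ t a) = f t a := by
  classical
  exact DirectSum.toModule_lof (M := fun t => θ.D t) k t a

variable (θ)

/-- The product of two components. -/
noncomputable def mulComponent (s t : G) : θ.D s →ₗ[k] θ.D t →ₗ[k] θ.D (s * t) :=
  LinearMap.mk₂ k
    (fun a b => ⟨θ.act s (θ.act s⁻¹ a * b), θ.sprod_le_right _ _ (twisted_mem a.2 b.2)⟩)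
    (fun a a' _ => Subtype.ext (twisted_add_left a.2 a'.2 _))
    (fun c a _ => Subtype.ext (twisted_smul_left c a.2 _))
    (fun a _ _ => Subtype.ext (twisted_add_right a.2 _ _))
    (fun c a _ => Subtype.ext (twisted_smul_right c a.2 _))

/-- The multiplication of the partial skew group ring. -/
noncomputable def mulHom : θ.Skew →ₗ[k] θ.Skew →ₗ[k] θ.Skew :=
  lift fun s => LinearMap.flip (lift fun t =>
    LinearMap.flip ((mulComponent θ s t).compr₂ (of θ (s * t))))

noncomputable instance : Mul θ.Skew where
  mul x y := mulHom θ x y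

variable {θ}

theorem mul_def (x y : θ.Skew) : x * y = mulHom θ x y := rfl

theorem of_mul_of {s t r : G} (h : s * t = r) {a : θ.D s} {b : θ.D t} {c : θ.D r}
    (hc : θ.act s (θ.act s⁻¹ a * b) = c) : of θ s a * of θ t b = of θ r c := by
  have h1 : of θ s a * of θ t b = of θ (s * t) (mulComponent θ s t a b) := by
    rw [mul_def, mulHom, lift_of, LinearMap.flip_apply, lift_of]
    rfl
  rw [h1]
  exact of_congr h hc

protected theorem mul_assoc (x y z : θ.Skew) : x * y * z = x * (y * z) := by
  simp only [mul_def]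
  induction x using induction_on with
  | zero => simp only [map_zero, LinearMap.zero_apply]
  | add x x' h h' => simp only [map_add, LinearMap.add_apply, h, h']
  | of r a =>
  induction y using induction_on with
  | zero => simp only [map_zero, LinearMap.zero_apply]
  | add x x' h h' => simp only [map_add, LinearMap.add_apply, h, h']
  | of s b =>
  induction z using induction_on with
  | zero => simp only [map_zero]
  | add x x' h h' => simp only [map_add, h, h']
  | of t c =>
  simp only [← mul_def]
  have hab : θ.act r (θ.act r⁻¹ a * b) ∈ θ.D (r * s) :=
    θ.sprod_le_right _ _ (twisted_mem a.2 b.2)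
  have hbc : θ.act s (θ.act s⁻¹ b * c) ∈ θ.D (s * t) :=
    θ.sprod_le_right _ _ (twisted_mem b.2 c.2)
  have habc : θ.act r (θ.act r⁻¹ a * θ.act s (θ.act s⁻¹ b * c)) ∈ θ.D (r * (s * t)) :=
    θ.sprod_le_right _ _ (twisted_mem a.2 hbc)
  rw [of_mul_of (r := r * s) rfl (c := ⟨_, hab⟩) rfl,
    of_mul_of (r := s * t) rfl (c := ⟨_, hbc⟩) rfl,
    of_mul_of (r := r * (s * t)) rfl (c := ⟨_, habc⟩) rfl]
  exact of_mul_of (mul_assoc r s t) (twisted_assoc a.2 b.2 c)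

noncomputable instance : NonUnitalRing θ.Skew :=
  { (inferInstance : AddCommGroup θ.Skew), (inferInstance : Mul θ.Skew) with
    left_distrib := fun x y z => map_add (mulHom θ x) y z
    right_distrib := fun x y z => by
      simp only [mul_def, map_add, LinearMap.add_apply]
    zero_mul := fun x => by simp only [mul_def, map_zero, LinearMap.zero_apply]
    mul_zero := fun x => map_zero (mulHom θ x)
    mul_assoc := Skew.mul_assoc }

instance : IsScalarTower k θ.Skew θ.Skew where
  smul_assoc c x y := by
    simp only [smul_eq_mul, mul_def, map_smul, LinearMap.smul_apply]

instance : SMulCommClass k θ.Skew θ.Skew where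
  smul_comm c x y := (map_smul (mulHom θ x) c y).symm

theorem iSupIndep_of_le_range {U : G → Submodule k θ.Skew}
    (hU : ∀ t, U t ≤ LinearMap.range (of θ t)) : iSupIndep U := by
  intro t
  rw [Submodule.disjoint_def]
  intro x hx hx'
  have h1 : (⨆ s, ⨆ _ : s ≠ t, U s) ≤ LinearMap.ker (coeff θ t) := by
    refine iSup₂_le fun s hs => (hU s).trans ?_
    rintro _ ⟨a, rfl⟩
    exact coeff_of_ne hs a
  obtain ⟨a, rfl⟩ := hU t hx
  have h2 : coeff θ t (of θ t a) = 0 := h1 hx'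
  rw [coeff_of_same] at h2
  rw [h2, map_zero]

end Skew

end ProductPartialAction

end SkewRings

/-! ### Products of single-entry matrices with shifted ones. -/

section SingleEntries

variable {k : Type uk} {G : Type uG} {A : Type uA} [CommRing k] [Group G] [NonUnitalRing A]
  [Module k A]

theorem FMat.single_mul_shift_single {p q : G × G} {s v : G} (hp : p.2 = s * q.1)
    (hv : s * q.2 = v) (a b : A) :
    single p a * shift k s (single q b) = single (p.1, v) (a * b) := by
  rw [shift_single, single_mul_single, if_pos hp, ← hv]

theorem FMat.single_mul_shift_single_of_ne {p q : G × G} {s : G} (hp : p.2 ≠ s * q.1)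
    (a b : A) : single p a * shift k s (single q b) = 0 := by
  rw [shift_single, single_mul_single, if_neg hp]

end SingleEntries

/-! ### The graded algebra as a full corner of the skew group ring. -/

section SmashCorners

variable {k : Type uk} {G : Type uG} {A : Type uA} {C : Type uX} [CommRing k] [Group G]
    [NonUnitalRing A] [Module k A] [IsScalarTower k A A] [SMulCommClass k A A]
    [NonUnitalRing C] [Module k C] [IsScalarTower k C C] [SMulCommClass k C C]

open ProductPartialAction

/-- The canonical partial action of `𝒜` embedded by `ι` as a corner of the product partial
action `θ`. -/
structure IsSmashCorner {𝒜 : GroupGrading k G A} (hA : 𝒜.IsPartiallyStrong)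
    (θ : ProductPartialAction k G C) (ι : 𝒜.partialSmash →ₗ[k] C) : Prop where
  map_mul : ∀ x y, ι (x * y) = ι x * ι y
  injective : Function.Injective ι
  restricts : θ.RestrictsTo ι (𝒜.canonicalPartialAction hA)

namespace IsSmashCorner

variable {𝒜 : GroupGrading k G A} {hA : 𝒜.IsPartiallyStrong} {θ : ProductPartialAction k G C}
  {ι : 𝒜.partialSmash →ₗ[k] C}

theorem mem_D_iff (h : IsSmashCorner hA θ ι) {t : G} {x : 𝒜.partialSmash} :
    ι x ∈ θ.D t ↔ x.1 ∈ 𝒜.smashDomain t := by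
  have h1 := h.restricts.1 t
  exact (SetLike.ext_iff.1 h1 x).symm

theorem act_eq (h : IsSmashCorner hA θ ι) {t : G} {x y : 𝒜.partialSmash}
    (hx : x.1 ∈ 𝒜.smashDomain t⁻¹) (hy : y.1 = FMat.shift k t x.1) : θ.act t (ι x) = ι y := by
  have h1 := h.mem_D_iff.2 hx
  rw [act_of_mem h1]
  refine (h.restricts.2 t ⟨x, hx⟩ h1).trans (congrArg ι (Subtype.ext hy.symm))

/-- The elements of the skew group ring of degree `t` in the corner. -/
noncomputable def emb (h : IsSmashCorner hA θ ι) (t : G) : 𝒜.smashDomain t →ₗ[k] θ.Skew :=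
  Skew.of θ t ∘ₗ LinearMap.codRestrict (θ.D t)
    (ι ∘ₗ LinearMap.codRestrict 𝒜.partialSmash.toSubmodule (𝒜.smashDomain t).subtype
      fun M => GroupGrading.smashDomain_le hA t M.2) fun M => h.mem_D_iff.2 M.2

theorem emb_apply (h : IsSmashCorner hA θ ι) {t : G} {M : FMat G A} (hM : M ∈ 𝒜.smashDomain t) :
    h.emb t ⟨M, hM⟩ = Skew.of θ t ⟨ι ⟨M, GroupGrading.smashDomain_le hA t hM⟩,
      h.mem_D_iff.2 hM⟩ := rfl

theorem emb_injective (h : IsSmashCorner hA θ ι) (t : G) : Function.Injective (h.emb t) := by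
  intro M N hMN
  have h1 := congrArg (Skew.coeff θ t) hMN
  rw [← Subtype.coe_eta M M.2, ← Subtype.coe_eta N N.2, emb_apply, emb_apply, Skew.coeff_of_same,
    Skew.coeff_of_same] at h1
  have h2 := congrArg Subtype.val (h.injective (congrArg Subtype.val h1))
  exact Subtype.ext h2

/-- On the corner, $\theta$ is the restriction of the global action $\beta$ by shifts, and
$\beta_s(\beta_{s^{-1}}(M)N)=M\beta_s(N)$. The skew product is thereby computed with ordinary matrix
products: $(M\delta_s)(N\delta_t)=M\beta_s(N)\delta_{st}$. -/
theorem emb_mul (h : IsSmashCorner hA θ ι) {s t r : G} (hr : s * t = r) {M N L : FMat G A}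
    (hM : M ∈ 𝒜.smashDomain s) (hN : N ∈ 𝒜.smashDomain t) (hL : L ∈ 𝒜.smashDomain r)
    (hMN : M * FMat.shift k s N = L) :
    h.emb s ⟨M, hM⟩ * h.emb t ⟨N, hN⟩ = h.emb r ⟨L, hL⟩ := by
  have hM' : FMat.shift k s⁻¹ M ∈ 𝒜.smashDomain s⁻¹ :=
    GroupGrading.shift_mem_smashDomain hA s⁻¹ (by rwa [inv_inv])
  have hM1 : M ∈ 𝒜.partialSmash := GroupGrading.smashDomain_le hA s hM
  have hN1 : N ∈ 𝒜.partialSmash := GroupGrading.smashDomain_le hA t hN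
  have hL1 : L ∈ 𝒜.partialSmash := GroupGrading.smashDomain_le hA r hL
  have hM2 : FMat.shift k s⁻¹ M ∈ 𝒜.partialSmash := GroupGrading.smashDomain_le hA _ hM'
  refine Skew.of_mul_of hr ?_
  change θ.act s (θ.act s⁻¹ (ι ⟨M, hM1⟩) * ι ⟨N, hN1⟩) = ι ⟨L, hL1⟩
  rw [h.act_eq (x := ⟨M, hM1⟩) (y := ⟨_, hM2⟩) (by rwa [inv_inv]) rfl, ← h.map_mul]
  refine h.act_eq ?_ ?_
  · have h1 := mul_mem_sprod hM' hN
    have h2 : 𝒜.smashDomain s⁻¹ ⊡ 𝒜.smashDomain t ≤ 𝒜.smashDomain s⁻¹ := by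
      rw [GroupGrading.smashDomain_comm hA]
      exact (sprod_mono (GroupGrading.smashDomain_le hA t) le_rfl).trans
        (GroupGrading.one_smashDomain hA _).le
    exact h2 h1
  · change L = FMat.shift k s (FMat.shift k s⁻¹ M * N)
    rw [FMat.shift_mul, FMat.shift_shift, mul_inv_cancel, FMat.shift_one, hMN]

theorem single_mem_smashDomain (hA : 𝒜.IsPartiallyStrong) {t r s : G} {z : A}
    (hz : z ∈ 𝒜.comp r⁻¹ ⊡ (𝒜.D t ⊡ 𝒜.comp s)) : FMat.single (r, s) z ∈ 𝒜.smashDomain t := by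
  rw [GroupGrading.smashDomain_eq hA]
  exact FMat.single_mem hz

theorem single_mem_smashDomain_one (hA : 𝒜.IsPartiallyStrong) {r s : G} {z : A}
    (hz : z ∈ 𝒜.comp r⁻¹ ⊡ 𝒜.comp s) : FMat.single (r, s) z ∈ 𝒜.smashDomain 1 := by
  rw [GroupGrading.smashDomain_one hA]
  exact FMat.single_mem hz

theorem comp_sprod_D_sprod (hA : 𝒜.IsPartiallyStrong) (r t : G) :
    𝒜.comp r ⊡ (𝒜.D t ⊡ 𝒜.comp t) = 𝒜.comp r ⊡ 𝒜.comp t := by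
  rw [GroupGrading.D_comp hA]

theorem comp_sprod_one (hA : 𝒜.IsPartiallyStrong) (t : G) : 𝒜.comp t ⊡ 𝒜.comp 1 = 𝒜.comp t := by
  apply le_antisymm
  · simpa using GroupGrading.sprod_comp_le (𝒜 := 𝒜) t 1
  · calc 𝒜.comp t = 𝒜.comp t ⊡ 𝒜.D t⁻¹ := by
          conv_lhs => rw [hA t]
          rw [GroupGrading.D, inv_inv, sprod_assoc]
      _ ≤ _ := sprod_mono le_rfl (GroupGrading.D_le _)

theorem single_one_mem (hA : 𝒜.IsPartiallyStrong) {t : G} {z : A} (hz : z ∈ 𝒜.comp t) :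
    FMat.single (1, t) z ∈ 𝒜.smashDomain t := by
  refine single_mem_smashDomain hA ?_
  rwa [comp_sprod_D_sprod hA, inv_one, GroupGrading.one_comp hA]

theorem single_column_mem (hA : 𝒜.IsPartiallyStrong) {r : G} {z : A} (hz : z ∈ 𝒜.comp r⁻¹) :
    FMat.single (r, 1) z ∈ 𝒜.smashDomain 1 := by
  refine single_mem_smashDomain_one hA ?_
  rwa [comp_sprod_one hA]

theorem single_row_mem (hA : 𝒜.IsPartiallyStrong) {s : G} {z : A} (hz : z ∈ 𝒜.comp s) :
    FMat.single (1, s) z ∈ 𝒜.smashDomain 1 := by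
  refine single_mem_smashDomain_one hA ?_
  rwa [inv_one, GroupGrading.one_comp hA]

/-- The component of degree `t` of the embedding of `A`. -/
noncomputable def rowEmb (h : IsSmashCorner hA θ ι) (t : G) : 𝒜.comp t →ₗ[k] θ.D t :=
  LinearMap.codRestrict (θ.D t)
    (ι ∘ₗ LinearMap.codRestrict 𝒜.partialSmash.toSubmodule
      ((Finsupp.lsingle (1, t) : A →ₗ[k] FMat G A) ∘ₗ (𝒜.comp t).subtype)
      fun z => GroupGrading.smashDomain_le hA t (single_one_mem hA z.2))
    fun z => h.mem_D_iff.2 (single_one_mem hA z.2)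

theorem of_rowEmb (h : IsSmashCorner hA θ ι) (t : G) (z : 𝒜.comp t) :
    Skew.of θ t (h.rowEmb t z) = h.emb t ⟨FMat.single (1, t) z, single_one_mem hA z.2⟩ := rfl

theorem single_injective (p : G × G) : Function.Injective (FMat.single p : A → FMat G A) :=
  Finsupp.single_injective p

theorem rowEmb_injective (h : IsSmashCorner hA θ ι) (t : G) :
    Function.Injective (h.rowEmb t) := by
  intro z w hzw
  have h1 := congrArg (Skew.of θ t) hzw
  rw [of_rowEmb, of_rowEmb] at h1
  exact Subtype.ext (single_injective _ (congrArg Subtype.val (h.emb_injective t h1)))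

open Classical in
/-- The decomposition of `A` in its components. -/
noncomputable def decompose (𝒜 : GroupGrading k G A) :
    A ≃ₗ[k] DirectSum G fun t => 𝒜.comp t :=
  (LinearEquiv.ofBijective (DirectSum.coeLinearMap 𝒜.comp)
    (DirectSum.isInternal_submodule_of_iSupIndep_of_iSup_eq_top 𝒜.indep 𝒜.iSup_eq_top)).symm

/-- The embedding `a ↦ a e_{1,t} δₜ` (`a ∈ Aₜ`) of `A` in the skew group ring. -/
noncomputable def toSkew (h : IsSmashCorner hA θ ι) : A →ₗ[k] θ.Skew :=
  (DirectSum.lmap h.rowEmb : (DirectSum G fun t => 𝒜.comp t) →ₗ[k] θ.Skew) ∘ₗ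
    (decompose 𝒜).toLinearMap

theorem toSkew_injective (h : IsSmashCorner hA θ ι) : Function.Injective h.toSkew :=
  ((DirectSum.lmap_injective h.rowEmb).2 h.rowEmb_injective).comp (decompose 𝒜).injective

theorem toSkew_apply (h : IsSmashCorner hA θ ι) {t : G} {z : A} (hz : z ∈ 𝒜.comp t) :
    h.toSkew z = h.emb t ⟨FMat.single (1, t) z, single_one_mem hA hz⟩ := by
  classical
  have h1 : decompose 𝒜 z = DirectSum.lof k G (fun t => 𝒜.comp t) t ⟨z, hz⟩ := by
    rw [decompose, LinearEquiv.symm_apply_eq]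
    exact (DirectSum.coeLinearMap_lof 𝒜.comp t ⟨z, hz⟩).symm
  refine (congrArg (DirectSum.lmap h.rowEmb) h1).trans ?_
  exact DirectSum.lmap_lof h.rowEmb t ⟨z, hz⟩

/-- The position $(1,t)$ in degree $t$ is chosen so that
$e_{1,s}\,\beta_s(e_{1,t})=e_{1,s}e_{s,st}=e_{1,st}$. -/
theorem toSkew_mul (h : IsSmashCorner hA θ ι) (x y : A) :
    h.toSkew (x * y) = h.toSkew x * h.toSkew y := by
  have hx : x ∈ ⨆ t, 𝒜.comp t := by rw [𝒜.iSup_eq_top]; trivial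
  have hy : y ∈ ⨆ t, 𝒜.comp t := by rw [𝒜.iSup_eq_top]; trivial
  induction hx using Submodule.iSup_induction' with
  | zero => simp only [zero_mul, map_zero]
  | add x x' _ _ hx hx' => simp only [add_mul, map_add, hx, hx']
  | mem s x hx =>
  induction hy using Submodule.iSup_induction' with
  | zero => simp only [mul_zero, map_zero]
  | add x x' _ _ hx hx' => simp only [mul_add, map_add, hx, hx']
  | mem t y hy =>
  rw [h.toSkew_apply hx, h.toSkew_apply hy, h.toSkew_apply (𝒜.mul_mem s t x y hx hy)]
  exact (h.emb_mul rfl _ _ _ (FMat.single_mul_shift_single (p := (1, s)) (q := (1, t))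
    (mul_one s).symm rfl x y)).symm

/-- The corner in degree `t`. -/
noncomputable def comp (h : IsSmashCorner hA θ ι) (t : G) : Submodule k θ.Skew :=
  LinearMap.range (h.emb t)

/-- Each domain is the sum of its single-entry parts, so inclusions may be tested on single-entry
matrices. -/
theorem comp_le (h : IsSmashCorner hA θ ι) {t : G} {W : Submodule k θ.Skew}
    (hW : ∀ r s z, ∀ hz : z ∈ 𝒜.comp r⁻¹ ⊡ (𝒜.D t ⊡ 𝒜.comp s),
      h.emb t ⟨FMat.single (r, s) z, single_mem_smashDomain hA hz⟩ ∈ W) : h.comp t ≤ W := by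
  have h1 : 𝒜.smashDomain t ≤ (W.comap (h.emb t)).map (𝒜.smashDomain t).subtype := by
    conv_lhs => rw [GroupGrading.smashDomain_eq hA]
    exact FMat.entrywise_le fun p z hz => ⟨⟨_, single_mem_smashDomain hA hz⟩, hW _ _ z hz, rfl⟩
  rintro _ ⟨M, rfl⟩
  obtain ⟨N, hN, hNM⟩ := h1 M.2
  rw [← Subtype.ext hNM]
  exact hN

theorem map_toSkew_le (h : IsSmashCorner hA θ ι) (t : G) :
    (𝒜.comp t).map h.toSkew ≤ h.comp t := by
  rintro _ ⟨z, hz, rfl⟩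
  rw [h.toSkew_apply hz]
  exact ⟨_, rfl⟩

/-- To check that all `z e_{r,s} δₜ` with `z ∈ U V` lie in `W`, it suffices to do so for products. -/
theorem emb_single_mem (h : IsSmashCorner hA θ ι) {t r s : G} {U V : Submodule k A}
    {W : Submodule k θ.Skew} (hUV : U ⊡ V ≤ 𝒜.comp r⁻¹ ⊡ (𝒜.D t ⊡ 𝒜.comp s))
    (hW : ∀ x (_ : x ∈ U) y (_ : y ∈ V) (hxy : FMat.single (r, s) (x * y) ∈ 𝒜.smashDomain t),
      h.emb t ⟨_, hxy⟩ ∈ W) {z : A} (hz : z ∈ U ⊡ V)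
    (hz' : FMat.single (r, s) z ∈ 𝒜.smashDomain t) : h.emb t ⟨_, hz'⟩ ∈ W := by
  refine (sprod_induction (p := fun z => ∃ hz : FMat.single (r, s) z ∈ 𝒜.smashDomain t,
    h.emb t ⟨_, hz⟩ ∈ W) ?_ ?_ hz).2
  · intro x hx y hy
    have h1 := single_mem_smashDomain hA (hUV (mul_mem_sprod hx hy))
    exact ⟨h1, hW x hx y hy h1⟩
  · rintro x y ⟨hx, hx'⟩ ⟨hy, hy'⟩
    have h1 : FMat.single (r, s) (x + y) ∈ 𝒜.smashDomain t := by
      rw [FMat.single_add]; exact add_mem hx hy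
    refine ⟨h1, ?_⟩
    have h2 : (⟨_, h1⟩ : 𝒜.smashDomain t) = ⟨_, hx⟩ + ⟨_, hy⟩ :=
      Subtype.ext (FMat.single_add _ x y)
    rw [h2, map_add]
    exact add_mem hx' hy'

/-- The product of $z\,e_{r,s}\delta_t$ and $a\,e_{1,1}\delta_1$ is zero unless $s=t$, when it is
$za\,e_{r,t}\delta_t$ with $za\in A_{r^{-1}}A_t$. A product $xy$ in $A_{r^{-1}}A_t$ then splits as
$x\,e_{r,1}\delta_1\cdot y\,e_{1,t}\delta_t$. -/
theorem comp_sprod_row (h : IsSmashCorner hA θ ι) (t : G) :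
    h.comp t ⊡ (𝒜.comp 1).map h.toSkew ≤ h.comp 1 ⊡ (𝒜.comp t).map h.toSkew := by
  rw [sprod_le]
  rintro w hw _ ⟨a, ha, rfl⟩
  refine h.comp_le (W := (h.comp 1 ⊡ (𝒜.comp t).map h.toSkew).comap
    (LinearMap.mulRight k (h.toSkew a))) (fun r s z hz => ?_) hw
  rw [Submodule.mem_comap, LinearMap.mulRight_apply, h.toSkew_apply ha]
  by_cases hst : s = t
  · subst hst
    have hza : z * a ∈ 𝒜.comp r⁻¹ ⊡ 𝒜.comp s := by
      have h1 := mul_mem_sprod hz ha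
      rw [comp_sprod_D_sprod hA, sprod_assoc, comp_sprod_one hA] at h1
      exact h1
    have hza' : z * a ∈ 𝒜.comp r⁻¹ ⊡ (𝒜.D s ⊡ 𝒜.comp s) := by rwa [comp_sprod_D_sprod hA]
    rw [h.emb_mul (mul_one s) _ _ (single_mem_smashDomain hA hza')
      (FMat.single_mul_shift_single (by simp) (by simp) _ _)]
    refine h.emb_single_mem (comp_sprod_D_sprod hA _ _).ge ?_ hza _
    intro x hx y hy hxy
    rw [← h.emb_mul (one_mul s) (single_column_mem hA hx) (single_one_mem hA hy) hxy
      (FMat.single_mul_shift_single (by simp) (by simp) _ _)]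
    exact mul_mem_sprod ⟨_, rfl⟩ ⟨y, hy, h.toSkew_apply hy⟩
  · rw [h.emb_mul (mul_one t) _ _ (zero_mem _)
      (FMat.single_mul_shift_single_of_ne (by simpa using hst) _ _)]
    have h2 : (⟨0, zero_mem _⟩ : 𝒜.smashDomain t) = 0 := rfl
    rw [h2, map_zero]
    exact zero_mem _

/-- Only $r=1$ contributes, giving $az\,e_{1,s}\delta_t$ with $az\in A_tA_{t^{-1}}A_s$. Here the
degree is split off on the left: for $x\in A_t$ and $y\in A_{t^{-1}}A_s$, the factors are
$x\,e_{1,t}\delta_t$ and $y\,e_{1,t^{-1}s}\delta_1$. -/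
theorem row_sprod_comp (h : IsSmashCorner hA θ ι) (t : G) :
    (𝒜.comp 1).map h.toSkew ⊡ h.comp t ≤ (𝒜.comp t).map h.toSkew ⊡ h.comp 1 := by
  rw [sprod_le]
  rintro _ ⟨a, ha, rfl⟩ w hw
  refine h.comp_le (W := ((𝒜.comp t).map h.toSkew ⊡ h.comp 1).comap
    (LinearMap.mulLeft k (h.toSkew a))) (fun r s z hz => ?_) hw
  rw [Submodule.mem_comap, LinearMap.mulLeft_apply, h.toSkew_apply ha]
  by_cases hr : r = 1
  · subst hr
    have haz' : a * z ∈ 𝒜.comp 1⁻¹ ⊡ (𝒜.D t ⊡ 𝒜.comp s) := by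
      have h1 := mul_mem_sprod ha hz
      rw [inv_one, ← sprod_assoc, GroupGrading.one_comp hA] at h1
      rwa [inv_one]
    have haz : a * z ∈ 𝒜.comp t ⊡ (𝒜.comp t⁻¹ ⊡ 𝒜.comp s) := by
      rw [inv_one, ← sprod_assoc, GroupGrading.one_D hA, GroupGrading.D, sprod_assoc] at haz'
      exact haz'
    rw [h.emb_mul (one_mul t) _ _ (single_mem_smashDomain hA haz')
      (FMat.single_mul_shift_single (by simp) (by simp) _ _)]
    refine h.emb_single_mem (le_of_eq ?_) ?_ haz _
    · rw [inv_one, ← sprod_assoc (𝒜.comp 1), GroupGrading.one_D hA, GroupGrading.D, sprod_assoc]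
    intro x hx y hy hxy
    -- Now $y\in A_{t^{-1}s}$, which is what an entry at $(1,t^{-1}s)$ requires; $\beta_t$ moves
    -- that position to $(t,s)$.
    have hy' := GroupGrading.sprod_comp_le _ _ hy
    rw [← h.emb_mul (mul_one t) (single_one_mem hA hx) (single_row_mem hA hy') hxy
      (FMat.single_mul_shift_single (by simp) (by simp) _ _)]
    exact mul_mem_sprod ⟨x, hx, h.toSkew_apply hx⟩ ⟨_, rfl⟩
  · rw [h.emb_mul (one_mul t) _ _ (zero_mem _)
      (FMat.single_mul_shift_single_of_ne (by simpa [eq_comm] using hr) _ _)]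
    have h2 : (⟨0, zero_mem _⟩ : 𝒜.smashDomain t) = 0 := rfl
    rw [h2, map_zero]
    exact zero_mem _

/-- An entry in $A_{r^{-1}}A_1A_s$ at $(r,s)$ factors through the position $(1,1)$, as
$x\,e_{r,1}\cdot u\,e_{1,1}\cdot v\,e_{1,s}$. This is fullness of the corner. -/
theorem comp_full (h : IsSmashCorner hA θ ι) :
    h.comp 1 ≤ h.comp 1 ⊡ ((𝒜.comp 1).map h.toSkew ⊡ h.comp 1) := by
  refine h.comp_le fun r s z hz => ?_
  have e : 𝒜.comp r⁻¹ ⊡ (𝒜.D 1 ⊡ 𝒜.comp s) = 𝒜.comp r⁻¹ ⊡ (𝒜.comp 1 ⊡ 𝒜.comp s) := by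
    rw [GroupGrading.D_one hA]
  rw [e] at hz
  refine h.emb_single_mem e.ge ?_ hz _
  intro x hx y hy hxy
  have hxy' : FMat.single (r, s) (x * y) ∈ 𝒜.smashDomain 1 := hxy
  have key : ∀ y ∈ 𝒜.comp 1 ⊡ 𝒜.comp s, ∀ hy : FMat.single (1, s) y ∈ 𝒜.smashDomain 1,
      h.emb 1 ⟨_, hy⟩ ∈ (𝒜.comp 1).map h.toSkew ⊡ h.comp 1 := by
    intro y hy hy'
    refine h.emb_single_mem (le_of_eq ?_) ?_ hy hy'
    · rw [inv_one, GroupGrading.D_one hA, GroupGrading.one_comp hA, GroupGrading.one_comp hA]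
    intro u hu v hv huv
    rw [← h.emb_mul (one_mul 1) (single_one_mem hA hu) (single_row_mem hA hv) huv
      (FMat.single_mul_shift_single (by simp) (by simp) _ _)]
    exact mul_mem_sprod ⟨u, hu, h.toSkew_apply hu⟩ ⟨_, rfl⟩
  have hy' : y ∈ 𝒜.comp s := by rwa [GroupGrading.one_comp hA] at hy
  rw [← h.emb_mul (one_mul 1) (single_column_mem hA hx) (single_row_mem hA hy') hxy'
    (FMat.single_mul_shift_single (by simp) (by simp) _ _)]
  exact mul_mem_sprod ⟨_, rfl⟩ (key y hy _)

theorem row_comp_row (h : IsSmashCorner hA θ ι) :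
    (𝒜.comp 1).map h.toSkew ⊡ (h.comp 1 ⊡ (𝒜.comp 1).map h.toSkew) ≤
      (𝒜.comp 1).map h.toSkew := by
  rw [sprod_le]
  rintro _ ⟨a, ha, rfl⟩ w hw
  suffices h1 : h.comp 1 ⊡ (𝒜.comp 1).map h.toSkew ≤
      ((𝒜.comp 1).map h.toSkew).comap (LinearMap.mulLeft k (h.toSkew a)) from h1 hw
  clear hw w
  rw [sprod_le]
  rintro w hw _ ⟨b, hb, rfl⟩
  refine h.comp_le (W := ((𝒜.comp 1).map h.toSkew).comap (LinearMap.mulLeft k (h.toSkew a) ∘ₗ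
    (LinearMap.mulRight k (h.toSkew b)))) (fun r s z hz => ?_) hw
  rw [Submodule.mem_comap, LinearMap.comp_apply, LinearMap.mulLeft_apply,
    LinearMap.mulRight_apply, h.toSkew_apply ha, h.toSkew_apply hb]
  have h0 : (⟨0, zero_mem _⟩ : 𝒜.smashDomain 1) = 0 := rfl
  rw [GroupGrading.D_one hA, GroupGrading.one_comp hA] at hz
  by_cases hs : s = 1
  · subst hs
    have hzb : z * b ∈ 𝒜.comp r⁻¹ := by
      have h1 := mul_mem_sprod hz hb
      rwa [comp_sprod_one hA, comp_sprod_one hA] at h1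
    rw [h.emb_mul (one_mul 1) _ _ (single_column_mem hA hzb)
      (FMat.single_mul_shift_single (by simp) (by simp) _ _)]
    by_cases hr : r = 1
    · subst hr
      rw [inv_one] at hzb
      have hazb : a * (z * b) ∈ 𝒜.comp 1 := by
        have h1 := mul_mem_sprod ha hzb
        rwa [comp_sprod_one hA] at h1
      rw [h.emb_mul (one_mul 1) _ _ (single_one_mem hA hazb)
        (FMat.single_mul_shift_single (by simp) (by simp) _ _)]
      exact ⟨_, hazb, h.toSkew_apply hazb⟩
    · rw [h.emb_mul (one_mul 1) _ _ (zero_mem _)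
        (FMat.single_mul_shift_single_of_ne (by simpa [eq_comm] using hr) _ _), h0, map_zero]
      exact zero_mem _
  · rw [h.emb_mul (one_mul 1) _ _ (zero_mem _)
      (FMat.single_mul_shift_single_of_ne (by simpa using hs) _ _), h0, map_zero, mul_zero]
    exact zero_mem _

end IsSmashCorner

end SmashCorners

/-! ### Two corners of a partial action linked by a Morita equivalence. -/

section LinkedCorners

variable {k : Type uk} {G : Type uG} {C : Type uX} [CommRing k] [Group G]
    [NonUnitalRing C] [Module k C] [IsScalarTower k C C] [SMulCommClass k C C]

open ProductPartialAction

namespace ProductPartialAction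

variable (θ : ProductPartialAction k G C)

/-- The elements `a δₜ` of the partial skew group ring with `a ∈ U ∩ Dₜ`. -/
noncomputable def degree (t : G) (U : Submodule k C) : Submodule k θ.Skew :=
  (U.comap (θ.D t).subtype).map (Skew.of θ t)

variable {θ}

theorem degree_sprod_le {s t r : G} (hr : s * t = r) {U V W : Submodule k C}
    (h : ∀ u ∈ U, u ∈ θ.D s → ∀ v ∈ V, v ∈ θ.D t → θ.act s (θ.act s⁻¹ u * v) ∈ W) :
    θ.degree s U ⊡ θ.degree t V ≤ θ.degree r W := by
  rw [sprod_le]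
  rintro _ ⟨u, hu, rfl⟩ _ ⟨v, hv, rfl⟩
  have h1 : θ.act s (θ.act s⁻¹ u * v) ∈ θ.D r :=
    hr ▸ θ.sprod_le_right _ _ (twisted_mem u.2 v.2)
  rw [Skew.of_mul_of hr (c := ⟨_, h1⟩) rfl]
  exact ⟨_, h u hu u.2 v hv v.2, rfl⟩

theorem twisted_one (u v : C) : θ.act 1 (θ.act 1⁻¹ u * v) = u * v := by
  rw [inv_one, act_one, act_one]

theorem degree_mono (t : G) {U V : Submodule k C} (h : U ≤ V) : θ.degree t U ≤ θ.degree t V :=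
  Submodule.map_mono (Submodule.comap_mono h)

/-- In degree one the skew product is the product of `C`, as $\theta_1$ is the identity of the whole
algebra. -/
theorem degree_one_sprod (U V : Submodule k C) :
    θ.degree 1 U ⊡ θ.degree 1 V = θ.degree 1 (U ⊡ V) := by
  apply le_antisymm
  · refine degree_sprod_le (mul_one 1) fun u hu _ v hv _ => ?_
    rw [twisted_one]
    exact mul_mem_sprod hu hv
  · rintro _ ⟨⟨z, hz1⟩, hz, rfl⟩
    refine (sprod_induction (p := fun z => ∃ hz : z ∈ θ.D 1,
      Skew.of θ 1 ⟨z, hz⟩ ∈ θ.degree 1 U ⊡ θ.degree 1 V) ?_ ?_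
        (show z ∈ U ⊡ V from hz)).2
    · intro u hu v hv
      refine ⟨mem_D_one _, ?_⟩
      rw [← Skew.of_mul_of (mul_one 1) (a := ⟨u, mem_D_one u⟩) (b := ⟨v, mem_D_one v⟩)
        (twisted_one u v)]
      exact mul_mem_sprod ⟨_, hu, rfl⟩ ⟨_, hv, rfl⟩
    · rintro x y ⟨hx, hx'⟩ ⟨hy, hy'⟩
      exact ⟨add_mem hx hy, (map_add (Skew.of θ 1) ⟨x, hx⟩ ⟨y, hy⟩) ▸ add_mem hx' hy'⟩

end ProductPartialAction

/-- Two corners `E 1`, `F 1` of an algebra with a product partial action `θ`, linked by a Morita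
equivalence `X`, `Y` which intertwines the domains `E t`, `F t` of the restrictions of `θ`. -/
structure LinkedCorners (θ : ProductPartialAction k G C) (E F : G → Submodule k C)
    (X Y : Submodule k C) : Prop where
  E_le : ∀ t, E t ≤ θ.D t
  F_le : ∀ t, F t ≤ θ.D t
  XY : X ⊡ Y = E 1
  YX : Y ⊡ X = F 1
  EX : E 1 ⊡ X = X
  XF : X ⊡ F 1 = X
  FY : F 1 ⊡ Y = Y
  YE : Y ⊡ E 1 = Y
  E_idem : ∀ t, E t ⊡ E t = E t
  F_idem : ∀ t, F t ⊡ F t = F t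
  E_le_one : ∀ t, E t ≤ E 1
  F_le_one : ∀ t, F t ≤ F 1
  act_E : ∀ t, ∀ x ∈ E t⁻¹, θ.act t x ∈ E t
  act_F : ∀ t, ∀ x ∈ F t⁻¹, θ.act t x ∈ F t
  YEX : ∀ t, Y ⊡ (E t ⊡ X) = F t
  XFY : ∀ t, X ⊡ (F t ⊡ Y) = E t
  mem_E : ∀ t, E 1 ⊓ θ.D t ≤ E t
  mem_F : ∀ t, F 1 ⊓ θ.D t ≤ F t
  ECF : E 1 ⊡ (⊤ ⊡ F 1) ≤ X
  FCE : F 1 ⊡ (⊤ ⊡ E 1) ≤ Y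

namespace LinkedCorners

variable {θ : ProductPartialAction k G C} {E F : G → Submodule k C} {X Y : Submodule k C}

theorem symm (h : LinkedCorners θ E F X Y) : LinkedCorners θ F E Y X :=
  ⟨h.F_le, h.E_le, h.YX, h.XY, h.FY, h.YE, h.EX, h.XF, h.F_idem, h.E_idem, h.F_le_one, h.E_le_one, h.act_F, h.act_E, h.XFY, h.YEX,
    h.mem_F, h.mem_E, h.FCE, h.ECF⟩

/-- Since $E_1=XY$ and $YE_tX=F_t$, idempotence gives $E_tX\subseteq E_tX(YE_tX)=E_tXF_t$. Repeating
this yields a factorization in which every factor lies in an ideal on which $\theta_{t^{-1}}$ is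
defined. -/
theorem E_sprod_X_le (h : LinkedCorners θ E F X Y) (t : G) :
    E t ⊡ X ≤ E t ⊡ (E t ⊡ X ⊡ F t ⊡ F t) := by
  have h1 : E t ⊡ X ≤ E t ⊡ X ⊡ F t := by
    calc E t ⊡ X = E t ⊡ (E t ⊡ X) := by rw [← sprod_assoc, h.E_idem]
      _ ≤ E t ⊡ (E 1 ⊡ (E t ⊡ X)) := by
          refine sprod_mono le_rfl ?_
          conv_lhs => rw [← h.E_idem t]
          rw [sprod_assoc]
          exact sprod_mono (h.E_le_one t) le_rfl
      _ = E t ⊡ (X ⊡ (Y ⊡ (E t ⊡ X))) := by rw [← h.XY]; simp only [sprod_assoc]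
      _ = _ := by rw [h.YEX, sprod_assoc]
  calc E t ⊡ X ≤ E t ⊡ X ⊡ F t := h1
    _ ≤ E t ⊡ X ⊡ F t ⊡ F t := sprod_mono h1 le_rfl
    _ = E t ⊡ (E t ⊡ X ⊡ F t ⊡ F t) := by
        conv_lhs => rw [← h.E_idem t]
        simp only [sprod_assoc]

/-- It is not assumed that $\theta$ preserves the bimodule corner. By `E_sprod_X_le` the element is
a sum of products $avb$ with $a\in E_{t^{-1}}$, $b\in F_{t^{-1}}$ and $v$ in the domain of
$\theta_t$. Hence $\theta_t(avb)=\theta_t(a)\theta_t(v)\theta_t(b)\in E_1CF_1\subseteq X$, whatever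
$\theta_t(v)$ is. -/
theorem act_mul_mem_X (h : LinkedCorners θ E F X Y) {t : G} {u x : C} (hu : u ∈ E t⁻¹)
    (hx : x ∈ X) : θ.act t (u * x) ∈ X := by
  have key := h.E_sprod_X_le t⁻¹ (mul_mem_sprod hu hx)
  refine (sprod_induction (p := fun z => z ∈ θ.D t⁻¹ ∧ θ.act t z ∈ X) ?_ ?_ key).2
  · intro a ha w hw
    have hw' : w ∈ θ.D t⁻¹ ∧ θ.act t w ∈ (⊤ : Submodule k C) ⊡ F 1 := by
      refine sprod_induction (p := fun z => z ∈ θ.D t⁻¹ ∧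
        θ.act t z ∈ (⊤ : Submodule k C) ⊡ F 1) ?_ ?_ hw
      · intro v hv b hb
        have hv' : v ∈ θ.D t⁻¹ := by
          have h1 : E t⁻¹ ⊡ X ⊡ F t⁻¹ ≤ θ.D t⁻¹ :=
            sprod_le.2 fun c _ d hd => θ.mul_mem_left _ c d (h.F_le _ hd)
          exact h1 hv
        have hb' := h.F_le _ hb
        refine ⟨θ.mul_mem_left _ v b hb', ?_⟩
        rw [act_mul hv' hb']
        exact mul_mem_sprod trivial (h.F_le_one t (h.act_F t b hb))
      · rintro y z ⟨hy, hy'⟩ ⟨hz, hz'⟩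
        exact ⟨add_mem hy hz, act_add hy hz ▸ add_mem hy' hz'⟩
    have ha' := h.E_le _ ha
    refine ⟨θ.mul_mem_left _ a w hw'.1, ?_⟩
    rw [act_mul ha' hw'.1]
    exact h.ECF (mul_mem_sprod (h.E_le_one t (h.act_E t a ha)) hw'.2)
  · rintro y z ⟨hy, hy'⟩ ⟨hz, hz'⟩
    exact ⟨add_mem hy hz, act_add hy hz ▸ add_mem hy' hz'⟩

/-- Multiplying $E_t\delta_t$ by $X$ stays in $X\delta_t$, by `act_mul_mem_X`. Multiplying then by
$Y$ on the left gives coefficients in $YX=F_1$ which also lie in the domain of degree $t$, hence in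
$F_t$. -/
theorem degree_YEX (h : LinkedCorners θ E F X Y) (t : G) :
    θ.degree 1 Y ⊡ (θ.degree t (E t) ⊡ θ.degree 1 X) ≤ θ.degree t (F t) := by
  have h1 : θ.degree t (E t) ⊡ θ.degree 1 X ≤ θ.degree t X :=
    degree_sprod_le (mul_one t) fun u hu _ x hx _ =>
      h.act_mul_mem_X (h.act_E t⁻¹ u (by rwa [inv_inv])) hx
  refine (sprod_mono le_rfl h1).trans (degree_sprod_le (one_mul t) fun y hy _ x hx hx' => ?_)
  rw [twisted_one]
  refine h.mem_F t ⟨?_, θ.mul_mem_left t y x hx'⟩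
  rw [← h.YX]
  exact mul_mem_sprod hy hx

theorem fullCorners (h : LinkedCorners θ E F X Y) {a b : G → Submodule k θ.Skew}
    (ha : IsPartiallyStrongFamily a) (hb : IsPartiallyStrongFamily b)
    (a_le : ∀ t, a t ≤ θ.degree t (E t)) (b_le : ∀ t, b t ≤ θ.degree t (F t))
    (Ia : ∀ t, θ.degree t (E t) ⊡ a 1 ≤ θ.degree 1 (E 1) ⊡ a t)
    (Jb : ∀ t, θ.degree t (F t) ⊡ b 1 ≤ θ.degree 1 (F 1) ⊡ b t)
    (aI : ∀ t, a 1 ⊡ θ.degree t (E t) ≤ a t ⊡ θ.degree 1 (E 1))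
    (bJ : ∀ t, b 1 ⊡ θ.degree t (F t) ≤ b t ⊡ θ.degree 1 (F 1))
    (I_full : θ.degree 1 (E 1) ≤ θ.degree 1 (E 1) ⊡ (a 1 ⊡ θ.degree 1 (E 1)))
    (J_full : θ.degree 1 (F 1) ≤ θ.degree 1 (F 1) ⊡ (b 1 ⊡ θ.degree 1 (F 1)))
    (a_corner : a 1 ⊡ (θ.degree 1 (E 1) ⊡ a 1) ≤ a 1)
    (b_corner : b 1 ⊡ (θ.degree 1 (F 1) ⊡ b 1) ≤ b 1) :
    FullCorners (fun t => θ.degree t (E t)) (fun t => θ.degree t (F t)) a b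
      (θ.degree 1 X) (θ.degree 1 Y) where
  left := ha
  right := hb
  XY := by rw [degree_one_sprod, h.XY]
  YX := by rw [degree_one_sprod, h.YX]
  IX := by rw [degree_one_sprod, h.EX]
  XJ := by rw [degree_one_sprod, h.XF]
  JY := by rw [degree_one_sprod, h.FY]
  YI := by rw [degree_one_sprod, h.YE]
  a_le := a_le
  b_le := b_le
  YIX := h.degree_YEX
  XJY := h.symm.degree_YEX
  Ia := Ia
  Jb := Jb
  aI := aI
  bJ := bJ
  I_full := I_full
  J_full := J_full
  a_corner := a_corner
  b_corner := b_corner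

end LinkedCorners

end LinkedCorners

/-! ### From a Morita equivalence of partial actions to a strong-graded-equivalence. -/

section PartialToGraded

variable {k : Type uk} {G : Type uG} {A : Type uA} {B : Type uB} [CommRing k] [Group G]
    [NonUnitalRing A] [Module k A] [IsScalarTower k A A] [SMulCommClass k A A]
    [NonUnitalRing B] [Module k B] [IsScalarTower k B B] [SMulCommClass k B B]
    {𝒜 : GroupGrading k G A} {ℬ : GroupGrading k G B}

open ProductPartialAction

theorem IsSmashCorner.comp_eq_degree {C : Type uX} [NonUnitalRing C] [Module k C]
    [IsScalarTower k C C] [SMulCommClass k C C] {hA : 𝒜.IsPartiallyStrong}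
    {θ : ProductPartialAction k G C} {ι : 𝒜.partialSmash →ₗ[k] C} (h : IsSmashCorner hA θ ι)
    (t : G) : h.comp t = θ.degree t ((𝒜.smashIdeal t).map ι) := by
  apply le_antisymm
  · rintro _ ⟨M, rfl⟩
    exact ⟨_, ⟨⟨M.1, GroupGrading.smashDomain_le hA t M.2⟩, M.2, rfl⟩, rfl⟩
  · rintro _ ⟨⟨z, hz⟩, ⟨x, hx, hxz⟩, rfl⟩
    exact ⟨⟨x.1, hx⟩, congrArg (Skew.of θ t) (Subtype.ext hxz)⟩

theorem IsSmashCorner.act_mem {C : Type uX} [NonUnitalRing C] [Module k C]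
    [IsScalarTower k C C] [SMulCommClass k C C] {hA : 𝒜.IsPartiallyStrong}
    {θ : ProductPartialAction k G C} {ι : 𝒜.partialSmash →ₗ[k] C} (h : IsSmashCorner hA θ ι)
    (t : G) : ∀ x ∈ (𝒜.smashIdeal t⁻¹).map ι, θ.act t x ∈ (𝒜.smashIdeal t).map ι := by
  rintro _ ⟨x, hx, rfl⟩
  exact ⟨(𝒜.canonicalPartialAction hA).α t ⟨x, hx⟩, Subtype.prop _, (h.act_eq hx rfl).symm⟩

theorem smashIdeal_one (hA : 𝒜.IsPartiallyStrong) : 𝒜.smashIdeal 1 = ⊤ :=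
  (𝒜.canonicalPartialAction hA).D_one

theorem smashIdeal_idem (hA : 𝒜.IsPartiallyStrong) (t : G) :
    𝒜.smashIdeal t ⊡ 𝒜.smashIdeal t = 𝒜.smashIdeal t :=
  (𝒜.canonicalPartialAction hA).D_idem t

theorem one_sprod_smashIdeal_sprod_one (hA : 𝒜.IsPartiallyStrong) (t : G) :
    𝒜.smashIdeal 1 ⊡ (𝒜.smashIdeal t ⊡ 𝒜.smashIdeal 1) = 𝒜.smashIdeal t := by
  have hle : 𝒜.smashIdeal t ≤ 𝒜.smashIdeal 1 := by
    rw [smashIdeal_one hA]; exact le_top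
  apply le_antisymm
  · exact (sprod_mono le_rfl ((𝒜.canonicalPartialAction hA).sprod_le_left t 1)).trans
      ((𝒜.canonicalPartialAction hA).sprod_le_right 1 t)
  · calc 𝒜.smashIdeal t = 𝒜.smashIdeal t ⊡ (𝒜.smashIdeal t ⊡ 𝒜.smashIdeal t) := by
          rw [smashIdeal_idem hA, smashIdeal_idem hA]
      _ ≤ _ := sprod_mono hle (sprod_mono le_rfl hle)

theorem linkedCorners {X : Type uX} {Y : Type uY} [AddCommGroup X] [Module k X]
    [AddCommGroup Y] [Module k Y] (hA : 𝒜.IsPartiallyStrong) (hB : ℬ.IsPartiallyStrong)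
    {M : MoritaContext k 𝒜.partialSmash ℬ.partialSmash X Y} {θ : ProductPartialAction k G M.Ctx}
    (hM : M.IsEquivalence)
    (hD : ∀ t, Submodule.map₂ M.τB (Submodule.map₂ M.rY ⊤ (𝒜.smashIdeal t)) ⊤ = ℬ.smashIdeal t)
    (h : IsSmashCorner hA θ M.cornerA) (h' : IsSmashCorner hB θ M.cornerB) :
    LinkedCorners θ (fun t => (𝒜.smashIdeal t).map M.cornerA)
      (fun t => (ℬ.smashIdeal t).map M.cornerB) ((⊤ : Submodule k X).map M.cornerX)
      ((⊤ : Submodule k Y).map M.cornerY) := by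
  have XY : (⊤ : Submodule k X).map M.cornerX ⊡ (⊤ : Submodule k Y).map M.cornerY =
      (𝒜.smashIdeal 1).map M.cornerA := by
    rw [← map_map₂_eq_sprod M.τA _ _ _ M.cornerA_τA, hM.τA_surjective, smashIdeal_one hA]
  have YEX (t : G) : (⊤ : Submodule k Y).map M.cornerY ⊡ ((𝒜.smashIdeal t).map M.cornerA ⊡
      (⊤ : Submodule k X).map M.cornerX) = (ℬ.smashIdeal t).map M.cornerB := by
    rw [← hD t, map_map₂_eq_sprod M.τB _ _ _ M.cornerB_τB,
      map_map₂_eq_sprod M.rY _ _ _ M.cornerY_rY, sprod_assoc]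
  exact
  { E_le := by
      rintro t _ ⟨x, hx, rfl⟩
      exact h.mem_D_iff.2 hx
    F_le := by
      rintro t _ ⟨x, hx, rfl⟩
      exact h'.mem_D_iff.2 hx
    XY := XY
    YX := by
      rw [← map_map₂_eq_sprod M.τB _ _ _ M.cornerB_τB, hM.τB_surjective, smashIdeal_one hB]
    EX := by
      rw [← map_map₂_eq_sprod M.lX _ _ _ M.cornerX_lX, smashIdeal_one hA, hM.lX_unital]
    XF := by
      rw [← map_map₂_eq_sprod M.rX _ _ _ M.cornerX_rX, smashIdeal_one hB, hM.rX_unital]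
    FY := by
      rw [← map_map₂_eq_sprod M.lY _ _ _ M.cornerY_lY, smashIdeal_one hB, hM.lY_unital]
    YE := by
      rw [← map_map₂_eq_sprod M.rY _ _ _ M.cornerY_rY, smashIdeal_one hA, hM.rY_unital]
    E_idem := fun t => by rw [← map_sprod _ M.cornerA_mul, smashIdeal_idem hA]
    F_idem := fun t => by rw [← map_sprod _ M.cornerB_mul, smashIdeal_idem hB]
    E_le_one := fun t => Submodule.map_mono (by rw [smashIdeal_one hA]; exact le_top)
    F_le_one := fun t => Submodule.map_mono (by rw [smashIdeal_one hB]; exact le_top)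
    act_E := h.act_mem
    act_F := h'.act_mem
    YEX := YEX
    XFY := fun t => by
      have e (U V W : Submodule k M.Ctx) : U ⊡ (V ⊡ (W ⊡ U) ⊡ V) = U ⊡ V ⊡ (W ⊡ (U ⊡ V)) := by
        simp only [sprod_assoc]
      -- The mirror condition is a consequence of the given one: $XF_tY=(XY)E_t(XY)=E_1E_tE_1=E_t$.
      rw [← YEX, e, XY, ← map_sprod _ M.cornerA_mul, ← map_sprod _ M.cornerA_mul,
        one_sprod_smashIdeal_sprod_one hA]
    mem_E := by
      rintro t _ ⟨⟨x, -, rfl⟩, hx⟩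
      exact ⟨x, h.mem_D_iff.1 hx, rfl⟩
    mem_F := by
      rintro t _ ⟨⟨x, -, rfl⟩, hx⟩
      exact ⟨x, h'.mem_D_iff.1 hx, rfl⟩
    ECF := by
      rw [sprod_le]
      rintro _ ⟨a, -, rfl⟩ w hw
      -- Right multiplication by the second diagonal corner kills the first column; left
      -- multiplication by the first corner then leaves only the upper right block.
      have h1 : (⊤ : Submodule k M.Ctx) ⊡ (ℬ.smashIdeal 1).map M.cornerB ≤
          LinearMap.ker M.projA ⊓ LinearMap.ker M.projY := by
        rw [sprod_le]
        rintro c - _ ⟨b, -, rfl⟩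
        constructor <;> simp
      have h2 : w.a = 0 := (h1 hw).1
      have h3 : w.y = 0 := (h1 hw).2
      exact ⟨M.lX a w.x, trivial, by apply MoritaContext.Ctx.ext <;> simp [h2]⟩
    FCE := by
      rw [sprod_le]
      rintro _ ⟨b, -, rfl⟩ w hw
      have h1 : (⊤ : Submodule k M.Ctx) ⊡ (𝒜.smashIdeal 1).map M.cornerA ≤
          LinearMap.ker M.projB ⊓ LinearMap.ker M.projX := by
        rw [sprod_le]
        rintro c - _ ⟨a, -, rfl⟩
        constructor <;> simp
      have h2 : w.b = 0 := (h1 hw).1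
      have h3 : w.x = 0 := (h1 hw).2
      exact ⟨M.lY b w.y, trivial, by apply MoritaContext.Ctx.ext <;> simp [h2, h3]⟩ }

theorem degree_le_range {C : Type uX} [NonUnitalRing C] [Module k C] [IsScalarTower k C C]
    [SMulCommClass k C C] (θ : ProductPartialAction k G C) (t : G) (U : Submodule k C) :
    θ.degree t U ≤ LinearMap.range (Skew.of θ t) := LinearMap.map_le_range

/-- All factors but `a t` have degree one, so each product is homogeneous of degree $t$ in the skew
group ring, and distinct degrees are independent. -/
theorem iSupIndep_sprod {C : Type uX} [NonUnitalRing C] [Module k C] [IsScalarTower k C C]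
    [SMulCommClass k C C] {θ : ProductPartialAction k G C} {a b : G → Submodule k θ.Skew}
    {E F : G → Submodule k C} (ha : ∀ t, a t ≤ θ.degree t (E t))
    (hb : ∀ t, b t ≤ θ.degree t (F t)) (X : Submodule k C) :
    iSupIndep fun t => a t ⊡ (a 1 ⊡ (θ.degree 1 X ⊡ b 1)) := by
  have h (s t r : G) (hr : s * t = r) : θ.degree s ⊤ ⊡ θ.degree t ⊤ ≤ θ.degree r ⊤ :=
    degree_sprod_le hr fun _ _ _ _ _ _ => trivial
  refine Skew.iSupIndep_of_le_range fun t => le_trans ?_ (degree_le_range θ t ⊤)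
  refine (sprod_mono ((ha t).trans (degree_mono t le_top)) ?_).trans (h t 1 t (mul_one t))
  refine (sprod_mono ((ha 1).trans (degree_mono 1 le_top)) ?_).trans (h 1 1 1 (mul_one 1))
  exact (sprod_mono (degree_mono 1 le_top) ((hb 1).trans (degree_mono 1 le_top))).trans
    (h 1 1 1 (mul_one 1))

theorem stronglyGradedEquivalent_of_moritaEquivalent (hA : 𝒜.IsPartiallyStrong)
    (hB : ℬ.IsPartiallyStrong)
    (H : (𝒜.canonicalPartialAction hA).MoritaEquivalent (ℬ.canonicalPartialAction hB)) :
    StronglyGradedEquivalent 𝒜 ℬ := by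
  obtain ⟨X, Y, _, _, _, _, M, θ, hM, hD, hrA, hrB⟩ := H
  have h : IsSmashCorner hA θ M.cornerA := ⟨M.cornerA_mul, M.cornerA_injective, hrA⟩
  have h' : IsSmashCorner hB θ M.cornerB := ⟨M.cornerB_mul, M.cornerB_injective, hrB⟩
  have L := linkedCorners hA hB hM hD h h'
  have aI := h.map_toSkew_le
  have bJ := h'.map_toSkew_le
  have a1 := h.comp_sprod_row
  have a2 := h.row_sprod_comp
  have a3 := h.comp_full
  have a4 := h.row_comp_row
  have b1 := h'.comp_sprod_row
  have b2 := h'.row_sprod_comp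
  have b3 := h'.comp_full
  have b4 := h'.row_comp_row
  -- The corner relations were obtained from matrices over $A$; here they are restated for the
  -- homogeneous parts of the skew group ring with coefficients in the embedded ideals, the form in
  -- which the linked corners supply $I$ and $J$.
  simp only [h.comp_eq_degree] at aI a1 a2 a3 a4
  simp only [h'.comp_eq_degree] at bJ b1 b2 b3 b4
  have K := L.fullCorners (GroupGrading.isPartiallyStrongFamily_map hA _ h.toSkew_mul)
    (GroupGrading.isPartiallyStrongFamily_map hB _ h'.toSkew_mul) aI bJ a1 b1 a2 b2 a3 b3 a4 b4
  exact K.cornerEquivalence.stronglyGradedEquivalent h.toSkew_mul h'.toSkew_mul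
    h.toSkew_injective h'.toSkew_injective (iSupIndep_sprod aI bJ _) (iSupIndep_sprod bJ aI _)

end PartialToGraded

end GradedMorita

theorem mainTheorem6 {k : Type uk} {G : Type uG} {A : Type uA} {B : Type uB}
    [CommRing k] [Group G]
    [NonUnitalRing A] [Module k A] [IsScalarTower k A A] [SMulCommClass k A A]
    [NonUnitalRing B] [Module k B] [IsScalarTower k B B] [SMulCommClass k B B]
    (𝒜 : GradedMorita.GroupGrading k G A) (ℬ : GradedMorita.GroupGrading k G B)
    (hA : 𝒜.IsPartiallyStrong) (hB : ℬ.IsPartiallyStrong) :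
    GradedMorita.StronglyGradedEquivalent 𝒜 ℬ ↔
      (𝒜.canonicalPartialAction hA).MoritaEquivalent (ℬ.canonicalPartialAction hB) := 
  ⟨fun h => h.moritaEquivalent hA hB,
    GradedMorita.stronglyGradedEquivalent_of_moritaEquivalent hA hB⟩
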